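/- **Setting.** Let $n\ge 3$, let $U\subseteq\mathbb R^n$ be open (a coordinate domain of spacetime) and let $p\in U$. A *generalized Kerr–Schild family* on $U$ consists of a smooth Lorentzian metric $\bar g$ of signature $(-,+,\dots,+)$ (the background), a smooth nowhere vanishing $1$-form $k$ with $\bar g^{ab}k_ak_b=0$, and functions $H_\mu$ depending on finitely many parameters $\mu=(\mu_1,\dots,\mu_J)$, which may be functions on spacetime. The full metric is $g_\mu=\bar g-2H_\mu\,k\otimes k$; $\bar g$ and $k$ do not depend on $\mu$, and $H_0=0$. The set of admissible parameter values contains a nonzero value and contains $t\mu$ for $t\in[0,1]$ whenever it contains $\mu$, and $(t,x)\mapsto H_{t\mu}(x)$ is smooth on $[0,1]\times U$. Put $k^a=\bar g^{ab}k_b$ $(=g_\mu^{ab}k_b)$. Assume that $k$ is geodesic. $\bar R_{ab}$ and $R_{ab}=R_{ab}(\mu)$ denote the Ricci tensors of $\bar g$ and $g_\mu$; everything below is at the point $p$. A *null frame* is a basis $(m_0,m_1,m_2,\dots,m_{n-1})$ with $m_0,m_1$ null, $m_0\cdot m_1=1$ and $m_2,\dots,m_{n-1}$ orthonormal and orthogonal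 to $m_0,m_1$. The component $T_{ab}=T(m_a,m_b)$ has boost weight $w(a)+w(b)$, where $w(0)=1$, $w(1)=-1$, $w(i)=0$ for $i\ge2$. The *multiplicity* of a null direction $l$ with respect to $T$ is the largest $m$ such that in null frames with $m_0=l$ all components of boost weight $>2-m$ vanish ($\infty$ if $T=0$); $l$ is an *aligned null direction* (AND) if its multiplicity is at least $1$, and a multiple AND if it is at least $2$. A symmetric tensor $T$ has type $G$: no AND; $I$: exactly one AND, which is single; $I_i$: at least two single ANDs and no multiple AND; $II$: a double AND and no other AND; $II_i$: exactly one double AND, all other ANDs single, and at least one of these; $D$: at least two double ANDs; $III$: a triple AND and no other AND; $III_i$: a triple AND and at least one single AND; $N$: a quadruple AND; $O$: $T=0$. A null direction $l\ne k$ of $g_\mu$ is represented by the null vector with $l\cdot k=1$; put $\bar l^a=l^a-H_\mu k^a$. A null direction $l\neq k$ of the full geometry is understood to be such that $\bar l$ does not depend on the parameters, i.e. it is the family $l_\mu=\bar l+H_\mu k$; its multiplicity with respect to the full Ricci tensor is considered for all nonzero values of the parameters. **(1)** Let $\tau\ge1$. If, for all admissible $\mu\ne0$, $k$ is an AND of $R_{ab}(\mu)$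 of multiplicity $\tau$ (or at least $\tau$), then $k$ is an AND of $\bar R_{ab}$ and its multiplicity $\bar\tau$ satisfies $\bar\tau\ge\tau$. **(2)** Let $\chi\ge1$. If, for all admissible $\mu\ne0$, $l_\mu\ne k$ is an AND of $R_{ab}(\mu)$ of multiplicity $\chi$ (or at least $\chi$), where $\bar l=l_\mu-H_\mu k$ is independent of $\mu$, then $\bar l$ is null for $\bar g$ and is an AND of $\bar R_{ab}$ whose multiplicity $\bar\chi$ satisfies $\bar\chi\ge\chi$. **(3)** Let $\mu\neq0$ be an admissible parameter value which is generic, in the sense that the multiplicities of $k$ and of every $\bar l+H_\mu k$ with respect to $R_{ab}(\mu)$ do not exceed those of $k$ and $\bar l+H_\nu k$ with respect to $R_{ab}(\nu)$, for every admissible $\nu\ne0$. Then $\bar R_{ab}$ and $R_{ab}(\mu)$ each have exactly one of the above types, the type of $R_{ab}(\mu)$ does not come after that of $\bar R_{ab}$ in the list $G, I, I_i, II, II_i, D, III, III_i, N, O$ of increasing specialness, and the two types, with their ANDs, form one of the following combinations (in particular, type $I$ does not occur). Here $\bar l,\bar l_1,\dots$ are ANDs of $\bar R_{ab}$ distinct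 from $k$, and $l,l_1,\dots$ are the corresponding directions of the full geometry; different $\bar l_j$ of the same multiplicity are distinct. Further ANDs are allowed unless excluded explicitly or by the type. * Background $G$: full $G$. * Background $I_i$. If $k$ is not an AND and $\bar l_1,\bar l_2$ are single: full $G$; or $I_i$ with $l_1,l_2$ single and $k$ not an AND. If $k,\bar l$ are single: full $I_i$ with $k,l$ single. * Background $II$. If $k$ is not an AND and $\bar l$ is double: full $G$; or $II$ with $l$ double. If $k$ is double: full $II$ with $k$ double. (No other ANDs.) * Background $II_i$. If $k$ is not an AND, $\bar l_1$ is double and $\bar l_2$ single: full $G$; $I_i$ with $l_2,l_3$ single, $\bar l_3$ a single AND of the background, $k,l_1$ not ANDs; $II$ with $l_1$ double and no other ANDs; $I_i$ or $II_i$ with $l_1$ respectively single or double, $l_2$ single, $k$ not an AND. If $k$ is single and $\bar l$ double: full $I_i$ with $k$ single; or $II_i$ with $k$ single and $l$ double. If $k$ is double and $\bar l$ single: full $II$ with $k$ double and no other ANDs; or $II_i$ with $k$ double and $l$ single. * Background $D$. If $k$ is not an AND and $\bar l_1,\bar l_2$ are double: full $G$; $I_i$ with $l_1,l_2$ single, $k$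 not an AND; $I_i$ with $l_1,l_3$ single, $\bar l_3$ a single AND of the background, $k,l_2$ not ANDs $(*)$; $I_i$ with $l_3,l_4$ single, $\bar l_3,\bar l_4$ single ANDs of the background, $k,l_1,l_2$ not ANDs $(*)$; $II$ with $l_1$ double and no other ANDs; $II_i$ with $l_1$ double, $l_2$ single, $k$ not an AND; $II_i$ with $l_1$ double, $l_3$ single, $\bar l_3$ a single AND of the background, $k,l_2$ not ANDs $(*)$; $D$ with $l_1,l_2$ double, $k$ not an AND. If $k$ is single and $\bar l_1,\bar l_2$ are double $(*)$: full $I_i$ with $k$ single; $II_i$ with $k$ single and $l_1$ the only double AND; $D$ with $k$ single and $l_1,l_2$ double. If $k,\bar l$ are double: full $II$ with $k$ double and no other ANDs; $II_i$ with $k$ the only double AND and $l$ single; $II_i$ with $k$ the only double AND, $l'$ single, $\bar l'$ a single AND of the background, $l$ not an AND $(*)$; $D$ with $k,l$ double. The cases marked $(*)$ occur only for $n>3$. * Background $III$. If $k$ is not an AND and $\bar l$ is triple: full $G$; or $II$, $III$ with $l$ respectively double, triple and no other ANDs. If $k$ is triple: full $II$, $III$ with $k$ respectively double, triple and no other ANDs.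 * Background $III_i$. If $k$ is not an AND, $\bar l_1$ is triple and $\bar l_2$ single: full $G$; $I_i$ with $l_2,l_3$ single, $\bar l_3$ a single AND of the background, $k,l_1$ not ANDs; $II$, $III$ with $l_1$ respectively double, triple and no other ANDs; $I_i$, $II_i$, $III_i$ with $l_1$ respectively single, double, triple, $l_2$ single, $k$ not an AND. If $k$ is single and $\bar l$ triple: full $I_i$ with $k$ single; $II_i$, $III_i$ with $k$ single and $l$ respectively double, triple. If $k$ is triple and $\bar l$ single: full $II$, $III$ with $k$ respectively double, triple and no other ANDs; $II_i$, $III_i$ with $k$ respectively double, triple and $l$ single. * Background $N$. If $k$ is not an AND and $\bar l$ is quadruple: full $G$; or $II$, $III$, $N$ with $l$ respectively double, triple, quadruple and no other ANDs. If $k$ is quadruple: full $II$, $III$, $N$ with $k$ respectively double, triple, quadruple and no other ANDs. * Background $O$: full $II$, $II_i$, $D$ with $k$ double; $III$, $III_i$ with $k$ triple; $N$ with $k$ quadruple; or $O$. -/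

import Mathlib

open scoped Matrix ContDiff

namespace GKS

/-! ## Coordinates, metrics, curvature -/

/-- Points of a coordinate domain, tangent vectors `v^a` and covectors `v_a`, all given by their
components. -/
abbrev Coord (n : ℕ) : Type := Fin n → ℝ

/-- Components `T_{ab}` of a covariant tensor of rank two at a point. -/
abbrev Tensor2 (n : ℕ) : Type := Matrix (Fin n) (Fin n) ℝ

/-- `T(v, w) = T_{ab} v^a w^b`. -/
def contract {n : ℕ} (T : Tensor2 n) (v w : Coord n) : ℝ := ∑ a, ∑ b, T a b * v a * w b

/-- The partial derivative `∂_c f` at `x`. -/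
noncomputable def pd {n : ℕ} (c : Fin n) (f : Coord n → ℝ) (x : Coord n) : ℝ :=
  fderiv ℝ f x (Pi.single c 1)

/-- Signature `(-,+,…,+)`: there is a basis that is orthonormal with exactly one timelike vector
(linear independence and the symmetry of `G` follow from the Gram matrix). -/
def IsLorentzian {n : ℕ} (G : Tensor2 n) : Prop :=
  ∃ e : Fin n → Coord n, ∀ a b, contract G (e a) (e b) =
    if a = b then (if a.val = 0 then -1 else 1) else 0

/-- Christoffel symbols `Γ^a_{bc} = ½ g^{ad} (∂_b g_{dc} + ∂_c g_{db} - ∂_d g_{bc})`. -/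
noncomputable def christoffel {n : ℕ} (g : Coord n → Tensor2 n) (a b c : Fin n) (x : Coord n) : ℝ :=
  (1 / 2) * ∑ d, (g x)⁻¹ a d *
    (pd b (fun y => g y d c) x + pd c (fun y => g y d b) x - pd d (fun y => g y b c) x)

/-- The Ricci tensor
`R_{bc} = ∂_a Γ^a_{bc} - ∂_c Γ^a_{ba} + Γ^a_{ad} Γ^d_{bc} - Γ^a_{cd} Γ^d_{ba}`. -/
noncomputable def ricci {n : ℕ} (g : Coord n → Tensor2 n) (x : Coord n) : Tensor2 n :=
  Matrix.of fun b c =>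
    (∑ a, pd a (christoffel g a b c) x) - (∑ a, pd c (christoffel g a b a) x)
    + (∑ a, ∑ d, christoffel g a a d x * christoffel g d b c x)
    - ∑ a, ∑ d, christoffel g a c d x * christoffel g d b a x

/-- The covariant derivative `∇_b w_a = ∂_b w_a - Γ^c_{ab} w_c` of a covector field. -/
noncomputable def covDeriv {n : ℕ} (g : Coord n → Tensor2 n) (w : Coord n → Coord n)
    (b a : Fin n) (x : Coord n) : ℝ :=
  pd b (fun y => w y a) x - ∑ c, christoffel g c a b x * w x c

/-! ## Null frames, boost weights, aligned null directions, Ricci types -/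

/-- A null vector (nonzero, as it has to define a direction). -/
def IsNull {n : ℕ} (G : Tensor2 n) (l : Coord n) : Prop := l ≠ 0 ∧ contract G l l = 0

/-- `F = (m₀, m₁, m₂, …)` is a null frame: `m₀`, `m₁` are null, `m₀ · m₁ = 1`, and the `m_i`,
`i ≥ 2`, are orthonormal and orthogonal to `m₀` and `m₁`. -/
def IsNullFrame {n : ℕ} (G : Tensor2 n) (F : Fin n → Coord n) : Prop :=
  ∀ a b, contract G (F a) (F b) =
    if a.val + b.val = 1 then 1 else if a = b ∧ 2 ≤ a.val then 1 else 0

/-- The boost weight of a frame index: `+1` for `0`, `-1` for `1`, and `0` for `i ≥ 2`.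
The boost weight of a component `T_{ab}` is the sum over its indices. -/
def boostWeight {n : ℕ} (a : Fin n) : ℤ :=
  if a.val = 0 then 1 else if a.val = 1 then -1 else 0

/-- In null frames with `m₀ = l`, all components of `T` of boost weight greater than `2 - m`
vanish, i.e. the boost order of `T` along `l` is at most `2 - m`. -/
def AlignedToOrder {n : ℕ} (G T : Tensor2 n) (l : Coord n) (m : ℕ) : Prop :=
  ∀ F : Fin n → Coord n, IsNullFrame G F → (∀ a : Fin n, a.val = 0 → F a = l) →
    ∀ a b, 2 - (m : ℤ) < boostWeight a + boostWeight b → contract T (F a) (F b) = 0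

/-- The multiplicity of the null direction `l` with respect to `T`: two minus the boost order of
`T` along `l`.  It is `0` if `l` is not aligned with `T`, lies in `{1, 2, 3, 4}` if `l` is aligned
with a nonzero `T`, and is `⊤` for `T = 0`. -/
noncomputable def mult {n : ℕ} (G T : Tensor2 n) (l : Coord n) : ℕ∞ :=
  ⨆ (m : ℕ) (_ : AlignedToOrder G T l m), (m : ℕ∞)

/-- Two nonzero vectors define the same direction. -/
def SameDir {n : ℕ} (l l' : Coord n) : Prop := ∃ c : ℝ, l' = c • l

/-- Algebraic types of a symmetric rank two tensor. -/
inductive RicciType where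
  | G | I | Ii | II | IIi | D | III | IIIi | N | O

/-- Position in the list of types by increasing specialness. -/
def RicciType.rank : RicciType → ℕ
  | .G => 0 | .I => 1 | .Ii => 2 | .II => 3 | .IIi => 4 | .D => 5 | .III => 6 | .IIIi => 7
  | .N => 8 | .O => 9

/-- `T` is of the given algebraic type with respect to the metric `G`. -/
def HasType {n : ℕ} (G T : Tensor2 n) : RicciType → Prop
  | .G => ∀ l, IsNull G l → mult G T l = 0
  | .I => ∃ l, IsNull G l ∧ mult G T l = 1 ∧
      ∀ l', IsNull G l' → ¬ SameDir l l' → mult G T l' = 0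
  | .Ii => (∃ l l', IsNull G l ∧ IsNull G l' ∧ ¬ SameDir l l' ∧ mult G T l = 1 ∧ mult G T l' = 1) ∧
      ∀ l, IsNull G l → mult G T l ≤ 1
  | .II => ∃ l, IsNull G l ∧ mult G T l = 2 ∧
      ∀ l', IsNull G l' → ¬ SameDir l l' → mult G T l' = 0
  | .IIi => ∃ l, IsNull G l ∧ mult G T l = 2 ∧
      (∃ l', IsNull G l' ∧ mult G T l' = 1) ∧
      ∀ l', IsNull G l' → ¬ SameDir l l' → mult G T l' ≤ 1
  | .D => ∃ l l', IsNull G l ∧ IsNull G l' ∧ ¬ SameDir l l' ∧ mult G T l = 2 ∧ mult G T l' = 2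
  | .III => ∃ l, IsNull G l ∧ mult G T l = 3 ∧
      ∀ l', IsNull G l' → ¬ SameDir l l' → mult G T l' = 0
  | .IIIi => (∃ l, IsNull G l ∧ mult G T l = 3) ∧ ∃ l', IsNull G l' ∧ mult G T l' = 1
  | .N => ∃ l, IsNull G l ∧ mult G T l = 4
  | .O => T = 0

/-! ## Generalized Kerr–Schild families -/

/-- A generalized Kerr–Schild family `g_μ = ḡ - 2 H_μ k ⊗ k` on the coordinate domain `U`, with
parameters `μ = (μ_α)`, `α = 1, …, J`, which may be local (functions on spacetime).  The background
`ḡ` and the null 1-form `k` do not depend on `μ`, and `H` vanishes for `μ = 0`. -/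
structure Family (n J : ℕ) (U : Set (Coord n)) where
  /-- the background metric `ḡ_{ab}` -/
  gbar : Coord n → Tensor2 n
  gbar_smooth : ∀ a b, ContDiffOn ℝ ∞ (fun x => gbar x a b) U
  gbar_lorentzian : ∀ x ∈ U, IsLorentzian (gbar x)
  /-- the 1-form `k_a` -/
  k : Coord n → Coord n
  k_smooth : ∀ a, ContDiffOn ℝ ∞ (fun x => k x a) U
  k_ne_zero : ∀ x ∈ U, k x ≠ 0
  k_null : ∀ x ∈ U, contract ((gbar x)⁻¹) (k x) (k x) = 0
  /-- the admissible values of the parameters; they can be scaled down to zero -/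
  params : Set (Fin J → Coord n → ℝ)
  params_scale : ∀ μ ∈ params, ∀ t ∈ Set.Icc (0 : ℝ) 1, t • μ ∈ params
  params_nontrivial : ∃ μ ∈ params, μ ≠ 0
  /-- the scalar function `H_μ` -/
  H : (Fin J → Coord n → ℝ) → Coord n → ℝ
  H_zero : ∀ x ∈ U, H 0 x = 0
  H_smooth : ∀ μ ∈ params,
    ContDiffOn ℝ ∞ (fun q : ℝ × Coord n => H (q.1 • μ) q.2) (Set.Icc (0 : ℝ) 1 ×ˢ U)

namespace Family

variable {n J : ℕ} {U : Set (Coord n)} (S : Family n J U)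

/-- The full metric `g_μ = ḡ - 2 H_μ k ⊗ k`. -/
def g (μ : Fin J → Coord n → ℝ) (x : Coord n) : Tensor2 n :=
  Matrix.of fun a b => S.gbar x a b - 2 * S.H μ x * S.k x a * S.k x b

/-- The vector `k^a = ḡ^{ab} k_b`. -/
noncomputable def kVec (x : Coord n) : Coord n := fun a => ∑ b, (S.gbar x)⁻¹ a b * S.k x b

/-- `k` is geodesic (not necessarily affinely parametrized): `k^b ∇̄_b k_a ∝ k_a`. -/
def IsGeodesic : Prop :=
  ∀ x ∈ U, ∃ f : ℝ, ∀ a, ∑ b, S.kVec x b * covDeriv S.gbar S.k b a x = f * S.k x a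

/-- Multiplicity of a null direction at `p` with respect to the background Ricci tensor. -/
noncomputable def multBg (p : Coord n) (l : Coord n) : ℕ∞ :=
  mult (S.gbar p) (ricci S.gbar p) l

/-- Multiplicity of a null direction at `p` with respect to the Ricci tensor of `g_μ`. -/
noncomputable def multFull (μ : Fin J → Coord n → ℝ) (p : Coord n) (l : Coord n) : ℕ∞ :=
  mult (S.g μ p) (ricci (S.g μ) p) l

/-- The null directions of `ḡ` at `p` that are distinct from `k`, each represented by its
unique null vector `l̄` with `l̄ · k = 1`. -/
def Dir (p : Coord n) : Type :=
  {l : Coord n // IsNull (S.gbar p) l ∧ ∑ a, S.k p a * l a = 1}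

/-- The counterpart `l = l̄ + H_μ k` of `l̄` in the full geometry. -/
noncomputable def lift (μ : Fin J → Coord n → ℝ) (p : Coord n) (l : S.Dir p) : Coord n :=
  l.1 + S.H μ p • S.kVec p

/-- `μ` is a nonzero generic parameter value at `p`: the alignment of `k` and of the directions
`l = l̄ + H k`, `l̄` independent of the parameters, with the Ricci tensor of `g_μ` is not special
to the value `μ` but is present for all nonzero values of the parameters. -/
def IsGeneric (p : Coord n) (μ : Fin J → Coord n → ℝ) : Prop :=
  μ ∈ S.params ∧ μ ≠ 0 ∧ ∀ ν ∈ S.params, ν ≠ 0 →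
    S.multFull μ p (S.kVec p) ≤ S.multFull ν p (S.kVec p) ∧
    ∀ l : S.Dir p, S.multFull μ p (S.lift μ p l) ≤ S.multFull ν p (S.lift ν p l)

end Family

/-! ## The table of allowed combinations -/

/-- All allowed combinations of the background type with the type of the full geometry, together
with the multiplicities `kb`, `lb` of `k` and of the directions `l̄ ≠ k` for the background, and
`kf`, `lf` of `k` and of the corresponding directions `l` for the full geometry.  Multiplicity `0`
means that the direction is not aligned.  Each constructor is one entry of the table; type `D`
tensors with a single aligned direction do not occur for `n = 3`. -/
inductive RicciTable (n : ℕ) {ι : Type} (kb kf : ℕ∞) (lb lf : ι → ℕ∞) :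
    RicciType → RicciType → Prop
  -- background `G`
  | G_G (hkb : kb = 0) (hlb : ∀ l, lb l = 0) (hkf : kf = 0) (hlf : ∀ l, lf l = 0) :
      RicciTable n kb kf lb lf .G .G
  -- background `I_i`, `k` not aligned
  | Ii_G (l₁ l₂ : ι) (hne : l₁ ≠ l₂) (hkb : kb = 0) (h₁ : lb l₁ = 1) (h₂ : lb l₂ = 1)
      (hkf : kf = 0) (hlf : ∀ l, lf l = 0) : RicciTable n kb kf lb lf .Ii .G
  | Ii_Ii (l₁ l₂ : ι) (hne : l₁ ≠ l₂) (hkb : kb = 0) (h₁ : lb l₁ = 1) (h₂ : lb l₂ = 1)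
      (hkf : kf = 0) (hf₁ : lf l₁ = 1) (hf₂ : lf l₂ = 1) : RicciTable n kb kf lb lf .Ii .Ii
  -- background `I_i`, `k` single
  | Ii_Ii_k (l : ι) (hkb : kb = 1) (h : lb l = 1) (hkf : kf = 1) (hf : lf l = 1) :
      RicciTable n kb kf lb lf .Ii .Ii
  -- background `II`, `k` not aligned
  | II_G (l : ι) (hkb : kb = 0) (h : lb l = 2) (ho : ∀ l', l' ≠ l → lb l' = 0)
      (hkf : kf = 0) (hlf : ∀ l, lf l = 0) : RicciTable n kb kf lb lf .II .G
  | II_II (l : ι) (hkb : kb = 0) (h : lb l = 2) (ho : ∀ l', l' ≠ l → lb l' = 0)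
      (hkf : kf = 0) (hf : lf l = 2) (hfo : ∀ l', l' ≠ l → lf l' = 0) :
      RicciTable n kb kf lb lf .II .II
  -- background `II`, `k` double
  | II_II_k (hkb : kb = 2) (hlb : ∀ l, lb l = 0) (hkf : kf = 2) (hlf : ∀ l, lf l = 0) :
      RicciTable n kb kf lb lf .II .II
  -- background `II_i`, `k` not aligned
  | IIi_G (l₁ l₂ : ι) (hkb : kb = 0) (h₁ : lb l₁ = 2) (h₂ : lb l₂ = 1)
      (hkf : kf = 0) (hlf : ∀ l, lf l = 0) : RicciTable n kb kf lb lf .IIi .G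
  | IIi_Ii (l₁ l₂ l₃ : ι) (hne : l₂ ≠ l₃) (hkb : kb = 0) (h₁ : lb l₁ = 2) (h₂ : lb l₂ = 1)
      (h₃ : lb l₃ = 1) (hkf : kf = 0) (hf₁ : lf l₁ = 0) (hf₂ : lf l₂ = 1) (hf₃ : lf l₃ = 1) :
      RicciTable n kb kf lb lf .IIi .Ii
  | IIi_II (l₁ l₂ : ι) (hkb : kb = 0) (h₁ : lb l₁ = 2) (h₂ : lb l₂ = 1)
      (hkf : kf = 0) (hf₁ : lf l₁ = 2) (hfo : ∀ l, l ≠ l₁ → lf l = 0) :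
      RicciTable n kb kf lb lf .IIi .II
  | IIi_Ii' (l₁ l₂ : ι) (hkb : kb = 0) (h₁ : lb l₁ = 2) (h₂ : lb l₂ = 1)
      (hkf : kf = 0) (hf₁ : lf l₁ = 1) (hf₂ : lf l₂ = 1) : RicciTable n kb kf lb lf .IIi .Ii
  | IIi_IIi (l₁ l₂ : ι) (hkb : kb = 0) (h₁ : lb l₁ = 2) (h₂ : lb l₂ = 1)
      (hkf : kf = 0) (hf₁ : lf l₁ = 2) (hf₂ : lf l₂ = 1) : RicciTable n kb kf lb lf .IIi .IIi
  -- background `II_i`, `k` single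
  | IIi_Ii_k1 (l : ι) (hkb : kb = 1) (h : lb l = 2) (hkf : kf = 1) (hlf : ∀ l, lf l ≤ 1) :
      RicciTable n kb kf lb lf .IIi .Ii
  | IIi_IIi_k1 (l : ι) (hkb : kb = 1) (h : lb l = 2) (hkf : kf = 1) (hf : lf l = 2) :
      RicciTable n kb kf lb lf .IIi .IIi
  -- background `II_i`, `k` double
  | IIi_II_k2 (l : ι) (hkb : kb = 2) (h : lb l = 1) (hkf : kf = 2) (hlf : ∀ l, lf l = 0) :
      RicciTable n kb kf lb lf .IIi .II
  | IIi_IIi_k2 (l : ι) (hkb : kb = 2) (h : lb l = 1) (hkf : kf = 2) (hf : lf l = 1) :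
      RicciTable n kb kf lb lf .IIi .IIi
  -- background `D`, `k` not aligned
  | D_G (l₁ l₂ : ι) (hne : l₁ ≠ l₂) (hkb : kb = 0) (h₁ : lb l₁ = 2) (h₂ : lb l₂ = 2)
      (hkf : kf = 0) (hlf : ∀ l, lf l = 0) : RicciTable n kb kf lb lf .D .G
  | D_Ii (l₁ l₂ : ι) (hne : l₁ ≠ l₂) (hkb : kb = 0) (h₁ : lb l₁ = 2) (h₂ : lb l₂ = 2)
      (hkf : kf = 0) (hf₁ : lf l₁ = 1) (hf₂ : lf l₂ = 1) : RicciTable n kb kf lb lf .D .Ii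
  | D_Ii' (hn : 3 < n) (l₁ l₂ l₃ : ι) (hne : l₁ ≠ l₂) (hkb : kb = 0) (h₁ : lb l₁ = 2)
      (h₂ : lb l₂ = 2) (h₃ : lb l₃ = 1) (hkf : kf = 0) (hf₁ : lf l₁ = 1) (hf₂ : lf l₂ = 0)
      (hf₃ : lf l₃ = 1) : RicciTable n kb kf lb lf .D .Ii
  | D_Ii'' (hn : 3 < n) (l₁ l₂ l₃ l₄ : ι) (hne : l₁ ≠ l₂) (hne' : l₃ ≠ l₄) (hkb : kb = 0)
      (h₁ : lb l₁ = 2) (h₂ : lb l₂ = 2) (h₃ : lb l₃ = 1) (h₄ : lb l₄ = 1) (hkf : kf = 0)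
      (hf₁ : lf l₁ = 0) (hf₂ : lf l₂ = 0) (hf₃ : lf l₃ = 1) (hf₄ : lf l₄ = 1) :
      RicciTable n kb kf lb lf .D .Ii
  | D_II (l₁ l₂ : ι) (hne : l₁ ≠ l₂) (hkb : kb = 0) (h₁ : lb l₁ = 2) (h₂ : lb l₂ = 2)
      (hkf : kf = 0) (hf₁ : lf l₁ = 2) (hfo : ∀ l, l ≠ l₁ → lf l = 0) :
      RicciTable n kb kf lb lf .D .II
  | D_IIi (l₁ l₂ : ι) (hne : l₁ ≠ l₂) (hkb : kb = 0) (h₁ : lb l₁ = 2) (h₂ : lb l₂ = 2)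
      (hkf : kf = 0) (hf₁ : lf l₁ = 2) (hf₂ : lf l₂ = 1) : RicciTable n kb kf lb lf .D .IIi
  | D_IIi' (hn : 3 < n) (l₁ l₂ l₃ : ι) (hne : l₁ ≠ l₂) (hkb : kb = 0) (h₁ : lb l₁ = 2)
      (h₂ : lb l₂ = 2) (h₃ : lb l₃ = 1) (hkf : kf = 0) (hf₁ : lf l₁ = 2) (hf₂ : lf l₂ = 0)
      (hf₃ : lf l₃ = 1) : RicciTable n kb kf lb lf .D .IIi
  | D_D (l₁ l₂ : ι) (hne : l₁ ≠ l₂) (hkb : kb = 0) (h₁ : lb l₁ = 2) (h₂ : lb l₂ = 2)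
      (hkf : kf = 0) (hf₁ : lf l₁ = 2) (hf₂ : lf l₂ = 2) : RicciTable n kb kf lb lf .D .D
  -- background `D`, `k` single
  | D_Ii_k1 (hn : 3 < n) (l₁ l₂ : ι) (hne : l₁ ≠ l₂) (hkb : kb = 1) (h₁ : lb l₁ = 2)
      (h₂ : lb l₂ = 2) (hkf : kf = 1) (hlf : ∀ l, lf l ≤ 1) : RicciTable n kb kf lb lf .D .Ii
  | D_IIi_k1 (hn : 3 < n) (l₁ l₂ : ι) (hne : l₁ ≠ l₂) (hkb : kb = 1) (h₁ : lb l₁ = 2)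
      (h₂ : lb l₂ = 2) (hkf : kf = 1) (hf₁ : lf l₁ = 2) (hfo : ∀ l, l ≠ l₁ → lf l ≤ 1) :
      RicciTable n kb kf lb lf .D .IIi
  | D_D_k1 (hn : 3 < n) (l₁ l₂ : ι) (hne : l₁ ≠ l₂) (hkb : kb = 1) (h₁ : lb l₁ = 2)
      (h₂ : lb l₂ = 2) (hkf : kf = 1) (hf₁ : lf l₁ = 2) (hf₂ : lf l₂ = 2) :
      RicciTable n kb kf lb lf .D .D
  -- background `D`, `k` double
  | D_II_k2 (l : ι) (hkb : kb = 2) (h : lb l = 2) (hkf : kf = 2) (hlf : ∀ l, lf l = 0) :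
      RicciTable n kb kf lb lf .D .II
  | D_IIi_k2 (l : ι) (hkb : kb = 2) (h : lb l = 2) (hkf : kf = 2) (hf : lf l = 1)
      (hfo : ∀ l, lf l ≤ 1) : RicciTable n kb kf lb lf .D .IIi
  | D_IIi_k2' (hn : 3 < n) (l l' : ι) (hkb : kb = 2) (h : lb l = 2) (h' : lb l' = 1)
      (hkf : kf = 2) (hf : lf l = 0) (hf' : lf l' = 1) (hfo : ∀ l, lf l ≤ 1) :
      RicciTable n kb kf lb lf .D .IIi
  | D_D_k2 (l : ι) (hkb : kb = 2) (h : lb l = 2) (hkf : kf = 2) (hf : lf l = 2) :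
      RicciTable n kb kf lb lf .D .D
  -- background `III`, `k` not aligned
  | III_G (l : ι) (hkb : kb = 0) (h : lb l = 3) (hkf : kf = 0) (hlf : ∀ l, lf l = 0) :
      RicciTable n kb kf lb lf .III .G
  | III_II (l : ι) (hkb : kb = 0) (h : lb l = 3) (hkf : kf = 0) (hf : lf l = 2)
      (hfo : ∀ l', l' ≠ l → lf l' = 0) : RicciTable n kb kf lb lf .III .II
  | III_III (l : ι) (hkb : kb = 0) (h : lb l = 3) (hkf : kf = 0) (hf : lf l = 3)
      (hfo : ∀ l', l' ≠ l → lf l' = 0) : RicciTable n kb kf lb lf .III .III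
  -- background `III`, `k` triple
  | III_II_k (hkb : kb = 3) (hlb : ∀ l, lb l = 0) (hkf : kf = 2) (hlf : ∀ l, lf l = 0) :
      RicciTable n kb kf lb lf .III .II
  | III_III_k (hkb : kb = 3) (hlb : ∀ l, lb l = 0) (hkf : kf = 3) (hlf : ∀ l, lf l = 0) :
      RicciTable n kb kf lb lf .III .III
  -- background `III_i`, `k` not aligned
  | IIIi_G (l₁ l₂ : ι) (hkb : kb = 0) (h₁ : lb l₁ = 3) (h₂ : lb l₂ = 1)
      (hkf : kf = 0) (hlf : ∀ l, lf l = 0) : RicciTable n kb kf lb lf .IIIi .G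
  | IIIi_Ii (l₁ l₂ l₃ : ι) (hne : l₂ ≠ l₃) (hkb : kb = 0) (h₁ : lb l₁ = 3) (h₂ : lb l₂ = 1)
      (h₃ : lb l₃ = 1) (hkf : kf = 0) (hf₁ : lf l₁ = 0) (hf₂ : lf l₂ = 1) (hf₃ : lf l₃ = 1) :
      RicciTable n kb kf lb lf .IIIi .Ii
  | IIIi_II (l₁ l₂ : ι) (hkb : kb = 0) (h₁ : lb l₁ = 3) (h₂ : lb l₂ = 1)
      (hkf : kf = 0) (hf₁ : lf l₁ = 2) (hfo : ∀ l, l ≠ l₁ → lf l = 0) :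
      RicciTable n kb kf lb lf .IIIi .II
  | IIIi_III (l₁ l₂ : ι) (hkb : kb = 0) (h₁ : lb l₁ = 3) (h₂ : lb l₂ = 1)
      (hkf : kf = 0) (hf₁ : lf l₁ = 3) (hfo : ∀ l, l ≠ l₁ → lf l = 0) :
      RicciTable n kb kf lb lf .IIIi .III
  | IIIi_Ii' (l₁ l₂ : ι) (hkb : kb = 0) (h₁ : lb l₁ = 3) (h₂ : lb l₂ = 1)
      (hkf : kf = 0) (hf₁ : lf l₁ = 1) (hf₂ : lf l₂ = 1) : RicciTable n kb kf lb lf .IIIi .Ii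
  | IIIi_IIi (l₁ l₂ : ι) (hkb : kb = 0) (h₁ : lb l₁ = 3) (h₂ : lb l₂ = 1)
      (hkf : kf = 0) (hf₁ : lf l₁ = 2) (hf₂ : lf l₂ = 1) : RicciTable n kb kf lb lf .IIIi .IIi
  | IIIi_IIIi (l₁ l₂ : ι) (hkb : kb = 0) (h₁ : lb l₁ = 3) (h₂ : lb l₂ = 1)
      (hkf : kf = 0) (hf₁ : lf l₁ = 3) (hf₂ : lf l₂ = 1) : RicciTable n kb kf lb lf .IIIi .IIIi
  -- background `III_i`, `k` single
  | IIIi_Ii_k1 (l : ι) (hkb : kb = 1) (h : lb l = 3) (hkf : kf = 1) (hlf : ∀ l, lf l ≤ 1) :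
      RicciTable n kb kf lb lf .IIIi .Ii
  | IIIi_IIi_k1 (l : ι) (hkb : kb = 1) (h : lb l = 3) (hkf : kf = 1) (hf : lf l = 2) :
      RicciTable n kb kf lb lf .IIIi .IIi
  | IIIi_IIIi_k1 (l : ι) (hkb : kb = 1) (h : lb l = 3) (hkf : kf = 1) (hf : lf l = 3) :
      RicciTable n kb kf lb lf .IIIi .IIIi
  -- background `III_i`, `k` triple
  | IIIi_II_k3 (l : ι) (hkb : kb = 3) (h : lb l = 1) (hkf : kf = 2) (hlf : ∀ l, lf l = 0) :
      RicciTable n kb kf lb lf .IIIi .II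
  | IIIi_III_k3 (l : ι) (hkb : kb = 3) (h : lb l = 1) (hkf : kf = 3) (hlf : ∀ l, lf l = 0) :
      RicciTable n kb kf lb lf .IIIi .III
  | IIIi_IIi_k3 (l : ι) (hkb : kb = 3) (h : lb l = 1) (hkf : kf = 2) (hf : lf l = 1) :
      RicciTable n kb kf lb lf .IIIi .IIi
  | IIIi_IIIi_k3 (l : ι) (hkb : kb = 3) (h : lb l = 1) (hkf : kf = 3) (hf : lf l = 1) :
      RicciTable n kb kf lb lf .IIIi .IIIi
  -- background `N`, `k` not aligned
  | N_G (l : ι) (hkb : kb = 0) (h : lb l = 4) (hkf : kf = 0) (hlf : ∀ l, lf l = 0) :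
      RicciTable n kb kf lb lf .N .G
  | N_II (l : ι) (hkb : kb = 0) (h : lb l = 4) (hkf : kf = 0) (hf : lf l = 2)
      (hfo : ∀ l', l' ≠ l → lf l' = 0) : RicciTable n kb kf lb lf .N .II
  | N_III (l : ι) (hkb : kb = 0) (h : lb l = 4) (hkf : kf = 0) (hf : lf l = 3)
      (hfo : ∀ l', l' ≠ l → lf l' = 0) : RicciTable n kb kf lb lf .N .III
  | N_N (l : ι) (hkb : kb = 0) (h : lb l = 4) (hkf : kf = 0) (hf : lf l = 4)
      (hfo : ∀ l', l' ≠ l → lf l' = 0) : RicciTable n kb kf lb lf .N .N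
  -- background `N`, `k` quadruple
  | N_II_k (hkb : kb = 4) (hkf : kf = 2) (hlf : ∀ l, lf l = 0) : RicciTable n kb kf lb lf .N .II
  | N_III_k (hkb : kb = 4) (hkf : kf = 3) (hlf : ∀ l, lf l = 0) : RicciTable n kb kf lb lf .N .III
  | N_N_k (hkb : kb = 4) (hkf : kf = 4) (hlf : ∀ l, lf l = 0) : RicciTable n kb kf lb lf .N .N
  -- background `O`
  | O_II (hkf : kf = 2) : RicciTable n kb kf lb lf .O .II
  | O_IIi (hkf : kf = 2) : RicciTable n kb kf lb lf .O .IIi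
  | O_D (hkf : kf = 2) : RicciTable n kb kf lb lf .O .D
  | O_III (hkf : kf = 3) : RicciTable n kb kf lb lf .O .III
  | O_IIIi (hkf : kf = 3) : RicciTable n kb kf lb lf .O .IIIi
  | O_N (hkf : kf = 4) : RicciTable n kb kf lb lf .O .N
  | O_O : RicciTable n kb kf lb lf .O .O

end GKS

/-! At a point, the map `v ↦ v + H (k · v) k` is an isometry from `ḡ` to `g_μ`. It fixes every
vector orthogonal to `k`, in particular `k` itself, and sends `l̄` to `l̄ + H k`. Null frames
therefore go to null frames, and multiplicities in the two geometries can be compared component by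
component in one background frame.

The first ingredient is semicontinuity. Along the ray `t • μ` the Ricci components in shifted frames
depend continuously on `t` and tend to the background components as `t → 0`
(`Family.tendsto_contract`). A component that vanishes for all `t ∈ (0, 1]` vanishes in the limit,
so no alignment is lost (`Family.le_multBg`). This is (1) and (2); for a generic `μ` it bounds the
full multiplicity of each null direction by its background multiplicity.

The second ingredient works in the opposite direction and uses that `k` is geodesic: `R(k, v) =
R̄(k, v)` whenever `v` is orthogonal to `k` (`IsKerrSchild.contract_ricci`). These components decide
whether `k` has multiplicity at least 1 or at least 2, so a background alignment of `k` survives up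
to order two. The identity is obtained from the difference `C` of the two connections, which
satisfies `C^a_{ba} = 0`, `C^a_{bc} k^c = -α k_b k^a` and `v^c C^a_{cd} ∇̄_a k^d = 0`.

The third ingredient is algebra. For a nonzero symmetric tensor every multiplicity is at most 4, two
distinct null directions have total multiplicity at most 4, a single AND is never the only AND, and
for `n = 3` two double ANDs exclude single ones. These facts make the types exhaustive and mutually
exclusive and rule out type `I`. Together with the two inequalities they turn the table into a case
analysis on two functions `Option ι → ℕ`, where `none` stands for `k` (`IsDegeneration.hasEntry`).
If the background Ricci tensor is zero, `k` has infinite background multiplicity, so `k` is at least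
double in the full geometry. -/

namespace GKS

/-! ### The bilinear form of a rank two tensor -/

section Contract
variable {n : ℕ}

theorem contract_eq (T : Tensor2 n) (v w : Coord n) : contract T v w = v ⬝ᵥ T *ᵥ w := by
  simp only [contract, dotProduct, Matrix.mulVec, Finset.mul_sum]
  exact Finset.sum_congr rfl fun a _ => Finset.sum_congr rfl fun b _ => by ring

@[simp] theorem contract_add_left (T : Tensor2 n) (u v w : Coord n) :
    contract T (u + v) w = contract T u w + contract T v w := by
  simp [contract_eq, add_dotProduct]

@[simp] theorem contract_add_right (T : Tensor2 n) (u v w : Coord n) :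
    contract T u (v + w) = contract T u v + contract T u w := by
  simp [contract_eq, Matrix.mulVec_add, dotProduct_add]

@[simp] theorem contract_sub_left (T : Tensor2 n) (u v w : Coord n) :
    contract T (u - v) w = contract T u w - contract T v w := by
  simp [contract_eq, sub_dotProduct]

@[simp] theorem contract_sub_right (T : Tensor2 n) (u v w : Coord n) :
    contract T u (v - w) = contract T u v - contract T u w := by
  simp [contract_eq, Matrix.mulVec_sub, dotProduct_sub]

@[simp] theorem contract_smul_left (T : Tensor2 n) (c : ℝ) (v w : Coord n) :
    contract T (c • v) w = c * contract T v w := by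
  simp [contract_eq]

@[simp] theorem contract_smul_right (T : Tensor2 n) (c : ℝ) (v w : Coord n) :
    contract T v (c • w) = c * contract T v w := by
  simp [contract_eq, Matrix.mulVec_smul]

@[simp] theorem contract_zero_left (T : Tensor2 n) (w : Coord n) : contract T 0 w = 0 := by
  simp [contract_eq]

@[simp] theorem contract_zero_right (T : Tensor2 n) (w : Coord n) : contract T w 0 = 0 := by
  simp [contract_eq]

theorem contract_sum_left {ι : Type*} (s : Finset ι) (T : Tensor2 n) (v : ι → Coord n)
    (w : Coord n) : contract T (∑ i ∈ s, v i) w = ∑ i ∈ s, contract T (v i) w := by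
  simp [contract_eq, sum_dotProduct]

theorem contract_sum_right {ι : Type*} (s : Finset ι) (T : Tensor2 n) (v : ι → Coord n)
    (w : Coord n) : contract T w (∑ i ∈ s, v i) = ∑ i ∈ s, contract T w (v i) := by
  simp [contract_eq, Matrix.mulVec_sum, dotProduct_sum]

theorem contract_comm {T : Tensor2 n} (hT : T.IsSymm) (v w : Coord n) :
    contract T v w = contract T w v := by
  rw [contract_eq, contract_eq, Matrix.dotProduct_mulVec, dotProduct_comm,
    ← Matrix.mulVec_transpose, hT.eq]

theorem contract_single (T : Tensor2 n) (a b : Fin n) :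
    contract T (Pi.single a 1) (Pi.single b 1) = T a b := by
  simp [contract_eq]

theorem tensor_ext {T T' : Tensor2 n} (h : ∀ v w, contract T v w = contract T' v w) : T = T' := by
  ext a b
  rw [← contract_single T, ← contract_single T', h]

/-- A frame whose Gram matrix is an involution is a basis, and the metric is symmetric. -/
theorem frame_matrix {G N : Tensor2 n} {e : Fin n → Coord n} (hN : N * N = 1) (hNt : Nᵀ = N)
    (he : ∀ a b, contract G (e a) (e b) = N a b) :
    G.IsSymm ∧ IsUnit G.det ∧ ∀ v, v = ∑ b, (∑ c, N b c * contract G (e c) v) • e b := by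
  set E : Tensor2 n := Matrix.of e with hE
  have h1 : E * G * Eᵀ = N := by
    ext a b
    rw [← he a b, contract_eq, Matrix.mul_assoc, Matrix.mul_apply', Matrix.dotProduct_mulVec]
    simp [Matrix.mul_apply, dotProduct, Matrix.vecMul, hE, Finset.mul_sum, Finset.sum_mul,
      Matrix.transpose_apply]
    rw [Finset.sum_comm]
    refine Finset.sum_congr rfl fun _ _ => Finset.sum_congr rfl fun _ _ => by ring
  -- From `E G Eᵀ = N` and `N² = 1` the square matrix `E` gets a right, hence two-sided, inverse.
  -- Regrouping the products shows that `Eᵀ N E` inverts `G`; symmetry, nondegeneracy and the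
  -- expansion of `v` all follow from this.
  have h2 : E * (G * Eᵀ * N) = 1 := by
    rw [← hN, ← h1]; simp only [Matrix.mul_assoc]
  have h3 : (G * Eᵀ * N) * E = 1 := mul_eq_one_comm.mp h2
  have h4 : G * (Eᵀ * N * E) = 1 := by rw [← h3]; simp only [Matrix.mul_assoc]
  have h5 : (Eᵀ * N * E) * G = 1 := mul_eq_one_comm.mp h4
  refine ⟨?_, ?_, fun v => ?_⟩
  · have h6 : (Eᵀ * N * E) * Gᵀ = 1 := by
      have := congrArg Matrix.transpose h4
      simpa [Matrix.transpose_mul, hNt, Matrix.mul_assoc] using this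
    have : Gᵀ = G := by
      calc Gᵀ = G * (Eᵀ * N * E) * Gᵀ := by rw [h4, one_mul]
        _ = G := by rw [Matrix.mul_assoc, h6, mul_one]
    exact this
  · exact Matrix.isUnit_det_of_right_inverse h4
  · have h7 : v = Eᵀ *ᵥ (N *ᵥ (E *ᵥ (G *ᵥ v))) := by
      simp only [Matrix.mulVec_mulVec]
      rw [show Eᵀ * (N * (E * G)) = 1 by rw [← h5]; simp only [Matrix.mul_assoc], Matrix.one_mulVec]
    conv_lhs => rw [h7]
    ext a
    simp only [Matrix.mulVec, dotProduct, Finset.sum_apply, Pi.smul_apply, smul_eq_mul,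
      Matrix.transpose_apply, contract_eq, hE, Matrix.of_apply]
    exact Finset.sum_congr rfl fun _ _ => by ring

end Contract

/-! ### Lorentzian metrics -/

section Lorentzian
variable {n : ℕ} {G : Tensor2 (n + 1)}

theorem IsLorentzian.frame {e : Fin (n + 1) → Coord (n + 1)}
    (he : ∀ a b, contract G (e a) (e b) =
      if a = b then (if a.val = 0 then -1 else 1) else 0) :
    G.IsSymm ∧ IsUnit G.det ∧
      ∀ v, v = ∑ b, ((if b.val = 0 then -1 else 1) * contract G (e b) v) • e b := by
  have := frame_matrix (G := G) (e := e)
    (N := Matrix.diagonal fun a => if a.val = 0 then -1 else 1) (by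
      rw [Matrix.diagonal_mul_diagonal, ← Matrix.diagonal_one]
      congr 1; ext a; split_ifs <;> norm_num) (Matrix.diagonal_transpose _)
    (fun a b => by rw [he, Matrix.diagonal_apply])
  simpa [Matrix.diagonal_apply] using this

theorem IsLorentzian.isSymm (hG : IsLorentzian G) : G.IsSymm := by
  obtain ⟨e, he⟩ := hG
  exact (IsLorentzian.frame he).1

theorem IsLorentzian.isUnit_det (hG : IsLorentzian G) : IsUnit G.det := by
  obtain ⟨e, he⟩ := hG
  exact (IsLorentzian.frame he).2.1

/-- The orthogonal complement of a timelike vector is spacelike. -/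
theorem IsLorentzian.pos_of_orthogonal (hG : IsLorentzian G) {u x : Coord (n + 1)}
    (hu : contract G u u < 0) (hux : contract G u x = 0) (hx : x ≠ 0) : 0 < contract G x x := by
  obtain ⟨e, he⟩ := hG
  obtain ⟨hs, -, hexp⟩ := IsLorentzian.frame he
  have key : ∀ v w, contract G v w = -(contract G (e 0) v * contract G (e 0) w) +
      ∑ i : Fin n, contract G (e i.succ) v * contract G (e i.succ) w := by
    intro v w
    conv_lhs => rw [hexp v]
    rw [contract_sum_left, Fin.sum_univ_succ]
    simp only [contract_smul_left]
    simp
  have hu' := key u u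
  have hux' := key u x
  have hx' := key x x
  -- Write `u₀`, `x₀` for the contractions with `e 0`, and `U`, `X` for the spatial sums of squares.
  -- Cauchy–Schwarz with `u · x = 0` gives `(u₀ x₀)² ≤ U X`. If `x` were not spacelike then `X ≤
  -- x₀²`, and `U < u₀²` would force `x₀ = 0`, hence `X = 0` and `x = 0`.
  have hcs := Finset.sum_mul_sq_le_sq_mul_sq Finset.univ
    (fun i : Fin n => contract G (e i.succ) u) (fun i : Fin n => contract G (e i.succ) x)
  have hU : 0 ≤ ∑ i : Fin n, contract G (e i.succ) u ^ 2 := Finset.sum_nonneg fun _ _ => sq_nonneg _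
  have hX : 0 ≤ ∑ i : Fin n, contract G (e i.succ) x ^ 2 := Finset.sum_nonneg fun _ _ => sq_nonneg _
  simp only [← pow_two] at hu' hx'
  by_contra hneg
  push Not at hneg
  have hX0 : ∑ i : Fin n, contract G (e i.succ) x ^ 2 ≤ contract G (e 0) x ^ 2 := by linarith
  have hUX : ∑ i : Fin n, contract G (e i.succ) u * contract G (e i.succ) x
      = contract G (e 0) u * contract G (e 0) x := by linarith
  rw [hUX] at hcs
  have h1 : contract G (e 0) x ^ 2 * (contract G (e 0) u ^ 2 -
      ∑ i : Fin n, contract G (e i.succ) u ^ 2) ≤ 0 := by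
    nlinarith [mul_le_mul_of_nonneg_left hX0 hU]
  have h2 : contract G (e 0) x ^ 2 ≤ 0 := by
    by_contra h
    push Not at h
    have : 0 < contract G (e 0) u ^ 2 - ∑ i : Fin n, contract G (e i.succ) u ^ 2 := by linarith
    nlinarith [mul_pos h this]
  have h3 : contract G (e 0) x = 0 := by nlinarith [sq_nonneg (contract G (e 0) x)]
  have h4 : ∑ i : Fin n, contract G (e i.succ) x ^ 2 = 0 := by
    rw [h3] at hX0; nlinarith
  rw [Finset.sum_eq_zero_iff_of_nonneg fun _ _ => sq_nonneg _] at h4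
  apply hx
  rw [hexp x, Fin.sum_univ_succ, h3]
  simp only [mul_zero, zero_smul, zero_add]
  refine Finset.sum_eq_zero fun i hi => ?_
  rw [pow_eq_zero_iff (two_ne_zero)|>.mp (h4 i hi)]
  simp

/-- Every null vector `l` has a null partner `m` with `l · m = 1`. -/
theorem IsLorentzian.exists_partner (hG : IsLorentzian G) {l : Coord (n + 1)} (hl : IsNull G l) :
    ∃ m, IsNull G m ∧ contract G l m = 1 := by
  have hG' := hG
  obtain ⟨e, he⟩ := hG'
  have hs := hG.isSymm
  have h00 : contract G (e 0) (e 0) = -1 := by simp [he]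
  -- A nonzero vector orthogonal to the timelike `e 0` is spacelike, so it cannot be null.
  have hne : contract G (e 0) l ≠ 0 := by
    intro h
    have := hG.pos_of_orthogonal (u := e 0) (by rw [h00]; norm_num) h hl.1
    exact this.ne' hl.2
  set c := contract G (e 0) l with hc
  have hc' : contract G l (e 0) = c := by rw [contract_comm hs]
  -- The partner is the reflection of `l` along `e 0`: `l + 2c e 0` is null because `4c² - 4c² = 0`,
  -- and its product with `l` is `2c²`, which fixes the prefactor.
  have h1 : contract G l ((1 / (2 * c ^ 2)) • (l + (2 * c) • e 0)) = 1 := by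
    simp only [contract_smul_right, contract_add_right, hl.2, hc']
    field_simp
    ring
  refine ⟨(1 / (2 * c ^ 2)) • (l + (2 * c) • e 0), ⟨?_, ?_⟩, h1⟩
  · intro h
    rw [h] at h1
    simp at h1
  · simp only [contract_smul_right, contract_smul_left, contract_add_left, contract_add_right,
      hl.2, hc', h00, ← hc]
    ring

/-- Two orthogonal null vectors are parallel. -/
theorem IsLorentzian.sameDir_of_orthogonal (hG : IsLorentzian G) {l l' : Coord (n + 1)}
    (hl : IsNull G l) (hl' : IsNull G l') (h : contract G l l' = 0) : SameDir l l' := by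
  obtain ⟨m, hm, hlm⟩ := hG.exists_partner hl
  have hs := hG.isSymm
  have hml : contract G m l = 1 := by rw [contract_comm hs, hlm]
  have hl'l : contract G l' l = 0 := by rw [contract_comm hs, h]
  refine ⟨contract G m l', ?_⟩
  by_contra hne
  have hx : l' - contract G m l' • l ≠ 0 := sub_ne_zero.mpr hne
  -- The vector `l - m` is timelike, with square `-2`. Removing the `l`-part from `l'` leaves a
  -- vector orthogonal to `l - m` which is still null, so it must be zero.
  have := hG.pos_of_orthogonal (u := l - m) (x := l' - contract G m l' • l)
    (by simp [hl.2, hm.2, hlm, hml]) (by simp [hl.2, h, hml]) hx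
  simp [hl.2, hl'.2, h, hl'l] at this

end Lorentzian

/-! ### Null frames -/

section Frames

/-- A positive definite symmetric bilinear form has an orthonormal basis. -/
theorem exists_orthonormal_of_posDef {V : Type*} [AddCommGroup V] [Module ℝ V]
    [FiniteDimensional ℝ V] (B : LinearMap.BilinForm ℝ V) (hs : ∀ x y, B x y = B y x)
    (hp : ∀ x, x ≠ 0 → 0 < B x x) {d : ℕ} (hd : Module.finrank ℝ V = d) :
    ∃ b : Fin d → V, ∀ i j, B (b i) (b j) = if i = j then 1 else 0 := by
  subst hd
  let core : InnerProductSpace.Core ℝ V :=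
    { inner := fun x y => B x y
      conj_inner_symm := fun x y => by simpa using hs y x
      re_inner_nonneg := fun x => by
        by_cases h : x = 0
        · simp [h]
        · simpa using (hp x h).le
      add_left := fun x y z => by simp
      smul_left := fun x y r => by simp
      definite := fun x h => by
        by_contra hx
        exact (hp x hx).ne' h }
  let := core.toNormedAddCommGroup
  let : InnerProductSpace ℝ V := InnerProductSpace.ofCore core.toCore
  let b := stdOrthonormalBasis ℝ V
  exact ⟨b, fun i j => (orthonormal_iff_ite.mp b.orthonormal) i j⟩

variable {n : ℕ} {G : Tensor2 (n + 3)}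

/-- The Gram matrix of a null frame is the permutation matrix of the transposition of `0` and `1`,
an involution. Hence the coefficient along `F b` is the contraction with the swapped frame vector.
-/
theorem IsNullFrame.expand {F : Fin (n + 3) → Coord (n + 3)} (hF : IsNullFrame G F)
    (v : Coord (n + 3)) : v = ∑ b, contract G (F (Equiv.swap 0 1 b)) v • F b := by
  have hN : ∀ a b : Fin (n + 3), contract G (F a) (F b) =
      ((Equiv.swap (0 : Fin (n + 3)) 1).permMatrix ℝ) a b := by
    intro a b
    rw [hF, Equiv.Perm.permMatrix, PEquiv.toMatrix_apply]
    simp only [Equiv.toPEquiv_apply, Option.mem_some_iff, Equiv.swap_apply_def]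
    rcases a with ⟨a, ha⟩
    rcases b with ⟨b, hb⟩
    simp only [Fin.ext_iff, Fin.val_zero, Fin.val_one]
    rcases a with _ | _ | a <;> rcases b with _ | _ | b <;> (simp; try omega)
  obtain ⟨-, -, h⟩ := frame_matrix (G := G) (e := F) (by
      rw [← Matrix.permMatrix_mul]; simp)
    (by rw [Matrix.transpose_permMatrix]; simp) hN
  conv_lhs => rw [h v]
  refine Finset.sum_congr rfl fun b _ => ?_
  congr 1
  rw [Finset.sum_eq_single (Equiv.swap 0 1 b)]
  · simp [Equiv.Perm.permMatrix, PEquiv.toMatrix_apply]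
  · intro c _ hc
    simp [Equiv.Perm.permMatrix, PEquiv.toMatrix_apply, Ne.symm hc]
  · simp

/-- Two null vectors `l`, `m` with `l · m = 1` can be completed to a null frame. -/
theorem IsLorentzian.exists_nullFrame (hG : IsLorentzian G) {l m : Coord (n + 3)}
    (hl : contract G l l = 0) (hm : contract G m m = 0) (hlm : contract G l m = 1) :
    ∃ F, IsNullFrame G F ∧ F 0 = l ∧ F 1 = m := by
  have hs := hG.isSymm
  have hml : contract G m l = 1 := by rw [contract_comm hs, hlm]
  let φ : Coord (n + 3) →ₗ[ℝ] ℝ × ℝ :=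
    { toFun := fun x => (contract G l x, contract G m x)
      map_add' := fun x y => by simp
      map_smul' := fun c x => by simp }
  have hφ : LinearMap.range φ = ⊤ := by
    rw [LinearMap.range_eq_top]
    rintro ⟨s, t⟩
    exact ⟨s • m + t • l, by simp [φ, hl, hm, hlm, hml]⟩
  -- The kernel is the orthogonal complement of `l` and `m`. It is also orthogonal to the timelike
  -- vector `l - m`, so the metric is positive definite there and an orthonormal basis supplies the
  -- remaining frame vectors.
  have hrank : Module.finrank ℝ (LinearMap.ker φ) = n + 1 := by
    have := LinearMap.finrank_range_add_finrank_ker φ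
    rw [hφ, finrank_top, Module.finrank_prod, Module.finrank_self, Module.finrank_fin_fun] at this
    omega
  let B : LinearMap.BilinForm ℝ (LinearMap.ker φ) :=
    LinearMap.mk₂ ℝ (fun x y => contract G x.1 y.1) (by intros; simp) (by intros; simp)
      (by intros; simp) (by intros; simp)
  obtain ⟨b, hb⟩ := exists_orthonormal_of_posDef B (fun x y => contract_comm hs _ _) (by
    intro x hx
    have hx' : φ x.1 = 0 := x.2
    have h1 : contract G l x.1 = 0 := congrArg Prod.fst hx'
    have h2 : contract G m x.1 = 0 := congrArg Prod.snd hx'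
    refine hG.pos_of_orthogonal (u := l - m) (by simp [hl, hm, hlm, hml])
      (by simp [h1, h2]) (fun h => hx (Subtype.ext h))) hrank
  have hbl : ∀ i, contract G l (b i).1 = 0 := fun i => congrArg Prod.fst (show φ (b i).1 = 0 from (b i).2)
  have hbm : ∀ i, contract G m (b i).1 = 0 := fun i => congrArg Prod.snd (show φ (b i).1 = 0 from (b i).2)
  have hbl' : ∀ i, contract G (b i).1 l = 0 := fun i => by rw [contract_comm hs, hbl]
  have hbm' : ∀ i, contract G (b i).1 m = 0 := fun i => by rw [contract_comm hs, hbm]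
  have hbb : ∀ i j, contract G (b i).1 (b j).1 = if i = j then 1 else 0 := hb
  refine ⟨Fin.cons l (Fin.cons m fun i => (b i).1), ?_, rfl, rfl⟩
  intro a c
  refine Fin.cases ?_ (fun a => ?_) a <;> refine Fin.cases ?_ (fun c => ?_) c
  · simp [hl]
  · refine Fin.cases ?_ (fun c => ?_) c
    · simp [hlm]
    · exact (hbl c).trans (by rw [if_neg (by simp), if_neg (by simp)])
  · refine Fin.cases ?_ (fun a => ?_) a
    · simp [hml]
    · refine (hbl' a).trans ?_
      rw [if_neg (by simp), if_neg fun h => absurd (congrArg Fin.val h.1) (by simp)]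
  · refine Fin.cases ?_ (fun a => ?_) a <;> refine Fin.cases ?_ (fun c => ?_) c
    · simp [hm]
    · exact (hbm c).trans (by rw [if_neg (by simp), if_neg (by simp)])
    · refine (hbm' a).trans ?_
      rw [if_neg (by simp), if_neg fun h => absurd (congrArg Fin.val h.1) (by simp)]
    · simp [hbb, Fin.ext_iff]; omega

end Frames
end GKS

namespace GKS

/-! ### Multiplicities of null directions -/

section Mult
variable {n : ℕ}

theorem boostWeight_le (a : Fin n) : boostWeight a ≤ 1 := by
  unfold boostWeight; split_ifs <;> norm_num

theorem neg_one_le_boostWeight (a : Fin n) : -1 ≤ boostWeight a := by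
  unfold boostWeight; split_ifs <;> norm_num

theorem boostWeight_swap (a : Fin (n + 3)) :
    boostWeight (Equiv.swap 0 1 a) = -boostWeight a := by
  rcases eq_or_ne a 0 with rfl | h0
  · simp [boostWeight]
  rcases eq_or_ne a 1 with rfl | h1
  · simp [boostWeight]
  rw [Equiv.swap_apply_of_ne_of_ne h0 h1]
  have h0' : a.val ≠ 0 := fun h => h0 (Fin.ext h)
  have h1' : a.val ≠ 1 := fun h => h1 (Fin.ext (by simp [h]))
  simp [boostWeight, h0', h1']

theorem AlignedToOrder.anti {G T : Tensor2 n} {l : Coord n} {m m' : ℕ}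
    (h : AlignedToOrder G T l m') (hm : m ≤ m') : AlignedToOrder G T l m :=
  fun F hF hl a b hab => h F hF hl a b (by omega)

theorem alignedToOrder_zero (G T : Tensor2 n) (l : Coord n) : AlignedToOrder G T l 0 := by
  intro F _ _ a b hab
  have := boostWeight_le a
  have := boostWeight_le b
  push_cast at hab
  omega

/-- The orders to which `l` is aligned are downward closed and contain `0`, so a lower bound on the
supremum can be tested at that order alone. For a successor, exceeding its predecessor already
produces a witness of sufficient order. -/
theorem le_mult_iff {G T : Tensor2 n} {l : Coord n} {m : ℕ} :
    (m : ℕ∞) ≤ mult G T l ↔ AlignedToOrder G T l m := by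
  constructor
  · intro h
    cases m with
    | zero => exact alignedToOrder_zero G T l
    | succ k =>
      rw [Nat.cast_succ, ENat.add_one_le_iff (ENat.natCast_ne_top k), mult, lt_iSup_iff] at h
      obtain ⟨m', h⟩ := h
      rw [lt_iSup_iff] at h
      obtain ⟨h1, h2⟩ := h
      exact h1.anti (by exact_mod_cast h2)
  · intro h
    exact le_iSup₂_of_le m h le_rfl

theorem mult_zero_tensor (G : Tensor2 n) (l : Coord n) : mult G 0 l = ⊤ := by
  rw [ENat.eq_top_iff_forall_ge]
  intro m
  rw [le_mult_iff]
  intro F _ _ a b _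
  simp [contract]

variable {G T : Tensor2 (n + 3)}

/-- Exchanging the two null vectors reverses boost weights. This transfers every criterion for `F 0`
to `F 1`. -/
theorem IsNullFrame.swap {F : Fin (n + 3) → Coord (n + 3)} (hF : IsNullFrame G F) :
    IsNullFrame G (F ∘ Equiv.swap 0 1) := by
  intro a b
  rw [Function.comp, Function.comp, hF]
  rcases a with ⟨a, ha⟩
  rcases b with ⟨b, hb⟩
  simp only [Equiv.swap_apply_def]
  rcases a with _ | _ | a <;> rcases b with _ | _ | b <;> simp [Fin.ext_iff]

/-- Alignment may be checked in a single null frame. -/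
theorem IsNullFrame.alignedToOrder_iff {F : Fin (n + 3) → Coord (n + 3)} (hF : IsNullFrame G F)
    {m : ℕ} : AlignedToOrder G T (F 0) m ↔
      ∀ a b, 2 - (m : ℤ) < boostWeight a + boostWeight b → contract T (F a) (F b) = 0 := by
  constructor
  · intro h a b hab
    exact h F hF (fun a ha => by rw [Fin.ext (a := a) (b := 0) ha]) a b hab
  · intro h F' hF' h0 a b hab
    have h0 : F' 0 = F 0 := h0 0 rfl
    -- Since both frames share `m₀`, a vector `F' a` has no part along any `F c` of smaller boost
    -- weight. Every component of `T` in the new frame is thus a combination of old components of at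
    -- least the same boost weight.
    have hz : ∀ a c : Fin (n + 3), boostWeight c < boostWeight a →
        contract G (F (Equiv.swap 0 1 c)) (F' a) = 0 := by
      intro a c hac
      rcases eq_or_ne c 1 with rfl | h1
      · rw [Equiv.swap_apply_right, ← h0, hF']
        have ha : a ≠ 1 := by rintro rfl; exact lt_irrefl _ hac
        have ha' : a.val ≠ 1 := fun h => ha (Fin.ext (by simp [h]))
        simp [ha']
      · rcases eq_or_ne c 0 with rfl | h2
        · have := boostWeight_le a
          simp [boostWeight] at hac
          simp [boostWeight] at this
          split_ifs at * <;> omega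
        · have ha : a = 0 := by
            by_contra ha
            have ha' : a.val ≠ 0 := fun h => ha (Fin.ext h)
            have h1' : c.val ≠ 1 := fun h => h1 (Fin.ext (by simp [h]))
            simp only [boostWeight, h1', ha', if_false] at hac
            split_ifs at hac <;> omega
          have h2' : c.val ≠ 0 := fun h => h2 (Fin.ext h)
          have h1' : c.val ≠ 1 := fun h => h1 (Fin.ext (by simp [h]))
          rw [Equiv.swap_apply_of_ne_of_ne h2 h1, ha, h0, hF]
          simp [h1', h2]
    rw [hF.expand (F' a), hF.expand (F' b), contract_sum_left]
    refine Finset.sum_eq_zero fun c _ => ?_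
    rw [contract_sum_right]
    refine Finset.sum_eq_zero fun d _ => ?_
    rw [contract_smul_left, contract_smul_right]
    rcases lt_or_ge (boostWeight c) (boostWeight a) with hc | hc
    · rw [hz a c hc, zero_mul]
    rcases lt_or_ge (boostWeight d) (boostWeight b) with hd | hd
    · rw [hz b d hd, zero_mul, mul_zero]
    rw [h c d (by omega), mul_zero, mul_zero]

theorem IsNullFrame.alignedToOrder_one_iff {F : Fin (n + 3) → Coord (n + 3)}
    (hF : IsNullFrame G F) {m : ℕ} : AlignedToOrder G T (F 1) m ↔
      ∀ a b, boostWeight a + boostWeight b < (m : ℤ) - 2 → contract T (F a) (F b) = 0 := by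
  have h := hF.swap.alignedToOrder_iff (T := T) (m := m)
  simp only [Function.comp, Equiv.swap_apply_left] at h
  rw [h]
  constructor
  · intro h a b hab
    have := h (Equiv.swap 0 1 a) (Equiv.swap 0 1 b) (by
      rw [boostWeight_swap, boostWeight_swap]; omega)
    simpa using this
  · intro h a b hab
    exact h _ _ (by rw [boostWeight_swap, boostWeight_swap]; omega)

theorem AlignedToOrder.smul {l : Coord (n + 3)} {c : ℝ} (hc : c ≠ 0) {m : ℕ}
    (h : AlignedToOrder G T l m) : AlignedToOrder G T (c • l) m := by
  intro F hF hl a b hab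
  -- The boost that rescales `m₀` by `c⁻¹` and `m₁` by `c` preserves null frames and returns `c • l`
  -- to `l`. It multiplies each component by a nonzero factor.
  let s : Fin (n + 3) → ℝ := fun a => if a.val = 0 then c⁻¹ else if a.val = 1 then c else 1
  have hs : ∀ a, s a ≠ 0 := by
    intro a; simp only [s]; split_ifs <;> simp [hc]
  have := h (fun a => s a • F a) (by
    intro a b
    rw [contract_smul_left, contract_smul_right, hF]
    rcases a with ⟨a, ha⟩
    rcases b with ⟨b, hb⟩
    rcases a with _ | _ | a <;> rcases b with _ | _ | b <;> simp [s, hc]) (by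
    intro a ha
    rw [hl a ha, show s a = c⁻¹ from if_pos ha, smul_smul, inv_mul_cancel₀ hc, one_smul]) a b hab
  simpa [contract_smul_left, contract_smul_right, hs] using this

theorem mult_smul {c : ℝ} (hc : c ≠ 0) (l : Coord (n + 3)) :
    mult G T (c • l) = mult G T l := by
  unfold mult
  refine iSup_congr fun m => ?_
  rw [show AlignedToOrder G T (c • l) m = AlignedToOrder G T l m from propext
    ⟨fun h => by
      have := h.smul (inv_ne_zero hc)
      rwa [smul_smul, inv_mul_cancel₀ hc, one_smul] at this, fun h => h.smul hc⟩]

theorem SameDir.mult_eq {l l' : Coord (n + 3)} (h : SameDir l l') (hl' : l' ≠ 0) :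
    mult G T l' = mult G T l := by
  obtain ⟨c, rfl⟩ := h
  exact mult_smul (fun hc => hl' (by simp [hc])) l

theorem SameDir.symm {l l' : Coord n} (h : SameDir l l') (hl' : l' ≠ 0) : SameDir l' l := by
  obtain ⟨c, rfl⟩ := h
  have hc : c ≠ 0 := fun hc => hl' (by simp [hc])
  exact ⟨c⁻¹, by rw [smul_smul, inv_mul_cancel₀ hc, one_smul]⟩

/-- A null frame whose first two vectors represent two given null directions. -/
theorem IsLorentzian.exists_nullFrame_of_not_sameDir (hG : IsLorentzian G) {l l' : Coord (n + 3)}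
    (hl : IsNull G l) (hl' : IsNull G l') (h : ¬ SameDir l l') :
    ∃ F, IsNullFrame G F ∧ F 0 = l ∧ ∃ c : ℝ, c ≠ 0 ∧ F 1 = c • l' := by
  have h0 : contract G l l' ≠ 0 := fun h0 => h (hG.sameDir_of_orthogonal hl hl' h0)
  obtain ⟨F, hF, hF0, hF1⟩ := hG.exists_nullFrame (l := l) (m := (contract G l l')⁻¹ • l') hl.2
    (by simp [hl'.2]) (by simp [h0])
  exact ⟨F, hF, hF0, _, inv_ne_zero h0, hF1⟩

theorem IsLorentzian.exists_nullFrame_of_isNull (hG : IsLorentzian G) {l : Coord (n + 3)}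
    (hl : IsNull G l) : ∃ F, IsNullFrame G F ∧ F 0 = l := by
  obtain ⟨m, hm, hlm⟩ := hG.exists_partner hl
  obtain ⟨F, hF, h, -⟩ := hG.exists_nullFrame hl.2 hm.2 hlm
  exact ⟨F, hF, h⟩

theorem IsNullFrame.isNull_zero {F : Fin (n + 3) → Coord (n + 3)} (hF : IsNullFrame G F) :
    IsNull G (F 0) := by
  refine ⟨fun h => ?_, by simp [hF _ _]⟩
  have := hF 0 1
  simp [h] at this

theorem IsNullFrame.isNull_one {F : Fin (n + 3) → Coord (n + 3)} (hF : IsNullFrame G F) :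
    IsNull G (F 1) := by
  simpa using hF.swap.isNull_zero

/-- A tensor is determined by its components in a null frame. -/
theorem IsNullFrame.tensor_ext {T T' : Tensor2 (n + 3)} {F : Fin (n + 3) → Coord (n + 3)}
    (hF : IsNullFrame G F) (h : ∀ a b, contract T (F a) (F b) = contract T' (F a) (F b)) :
    T = T' := by
  refine GKS.tensor_ext fun v w => ?_
  rw [hF.expand v, hF.expand w]
  simp only [contract_sum_left, contract_sum_right, contract_smul_left, contract_smul_right, h]

/-- Boost weights of components are at least `-2`, so alignment to order 5 would annihilate every
component. -/
theorem mult_le_four (hG : IsLorentzian G) (hT : T ≠ 0) {l : Coord (n + 3)} (hl : IsNull G l) :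
    mult G T l ≤ 4 := by
  by_contra hlt
  push Not at hlt
  have h5 : ((5 : ℕ) : ℕ∞) ≤ mult G T l := by
    have := (ENat.add_one_le_iff (show (4 : ℕ∞) ≠ ⊤ by decide)).mpr hlt
    exact_mod_cast this
  rw [le_mult_iff] at h5
  obtain ⟨F, hF, rfl⟩ := hG.exists_nullFrame_of_isNull hl
  rw [hF.alignedToOrder_iff] at h5
  refine hT (hF.tensor_ext fun a b => ?_)
  rw [h5 a b (by have := neg_one_le_boostWeight a; have := neg_one_le_boostWeight b; push_cast; omega)]
  simp [contract]

/-- In a null frame along both directions, multiplicity `a` of the first kills the boost weights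
above `2 - a`, and multiplicity `b` of the second kills those below `b - 2`. If `a + b > 4` the two
ranges cover all weights and `T` vanishes. -/
theorem mult_add_mult_le_four (hG : IsLorentzian G) (hT : T ≠ 0) {l l' : Coord (n + 3)}
    (hl : IsNull G l) (hl' : IsNull G l') (h : ¬ SameDir l l') :
    mult G T l + mult G T l' ≤ 4 := by
  obtain ⟨a, ha⟩ := ENat.ne_top_iff_exists.mp
    (ne_top_of_le_ne_top (show (4 : ℕ∞) ≠ ⊤ by decide) (mult_le_four hG hT hl))
  obtain ⟨b, hb⟩ := ENat.ne_top_iff_exists.mp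
    (ne_top_of_le_ne_top (show (4 : ℕ∞) ≠ ⊤ by decide) (mult_le_four hG hT hl'))
  obtain ⟨F, hF, rfl, c, hc, h1⟩ := hG.exists_nullFrame_of_not_sameDir hl hl' h
  rw [← mult_smul hc l', ← h1] at hb ⊢
  have ha' := le_mult_iff.mp ha.le
  have hb' := le_mult_iff.mp hb.le
  rw [hF.alignedToOrder_iff] at ha'
  rw [hF.alignedToOrder_one_iff] at hb'
  rw [← ha, ← hb]
  by_contra hlt
  push Not at hlt
  have hlt' : 4 < a + b := by exact_mod_cast hlt
  refine hT (hF.tensor_ext fun i j => ?_)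
  rw [show contract (0 : Tensor2 (n + 3)) (F i) (F j) = 0 by simp [contract]]
  rcases lt_or_ge (2 - (a : ℤ)) (boostWeight i + boostWeight j) with h | h
  · exact ha' i j h
  · exact hb' i j (by omega)

/-- The only component of boost weight 2 is the one with both indices `0`. -/
theorem one_le_mult_iff (hG : IsLorentzian G) {l : Coord (n + 3)} (hl : IsNull G l) :
    1 ≤ mult G T l ↔ contract T l l = 0 := by
  obtain ⟨F, hF, rfl⟩ := hG.exists_nullFrame_of_isNull hl
  rw [show (1 : ℕ∞) = ((1 : ℕ) : ℕ∞) by simp, le_mult_iff, hF.alignedToOrder_iff]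
  refine ⟨fun h => h 0 0 (by simp [boostWeight]), fun h a b hab => ?_⟩
  have ha : a = 0 := by
    have := boostWeight_le b
    by_contra h
    have : a.val ≠ 0 := fun h' => h (Fin.ext h')
    simp only [boostWeight, this, if_false] at hab this
    split_ifs at * <;> simp_all
  have hb : b = 0 := by
    have := boostWeight_le a
    by_contra h
    have : b.val ≠ 0 := fun h' => h (Fin.ext h')
    simp only [boostWeight, this, if_false] at hab this
    split_ifs at * <;> simp_all
  rw [ha, hb, h]

/-- Multiplicity at least two in a null frame. -/
theorem IsNullFrame.two_le_mult_iff (hT : T.IsSymm) {F : Fin (n + 3) → Coord (n + 3)}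
    (hF : IsNullFrame G F) :
    2 ≤ mult G T (F 0) ↔ ∀ b : Fin (n + 3), b ≠ 1 → contract T (F 0) (F b) = 0 := by
  rw [show (2 : ℕ∞) = ((2 : ℕ) : ℕ∞) by simp, le_mult_iff, hF.alignedToOrder_iff]
  refine ⟨fun h b hb => h 0 b ?_, fun h a b hab => ?_⟩
  · have : b.val ≠ 1 := fun h => hb (Fin.ext (by simp [h]))
    simp only [boostWeight, this]
    split_ifs <;> simp_all
  · have hab' : (a = 0 ∧ b ≠ 1) ∨ (b = 0 ∧ a ≠ 1) := by
      simp only [Fin.ext_iff, ne_eq, Fin.val_zero, Fin.val_one]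
      simp only [boostWeight] at hab
      split_ifs at hab <;> simp_all
    rcases hab' with ⟨rfl, hb⟩ | ⟨rfl, ha⟩
    · exact h b hb
    · rw [contract_comm hT, h a ha]

/-- Intermediate value theorem on `[-M, M]`, with `M` chosen so that the cubic term dominates the
others at both ends. -/
theorem exists_cubic_root (b c d : ℝ) : ∃ s : ℝ, s ^ 3 + b * s ^ 2 + c * s + d = 0 := by
  set M := 1 + |b| + |c| + |d| with hM
  have hb := abs_nonneg b
  have hc := abs_nonneg c
  have hd := abs_nonneg d
  have h1 : 1 ≤ M := by linarith
  have hM2 : M ≤ M ^ 2 := by nlinarith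
  have hM3 : M ^ 3 = M ^ 2 + |b| * M ^ 2 + |c| * M ^ 2 + |d| * M ^ 2 := by
    rw [show M ^ 3 = M ^ 2 * M by ring]; nth_rw 2 [hM]; ring
  have e1 : |c| * M ≤ |c| * M ^ 2 := mul_le_mul_of_nonneg_left hM2 hc
  have e2 : |d| * 1 ≤ |d| * M ^ 2 := mul_le_mul_of_nonneg_left (by linarith) hd
  have e3 := mul_le_mul_of_nonneg_right (abs_le.mp le_rfl : -|b| ≤ b ∧ b ≤ |b|).1 (sq_nonneg M)
  have e4 := mul_le_mul_of_nonneg_right (abs_le.mp le_rfl : -|b| ≤ b ∧ b ≤ |b|).2 (sq_nonneg M)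
  have e5 := mul_le_mul_of_nonneg_right (abs_le.mp le_rfl : -|c| ≤ c ∧ c ≤ |c|).1 (zero_le_one.trans h1)
  have e6 := mul_le_mul_of_nonneg_right (abs_le.mp le_rfl : -|c| ≤ c ∧ c ≤ |c|).2 (zero_le_one.trans h1)
  have e7 := (abs_le.mp le_rfl : -|d| ≤ d ∧ d ≤ |d|).1
  have e8 := (abs_le.mp le_rfl : -|d| ≤ d ∧ d ≤ |d|).2
  have hcont : Continuous fun s : ℝ => s ^ 3 + b * s ^ 2 + c * s + d := by fun_prop
  obtain ⟨s, -, hs⟩ := intermediate_value_Icc (show -M ≤ M by linarith) hcont.continuousOn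
    (show (0 : ℝ) ∈ Set.Icc _ _ from ⟨by nlinarith, by nlinarith⟩)
  exact ⟨s, hs⟩

/-- If there is a single aligned null direction, then it is not the only aligned one. -/
theorem exists_other_of_mult_eq_one (hG : IsLorentzian G) (hT : T.IsSymm) {l : Coord (n + 3)}
    (hl : IsNull G l) (h : mult G T l = 1) :
    ∃ l', IsNull G l' ∧ ¬ SameDir l l' ∧ 1 ≤ mult G T l' := by
  obtain ⟨F, hF, rfl⟩ := hG.exists_nullFrame_of_isNull hl
  have h00 : contract T (F 0) (F 0) = 0 := (one_le_mult_iff hG hl).mp h.ge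
  have hn2 : ¬ 2 ≤ mult G T (F 0) := by rw [h]; decide
  rw [hF.two_le_mult_iff hT] at hn2
  push Not at hn2
  obtain ⟨i, hi1, hi⟩ := hn2
  have hi0 : i ≠ 0 := by rintro rfl; exact hi h00
  have hi0' : i.val ≠ 0 := fun h => hi0 (Fin.ext h)
  have hi1' : i.val ≠ 1 := fun h => hi1 (Fin.ext (by simp [h]))
  have g00 : contract G (F 0) (F 0) = 0 := by simp [hF _ _]
  have g01 : contract G (F 0) (F 1) = 1 := by simp [hF _ _]
  have g10 : contract G (F 1) (F 0) = 1 := by simp [hF _ _]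
  have g11 : contract G (F 1) (F 1) = 0 := by simp [hF _ _]
  have g0i : contract G (F 0) (F i) = 0 := by rw [hF]; simp [hi1', hi0.symm]
  have gi0 : contract G (F i) (F 0) = 0 := by rw [hF]; simp [hi1', hi0]
  have g1i : contract G (F 1) (F i) = 0 := by rw [hF]; simp [hi0', hi1.symm]
  have gi1 : contract G (F i) (F 1) = 0 := by rw [hF]; simp [hi0', hi1]
  have gii : contract G (F i) (F i) = 1 := by
    rw [hF, if_neg (by omega), if_pos ⟨rfl, by omega⟩]
  have hnd : ∀ v : Coord (n + 3), contract G (F 0) v ≠ 0 → ¬ SameDir (F 0) v := by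
    rintro v hv ⟨c, rfl⟩
    simp [g00] at hv
  by_cases h11 : contract T (F 1) (F 1) = 0
  · exact ⟨F 1, hF.isNull_one, hnd _ (by simp [g01]), (one_le_mult_iff hG hF.isNull_one).mpr h11⟩
  -- Besides `F 0` itself, consider the null vectors `F 0 + s F i - (s²/2) F 1`. As `T(F 0, F 0) =
  -- 0`, evaluating `T` on them gives `s/4` times a cubic in `s` with leading coefficient `D ≠ 0`
  -- and constant term `8 T(F 0, F i) ≠ 0`. A real root exists and is nonzero, so the resulting
  -- direction differs from `F 0`.
  set D := contract T (F 1) (F 1) with hD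
  obtain ⟨s, hs⟩ := exists_cubic_root (-(4 * contract T (F 1) (F i)) / D)
    (4 * (contract T (F i) (F i) - contract T (F 0) (F 1)) / D) (8 * contract T (F 0) (F i) / D)
  have hs0 : s ≠ 0 := by
    rintro rfl
    have : 8 * contract T (F 0) (F i) / D = 0 := by simpa using hs
    rw [div_eq_zero_iff] at this
    rcases this with h | h
    · exact hi (by linarith)
    · exact h11 h
  have hnull : IsNull G (F 0 + s • F i - (s ^ 2 / 2) • F 1) := by
    constructor
    · intro h
      have := congrArg (contract G (F 0)) h
      simp [g00, g01, g0i, hs0] at this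
    · simp [g00, g01, g0i, g10, g11, g1i, gi0, gi1, gii]; ring
  refine ⟨_, hnull, hnd _ (by simp [g00, g01, g0i, hs0]), (one_le_mult_iff hG hnull).mpr ?_⟩
  have hs' : D * s ^ 3 - 4 * contract T (F 1) (F i) * s ^ 2 +
      4 * (contract T (F i) (F i) - contract T (F 0) (F 1)) * s + 8 * contract T (F 0) (F i) = 0 := by
    field_simp at hs
    linarith
  simp only [contract_add_left, contract_add_right, contract_sub_left, contract_sub_right,
    contract_smul_left, contract_smul_right, h00, contract_comm hT (F i) (F 0),
    contract_comm hT (F 1) (F 0), contract_comm hT (F i) (F 1), ← hD]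
  linear_combination (s / 4) * hs'

/-- In dimension three, two double aligned null directions exclude single ones. -/
theorem mult_ne_one_of_two_double {G T : Tensor2 3} (hG : IsLorentzian G) (hT : T.IsSymm)
    {l₁ l₂ l₃ : Coord 3} (h₁ : IsNull G l₁) (h₂ : IsNull G l₂) (h₃ : IsNull G l₃)
    (hne : ¬ SameDir l₁ l₂) (hm₁ : mult G T l₁ = 2) (hm₂ : mult G T l₂ = 2) :
    mult G T l₃ ≠ 1 := by
  intro hm₃
  obtain ⟨F, hF, rfl, c, hc, hF1⟩ := hG.exists_nullFrame_of_not_sameDir h₁ h₂ hne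
  rw [← mult_smul hc, ← hF1] at hm₂
  have hz := (hF.two_le_mult_iff hT).mp hm₁.ge
  have hz' := (hF.swap.two_le_mult_iff hT).mp (by simpa using hm₂.ge)
  have t00 : contract T (F 0) (F 0) = 0 := hz 0 (by decide)
  have t02 : contract T (F 0) (F 2) = 0 := hz 2 (by decide)
  have t11 : contract T (F 1) (F 1) = 0 := by simpa using hz' 0 (by decide)
  have t12 : contract T (F 1) (F 2) = 0 := by
    simpa [Equiv.swap_apply_of_ne_of_ne (show (2 : Fin 3) ≠ 0 by decide) (show (2 : Fin 3) ≠ 1 by decide)] using hz' 2 (by decide)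
  have g : ∀ a b, contract G (F a) (F b) = _ := hF
  have h3n := h₃.2
  have h3t := (one_le_mult_iff hG h₃).mp hm₃.ge
  have hexp := hF.expand l₃
  rw [Fin.sum_univ_three] at hexp
  generalize contract G (F (Equiv.swap 0 1 0)) l₃ = x at hexp
  generalize contract G (F (Equiv.swap 0 1 1)) l₃ = y at hexp
  generalize contract G (F (Equiv.swap 0 1 2)) l₃ = z at hexp
  have e1 : 2 * (x * y) + z ^ 2 = 0 := by
    rw [hexp] at h3n
    simp [g] at h3n
    linarith
  have e2 : 2 * (x * y) * contract T (F 0) (F 1) + z ^ 2 * contract T (F 2) (F 2) = 0 := by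
    rw [hexp] at h3t
    simp [t00, t02, t11, t12, contract_comm hT (F 1) (F 0), contract_comm hT (F 2) (F 0),
      contract_comm hT (F 2) (F 1)] at h3t
    linarith
  -- If `z = 0`, the null condition makes `l₃` parallel to one of the two double directions.
  -- Otherwise nullity and alignment together force `T₂₂ = T₀₁`.
  by_cases hz0 : z = 0
  · have hxy : x * y = 0 := by rw [hz0] at e1; linarith
    rcases mul_eq_zero.mp hxy with hx | hy
    · have : SameDir (F 1) l₃ := ⟨y, by rw [hexp, hx, hz0]; simp⟩
      rw [this.mult_eq h₃.1, hm₂] at hm₃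
      exact absurd hm₃ (by decide)
    · have : SameDir (F 0) l₃ := ⟨x, by rw [hexp, hy, hz0]; simp⟩
      rw [this.mult_eq h₃.1, hm₁] at hm₃
      exact absurd hm₃ (by decide)
  · have t22 : contract T (F 2) (F 2) = contract T (F 0) (F 1) := by
      have : z ^ 2 * (contract T (F 2) (F 2) - contract T (F 0) (F 1)) = 0 := by
        linear_combination e2 - contract T (F 0) (F 1) * e1
      rcases mul_eq_zero.mp this with h | h
      · exact absurd (pow_eq_zero_iff (two_ne_zero)|>.mp h) hz0
      · linarith
    -- Now `T` is a multiple of the metric, and then every null direction is at least double.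
    have hTG : T = contract T (F 0) (F 1) • G := by
      refine hF.tensor_ext fun a b => ?_
      rw [show ∀ c v w, contract (c • G) v w = c * contract G v w from fun c v w => by
        simp [contract_eq, Matrix.smul_mulVec]]
      fin_cases a <;> fin_cases b <;>
        simp [t00, t02, t11, t12, t22, g, contract_comm hT (F 1) (F 0),
          contract_comm hT (F 2) (F 0), contract_comm hT (F 2) (F 1)]
    have : 2 ≤ mult G T l₃ := by
      obtain ⟨F', hF', rfl⟩ := hG.exists_nullFrame_of_isNull h₃
      rw [hF'.two_le_mult_iff hT]
      intro b hb
      rw [hTG, show ∀ c v w, contract (c • G) v w = c * contract G v w from fun c v w => by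
        simp [contract_eq, Matrix.smul_mulVec], hF']
      have hb' : b.val ≠ 1 := fun h => hb (Fin.ext h)
      rw [if_neg (by simpa using hb'), if_neg (by simp), mul_zero]
    rw [hm₃] at this
    exact absurd this (by decide)

end Mult
end GKS

namespace GKS

/-! ### Multiplicity patterns and the table of types -/

section Patterns
variable {κ : Type} {n : ℕ}

/-- The algebraic type of a nonzero tensor, read off from the multiplicities of all its null
directions. -/
def Pattern (m : κ → ℕ) : RicciType → Prop
  | .G => ∀ o, m o = 0
  | .I => ∃ o, m o = 1 ∧ ∀ o', o' ≠ o → m o' = 0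
  | .Ii => (∃ o o', o ≠ o' ∧ m o = 1 ∧ m o' = 1) ∧ ∀ o, m o ≤ 1
  | .II => ∃ o, m o = 2 ∧ ∀ o', o' ≠ o → m o' = 0
  | .IIi => ∃ o, m o = 2 ∧ (∃ o', m o' = 1) ∧ ∀ o', o' ≠ o → m o' ≤ 1
  | .D => ∃ o o', o ≠ o' ∧ m o = 2 ∧ m o' = 2
  | .III => ∃ o, m o = 3 ∧ ∀ o', o' ≠ o → m o' = 0
  | .IIIi => (∃ o, m o = 3) ∧ ∃ o', m o' = 1
  | .N => ∃ o, m o = 4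
  | .O => False

/-- The constraints on the multiplicities of the null directions of a nonzero symmetric tensor in
dimension `n`. -/
structure IsMultPattern (n : ℕ) (m : κ → ℕ) : Prop where
  le_four : ∀ o, m o ≤ 4
  add_le : ∀ o o', o ≠ o' → m o + m o' ≤ 4
  other : ∀ o, m o = 1 → ∃ o', o' ≠ o ∧ 1 ≤ m o'
  three : n ≤ 3 → ∀ o o' o'', o ≠ o' → m o = 2 → m o' = 2 → m o'' ≠ 1

variable {m : κ → ℕ}

/-- The bound on sums separates the types: beside a direction of multiplicity at least 3 all others
are at most single, and beside a quadruple one there are none. -/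
theorem IsMultPattern.unique (h : IsMultPattern n m) {t t' : RicciType} (ht : Pattern m t)
    (ht' : Pattern m t') : t = t' := by
  have h1 : ∀ o, 3 ≤ m o → ∀ o', m o' ≤ 1 ∨ o' = o := by
    intro o ho o'
    by_contra! hne
    have := h.add_le o' o hne.2
    omega
  have h2 : ∀ o, m o = 4 → ∀ o', m o' = 0 ∨ o' = o := by
    intro o ho o'
    by_contra! hne
    have := h.add_le o' o hne.2
    omega
  cases t <;> cases t' <;> simp only [Pattern] at ht ht' <;> first | rfl | exact ht.elim | exact ht'.elim | grind +splitImp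

/-- A single AND is always accompanied by another AND, which is again single here. This is why type
`I` never occurs, and it supplies the second direction required by each `I_i` entry. -/
theorem IsMultPattern.pattern_Ii (h : IsMultPattern n m) (h1 : ∀ o, m o ≤ 1) {o : κ}
    (ho : m o = 1) : Pattern m .Ii ∧ ∃ o', o' ≠ o ∧ m o' = 1 := by
  obtain ⟨o', hne, h'⟩ := h.other o ho
  have := h1 o'
  exact ⟨⟨⟨o, o', hne.symm, ho, by omega⟩, h1⟩, o', hne, by omega⟩

/-- Classification by the largest multiplicity that occurs, then by the presence of further double
or single directions. -/
theorem IsMultPattern.exists_pattern (h : IsMultPattern n m) : ∃ t, Pattern m t := by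
  by_cases h0 : ∀ o, m o = 0
  · exact ⟨.G, h0⟩
  by_cases h1 : ∀ o, m o ≤ 1
  · push Not at h0
    obtain ⟨o, ho⟩ := h0
    have := h1 o
    exact ⟨.Ii, (h.pattern_Ii h1 (o := o) (by omega)).1⟩
  push Not at h1
  obtain ⟨o, ho⟩ := h1
  have h4 := h.le_four o
  have hadd := h.add_le
  obtain h2 | h3 | h4 : m o = 2 ∨ m o = 3 ∨ m o = 4 := by omega
  · by_cases hD : ∃ o', o' ≠ o ∧ 2 ≤ m o'
    · obtain ⟨o', hne, h'⟩ := hD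
      have := hadd o o' hne.symm
      exact ⟨.D, o, o', hne.symm, h2, by omega⟩
    push Not at hD
    by_cases hi : ∃ o', m o' = 1
    · exact ⟨.IIi, o, h2, hi, fun o' ho' => by have := hD o' ho'; omega⟩
    · push Not at hi
      exact ⟨.II, o, h2, fun o' ho' => by have := hD o' ho'; have := hi o'; omega⟩
  · by_cases hi : ∃ o', m o' = 1
    · exact ⟨.IIIi, ⟨o, h3⟩, hi⟩
    · push Not at hi
      exact ⟨.III, o, h3, fun o' ho' => by have := hadd o o' ho'.symm; have := hi o'; omega⟩
  · exact ⟨.N, o, h4⟩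

theorem RicciTable.rank_le {ι : Type} {kb kf : ℕ∞} {lb lf : ι → ℕ∞} {tb tf : RicciType}
    (h : RicciTable n kb kf lb lf tb tf) : tf.rank ≤ tb.rank := by
  cases h <;> simp [RicciType.rank]

end Patterns

/-! ### Degeneration of multiplicities and completeness of the table -/

section Table
variable {ι : Type} {n : ℕ} {mb mf : Option ι → ℕ}

/-- The relation between the multiplicities of the background and of the full geometry. -/
structure IsDegeneration (n : ℕ) (mb mf : Option ι → ℕ) : Prop where
  bg : IsMultPattern n mb
  full : IsMultPattern n mf
  le : ∀ o, mf o ≤ mb o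
  k_one : 1 ≤ mb none → 1 ≤ mf none
  k_two : 2 ≤ mb none → 2 ≤ mf none

/-- The table contains an entry with background type `tb` for the given multiplicities. -/
def HasEntry (n : ℕ) (mb mf : Option ι → ℕ) (tb : RicciType) : Prop :=
  ∃ tf, Pattern mf tf ∧ RicciTable n (mb none : ℕ∞) (mf none : ℕ∞)
    (fun l : ι => (mb (some l) : ℕ∞)) (fun l => (mf (some l) : ℕ∞)) tb tf

theorem IsDegeneration.entry_G (h : IsDegeneration n mb mf) (hb : Pattern mb .G) :
    HasEntry n mb mf .G := by
  have hb : ∀ o, mb o = 0 := hb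
  have hf : ∀ o, mf o = 0 := fun o => by have := h.le o; have := hb o; omega
  exact ⟨.G, hf, .G_G (by simp [hb]) (by simp [hb]) (by simp [hf]) (by simp [hf])⟩

/-- An aligned `k` stays aligned, so full type `G` is possible only when `k` is not an AND of the
background. -/
theorem IsDegeneration.zero_of_zero (h : IsDegeneration n mb mf) (hk : ∀ o, mf o = 0) :
    mb none = 0 := by
  by_contra h0
  have := h.k_one (by omega)
  have := hk none
  omega

/-- Every AND of the full geometry is single here, and so is its background counterpart. The entries
differ only by whether `k`, whose alignment is inherited, is one of them. -/
theorem IsDegeneration.entry_Ii (h : IsDegeneration n mb mf) (hb : Pattern mb .Ii) :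
    HasEntry n mb mf .Ii := by
  obtain ⟨⟨o₁, o₂, hne, ho₁, ho₂⟩, hle⟩ := hb
  by_cases hf : ∀ o, mf o = 0
  · have hk := h.zero_of_zero hf
    obtain ⟨l₁, rfl⟩ : ∃ l, o₁ = some l := Option.ne_none_iff_exists'.mp (by grind)
    obtain ⟨l₂, rfl⟩ : ∃ l, o₂ = some l := Option.ne_none_iff_exists'.mp (by grind)
    exact ⟨.G, hf, .Ii_G l₁ l₂ (by grind) (by simp [hk]) (by simp [ho₁]) (by simp [ho₂])
      (by simp [hf]) (by simp [hf])⟩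
  push Not at hf
  have hf1 : ∀ o, mf o ≤ 1 := fun o => (h.le o).trans (hle o)
  by_cases hk : mb none = 0
  · obtain ⟨o, ho⟩ := hf
    have hfk : mf none = 0 := by have := h.le none; omega
    have ho : mf o = 1 := by have := hf1 o; omega
    obtain ⟨hp, o', hne', ho'⟩ := h.full.pattern_Ii hf1 ho
    obtain ⟨l₁, rfl⟩ : ∃ l, o = some l := Option.ne_none_iff_exists'.mp (by grind)
    obtain ⟨l₂, rfl⟩ : ∃ l, o' = some l := Option.ne_none_iff_exists'.mp (by grind)
    have hb₁ : mb (some l₁) = 1 := by have := h.le (some l₁); have := hle (some l₁); omega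
    have hb₂ : mb (some l₂) = 1 := by have := h.le (some l₂); have := hle (some l₂); omega
    exact ⟨.Ii, hp, .Ii_Ii l₁ l₂ (by grind) (by simp [hk]) (by simp [hb₁]) (by simp [hb₂])
      (by simp [hfk]) (by simp [ho]) (by simp [ho'])⟩
  · have hfk : mf none = 1 := by have := h.k_one (by omega); have := hf1 none; omega
    have hk : mb none = 1 := by have := hle none; omega
    obtain ⟨hp, o', hne', ho'⟩ := h.full.pattern_Ii hf1 hfk
    obtain ⟨l, rfl⟩ : ∃ l, o' = some l := Option.ne_none_iff_exists'.mp (by grind)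
    have hb : mb (some l) = 1 := by have := h.le (some l); have := hle (some l); omega
    exact ⟨.Ii, hp, .Ii_Ii_k l (by simp [hk]) (by simp [hb]) (by simp [hfk]) (by simp [ho'])⟩

/-- Only one direction can be aligned, so its full multiplicity cannot be 1: a single AND would need
a companion. If that direction is `k`, multiplicity 0 is excluded as well. -/
theorem IsDegeneration.entry_II (h : IsDegeneration n mb mf) (hb : Pattern mb .II) :
    HasEntry n mb mf .II := by
  obtain ⟨o, ho, hz⟩ := hb
  have hzf : ∀ o', o' ≠ o → mf o' = 0 := fun o' ho' => by
    have := h.le o'; have := hz o' ho'; omega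
  have h1 : mf o ≠ 1 := fun h1 => by
    obtain ⟨o', hne, h'⟩ := h.full.other o h1
    have := hzf o' hne
    omega
  have h2 := h.le o
  rcases o with _ | l
  · have hf : mf none = 2 := by have := h.k_two ho.ge; omega
    exact ⟨.II, ⟨none, hf, hzf⟩, .II_II_k (by simp [ho]) (by simp [hz]) (by simp [hf]) (by simp [hzf])⟩
  have hk : mb none = 0 := hz none (by simp)
  have hkf : mf none = 0 := hzf none (by simp)
  by_cases h0 : mf (some l) = 0
  · have hf : ∀ o, mf o = 0 := by grind
    exact ⟨.G, hf, .II_G l (by simp [hk]) (by simp [ho]) (fun l' hl' => by simp [hz, hl'])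
      (by simp [hf]) (by simp [hf])⟩
  · have hf : mf (some l) = 2 := by omega
    exact ⟨.II, ⟨_, hf, hzf⟩, .II_II l (by simp [hk]) (by simp [ho])
      (fun l' hl' => by simp [hz, hl']) (by simp [hkf]) (by simp [hf])
      (fun l' hl' => by simp [hzf, hl'])⟩

/-- The full type is governed by what remains of the unique double direction; all others are at most
single in both geometries. A double `k` stays double, a single `k` stays single. -/
theorem IsDegeneration.entry_IIi (h : IsDegeneration n mb mf) (hb : Pattern mb .IIi) :
    HasEntry n mb mf .IIi := by
  obtain ⟨o, ho, ⟨o₁, ho₁⟩, hle⟩ := hb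
  have hlef : ∀ o', o' ≠ o → mf o' ≤ 1 := fun o' ho' => (h.le o').trans (hle o' ho')
  have hfo := h.le o
  have hne₁ : o₁ ≠ o := by rintro rfl; omega
  rcases o with _ | l
  · have hf : mf none = 2 := by have := h.k_two ho.ge; omega
    obtain ⟨l, rfl⟩ := Option.ne_none_iff_exists'.mp hne₁
    by_cases h0 : ∀ o', o' ≠ none → mf o' = 0
    · exact ⟨.II, ⟨none, hf, h0⟩, .IIi_II_k2 l (by simp [ho]) (by simp [ho₁]) (by simp [hf])
        (by simp [h0])⟩
    · push Not at h0
      obtain ⟨o', hne, ho'⟩ := h0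
      obtain ⟨l', rfl⟩ := Option.ne_none_iff_exists'.mp hne
      have hf' : mf (some l') = 1 := by have := hlef _ hne; omega
      have hb' : mb (some l') = 1 := by have := hle _ hne; have := h.le (some l'); omega
      exact ⟨.IIi, ⟨none, hf, ⟨_, hf'⟩, hlef⟩, .IIi_IIi_k2 l' (by simp [ho]) (by simp [hb'])
        (by simp [hf]) (by simp [hf'])⟩
  have hkle := hle none (by simp)
  by_cases hk : mb none = 0
  · have hkf : mf none = 0 := by have := h.le none; omega
    obtain ⟨l₁, rfl⟩ : ∃ l, o₁ = some l := Option.ne_none_iff_exists'.mp (by grind)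
    by_cases hall : ∀ o, mf o = 0
    · exact ⟨.G, hall, .IIi_G l l₁ (by simp [hk]) (by simp [ho]) (by simp [ho₁]) (by simp [hall])
        (by simp [hall])⟩
    obtain h0 | h1 | h2 : mf (some l) = 0 ∨ mf (some l) = 1 ∨ mf (some l) = 2 := by omega
    · have hf1 : ∀ o, mf o ≤ 1 := by grind
      push Not at hall
      obtain ⟨o', ho'⟩ := hall
      have ho' : mf o' = 1 := by have := hf1 o'; omega
      obtain ⟨hp, o'', hne, ho''⟩ := h.full.pattern_Ii hf1 ho'
      have e' := hle o' (by grind)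
      have e'' := hle o'' (by grind)
      have := h.le o'
      have := h.le o''
      obtain ⟨l₂, rfl⟩ : ∃ l, o' = some l := Option.ne_none_iff_exists'.mp (by grind)
      obtain ⟨l₃, rfl⟩ : ∃ l, o'' = some l := Option.ne_none_iff_exists'.mp (by grind)
      exact ⟨.Ii, hp, .IIi_Ii l l₂ l₃ (by grind) (by simp [hk]) (by simp [ho])
        (by norm_cast; omega) (by norm_cast; omega) (by simp [hkf]) (by simp [h0]) (by simp [ho'])
        (by simp [ho''])⟩
    · have hf1 : ∀ o, mf o ≤ 1 := by grind
      obtain ⟨hp, o', hne, ho'⟩ := h.full.pattern_Ii hf1 h1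
      have := hle o' hne
      have := h.le o'
      obtain ⟨l₂, rfl⟩ : ∃ l, o' = some l := Option.ne_none_iff_exists'.mp (by grind)
      exact ⟨.Ii, hp, .IIi_Ii' l l₂ (by simp [hk]) (by simp [ho]) (by norm_cast; omega)
        (by simp [hkf]) (by simp [h1]) (by simp [ho'])⟩
    · by_cases hz : ∀ o', o' ≠ some l → mf o' = 0
      · exact ⟨.II, ⟨_, h2, hz⟩, .IIi_II l l₁ (by simp [hk]) (by simp [ho]) (by simp [ho₁])
          (by simp [hkf]) (by simp [h2]) (fun l' hl' => by simp [hz, hl'])⟩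
      · push Not at hz
        obtain ⟨o', hne, ho'⟩ := hz
        have := hle o' hne
        have := h.le o'
        obtain ⟨l₂, rfl⟩ : ∃ l, o' = some l := Option.ne_none_iff_exists'.mp (by grind)
        have ho' : mf (some l₂) = 1 := by omega
        exact ⟨.IIi, ⟨_, h2, ⟨_, ho'⟩, hlef⟩, .IIi_IIi l l₂ (by simp [hk]) (by simp [ho])
          (by norm_cast; omega) (by simp [hkf]) (by simp [h2]) (by simp [ho'])⟩
  · have hk : mb none = 1 := by omega
    have hkf : mf none = 1 := by have := h.k_one hk.ge; have := h.le none; omega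
    by_cases h2 : mf (some l) = 2
    · exact ⟨.IIi, ⟨_, h2, ⟨_, hkf⟩, hlef⟩, .IIi_IIi_k1 l (by simp [hk]) (by simp [ho])
        (by simp [hkf]) (by simp [h2])⟩
    · have hf1 : ∀ o, mf o ≤ 1 := by grind
      exact ⟨.Ii, (h.full.pattern_Ii hf1 hkf).1, .IIi_Ii_k1 l (by simp [hk]) (by simp [ho])
        (by simp [hkf]) (fun l => by exact_mod_cast hf1 (some l))⟩

/-- As for type `II`, the one possible AND cannot become single. If it is `k`, double alignment is
inherited, but triple alignment need not be. -/
theorem IsDegeneration.entry_III (h : IsDegeneration n mb mf) (hb : Pattern mb .III) :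
    HasEntry n mb mf .III := by
  obtain ⟨o, ho, hz⟩ := hb
  have hzf : ∀ o', o' ≠ o → mf o' = 0 := fun o' ho' => by
    have := h.le o'; have := hz o' ho'; omega
  have h1 : mf o ≠ 1 := fun h1 => by
    obtain ⟨o', hne, h'⟩ := h.full.other o h1
    have := hzf o' hne
    omega
  have h2 := h.le o
  rcases o with _ | l
  · have := h.k_two (by omega)
    obtain hf | hf : mf none = 2 ∨ mf none = 3 := by omega
    · exact ⟨.II, ⟨none, hf, hzf⟩, .III_II_k (by simp [ho]) (by simp [hz]) (by simp [hf])
        (by simp [hzf])⟩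
    · exact ⟨.III, ⟨none, hf, hzf⟩, .III_III_k (by simp [ho]) (by simp [hz]) (by simp [hf])
        (by simp [hzf])⟩
  have hk : mb none = 0 := hz none (by simp)
  have hkf : mf none = 0 := hzf none (by simp)
  obtain hf | hf | hf : mf (some l) = 0 ∨ mf (some l) = 2 ∨ mf (some l) = 3 := by omega
  · have hf : ∀ o, mf o = 0 := by grind
    exact ⟨.G, hf, .III_G l (by simp [hk]) (by simp [ho]) (by simp [hf]) (by simp [hf])⟩
  · exact ⟨.II, ⟨_, hf, hzf⟩, .III_II l (by simp [hk]) (by simp [ho])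
      (by simp [hkf]) (by simp [hf]) (fun l' hl' => by simp [hzf, hl'])⟩
  · exact ⟨.III, ⟨_, hf, hzf⟩, .III_III l (by simp [hk]) (by simp [ho])
      (by simp [hkf]) (by simp [hf]) (fun l' hl' => by simp [hzf, hl'])⟩

/-- The bound on sums leaves multiplicity at most 1 away from the triple direction. The cases are as
for `II_i`, except that the distinguished direction may now remain double or triple. -/
theorem IsDegeneration.entry_IIIi (h : IsDegeneration n mb mf) (hb : Pattern mb .IIIi) :
    HasEntry n mb mf .IIIi := by
  obtain ⟨⟨o, ho⟩, o₁, ho₁⟩ := hb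
  have hle : ∀ o', o' ≠ o → mb o' ≤ 1 := fun o' ho' => by
    have := h.bg.add_le o o' (Ne.symm ho')
    omega
  have hlef : ∀ o', o' ≠ o → mf o' ≤ 1 := fun o' ho' => (h.le o').trans (hle o' ho')
  have hfo := h.le o
  have hne₁ : o₁ ≠ o := by rintro rfl; omega
  rcases o with _ | l
  · have := h.k_two (by omega)
    obtain ⟨l, rfl⟩ := Option.ne_none_iff_exists'.mp hne₁
    by_cases h0 : ∀ o', o' ≠ none → mf o' = 0
    · obtain hf | hf : mf none = 2 ∨ mf none = 3 := by omega
      · exact ⟨.II, ⟨none, hf, h0⟩, .IIIi_II_k3 l (by simp [ho]) (by simp [ho₁]) (by simp [hf])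
          (by simp [h0])⟩
      · exact ⟨.III, ⟨none, hf, h0⟩, .IIIi_III_k3 l (by simp [ho]) (by simp [ho₁]) (by simp [hf])
          (by simp [h0])⟩
    · push Not at h0
      obtain ⟨o', hne, ho'⟩ := h0
      obtain ⟨l', rfl⟩ := Option.ne_none_iff_exists'.mp hne
      have hf' : mf (some l') = 1 := by have := hlef _ hne; omega
      have hb' : mb (some l') = 1 := by have := hle _ hne; have := h.le (some l'); omega
      obtain hf | hf : mf none = 2 ∨ mf none = 3 := by omega
      · exact ⟨.IIi, ⟨none, hf, ⟨_, hf'⟩, hlef⟩, .IIIi_IIi_k3 l' (by simp [ho]) (by simp [hb'])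
          (by simp [hf]) (by simp [hf'])⟩
      · exact ⟨.IIIi, ⟨⟨none, hf⟩, ⟨_, hf'⟩⟩, .IIIi_IIIi_k3 l' (by simp [ho]) (by simp [hb'])
          (by simp [hf]) (by simp [hf'])⟩
  have hkle := hle none (by simp)
  by_cases hk : mb none = 0
  · have hkf : mf none = 0 := by have := h.le none; omega
    obtain ⟨l₁, rfl⟩ : ∃ l, o₁ = some l := Option.ne_none_iff_exists'.mp (by grind)
    by_cases hall : ∀ o, mf o = 0
    · exact ⟨.G, hall, .IIIi_G l l₁ (by simp [hk]) (by simp [ho]) (by simp [ho₁]) (by simp [hall])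
        (by simp [hall])⟩
    obtain h0 | h1 | h2 : mf (some l) = 0 ∨ mf (some l) = 1 ∨ 2 ≤ mf (some l) := by omega
    · have hf1 : ∀ o, mf o ≤ 1 := by grind
      push Not at hall
      obtain ⟨o', ho'⟩ := hall
      have ho' : mf o' = 1 := by have := hf1 o'; omega
      obtain ⟨hp, o'', hne, ho''⟩ := h.full.pattern_Ii hf1 ho'
      have e' := hle o' (by grind)
      have e'' := hle o'' (by grind)
      have := h.le o'
      have := h.le o''
      obtain ⟨l₂, rfl⟩ : ∃ l, o' = some l := Option.ne_none_iff_exists'.mp (by grind)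
      obtain ⟨l₃, rfl⟩ : ∃ l, o'' = some l := Option.ne_none_iff_exists'.mp (by grind)
      exact ⟨.Ii, hp, .IIIi_Ii l l₂ l₃ (by grind) (by simp [hk]) (by simp [ho])
        (by norm_cast; omega) (by norm_cast; omega) (by simp [hkf]) (by simp [h0]) (by simp [ho'])
        (by simp [ho''])⟩
    · have hf1 : ∀ o, mf o ≤ 1 := by grind
      obtain ⟨hp, o', hne, ho'⟩ := h.full.pattern_Ii hf1 h1
      have := hle o' hne
      have := h.le o'
      obtain ⟨l₂, rfl⟩ : ∃ l, o' = some l := Option.ne_none_iff_exists'.mp (by grind)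
      exact ⟨.Ii, hp, .IIIi_Ii' l l₂ (by simp [hk]) (by simp [ho]) (by norm_cast; omega)
        (by simp [hkf]) (by simp [h1]) (by simp [ho'])⟩
    · by_cases hz : ∀ o', o' ≠ some l → mf o' = 0
      · obtain h2 | h2 : mf (some l) = 2 ∨ mf (some l) = 3 := by omega
        · exact ⟨.II, ⟨_, h2, hz⟩, .IIIi_II l l₁ (by simp [hk]) (by simp [ho]) (by simp [ho₁])
            (by simp [hkf]) (by simp [h2]) (fun l' hl' => by simp [hz, hl'])⟩
        · exact ⟨.III, ⟨_, h2, hz⟩, .IIIi_III l l₁ (by simp [hk]) (by simp [ho]) (by simp [ho₁])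
            (by simp [hkf]) (by simp [h2]) (fun l' hl' => by simp [hz, hl'])⟩
      · push Not at hz
        obtain ⟨o', hne, ho'⟩ := hz
        have := hle o' hne
        have := h.le o'
        obtain ⟨l₂, rfl⟩ : ∃ l, o' = some l := Option.ne_none_iff_exists'.mp (by grind)
        have ho' : mf (some l₂) = 1 := by omega
        obtain h2 | h2 : mf (some l) = 2 ∨ mf (some l) = 3 := by omega
        · exact ⟨.IIi, ⟨_, h2, ⟨_, ho'⟩, hlef⟩, .IIIi_IIi l l₂ (by simp [hk]) (by simp [ho])
            (by norm_cast; omega) (by simp [hkf]) (by simp [h2]) (by simp [ho'])⟩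
        · exact ⟨.IIIi, ⟨⟨_, h2⟩, ⟨_, ho'⟩⟩, .IIIi_IIIi l l₂ (by simp [hk]) (by simp [ho])
            (by norm_cast; omega) (by simp [hkf]) (by simp [h2]) (by simp [ho'])⟩
  · have hk : mb none = 1 := by omega
    have hkf : mf none = 1 := by have := h.k_one hk.ge; have := h.le none; omega
    obtain h1 | h2 | h3 : mf (some l) ≤ 1 ∨ mf (some l) = 2 ∨ mf (some l) = 3 := by omega
    · have hf1 : ∀ o, mf o ≤ 1 := by grind
      exact ⟨.Ii, (h.full.pattern_Ii hf1 hkf).1, .IIIi_Ii_k1 l (by simp [hk]) (by simp [ho])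
        (by simp [hkf]) (fun l => by exact_mod_cast hf1 (some l))⟩
    · exact ⟨.IIi, ⟨_, h2, ⟨_, hkf⟩, hlef⟩, .IIIi_IIi_k1 l (by simp [hk]) (by simp [ho])
        (by simp [hkf]) (by simp [h2])⟩
    · exact ⟨.IIIi, ⟨⟨_, h3⟩, ⟨_, hkf⟩⟩, .IIIi_IIIi_k1 l (by simp [hk]) (by simp [ho])
        (by simp [hkf]) (by simp [h3])⟩

/-- A quadruple direction excludes all other ANDs, so multiplicity 1 is impossible in the full
geometry for lack of a companion. -/
theorem IsDegeneration.entry_N (h : IsDegeneration n mb mf) (hb : Pattern mb .N) :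
    HasEntry n mb mf .N := by
  obtain ⟨o, ho⟩ := hb
  have hz : ∀ o', o' ≠ o → mb o' = 0 := fun o' ho' => by
    have := h.bg.add_le o o' (Ne.symm ho')
    omega
  have hzf : ∀ o', o' ≠ o → mf o' = 0 := fun o' ho' => by
    have := h.le o'; have := hz o' ho'; omega
  have h1 : mf o ≠ 1 := fun h1 => by
    obtain ⟨o', hne, h'⟩ := h.full.other o h1
    have := hzf o' hne
    omega
  have h2 := h.le o
  rcases o with _ | l
  · have := h.k_two (by omega)
    obtain hf | hf | hf : mf none = 2 ∨ mf none = 3 ∨ mf none = 4 := by omega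
    · exact ⟨.II, ⟨none, hf, hzf⟩, .N_II_k (by simp [ho]) (by simp [hf]) (by simp [hzf])⟩
    · exact ⟨.III, ⟨none, hf, hzf⟩, .N_III_k (by simp [ho]) (by simp [hf]) (by simp [hzf])⟩
    · exact ⟨.N, ⟨none, hf⟩, .N_N_k (by simp [ho]) (by simp [hf]) (by simp [hzf])⟩
  have hk : mb none = 0 := hz none (by simp)
  have hkf : mf none = 0 := hzf none (by simp)
  obtain hf | hf | hf | hf : mf (some l) = 0 ∨ mf (some l) = 2 ∨ mf (some l) = 3 ∨
    mf (some l) = 4 := by omega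
  · have hf : ∀ o, mf o = 0 := by grind
    exact ⟨.G, hf, .N_G l (by simp [hk]) (by simp [ho]) (by simp [hf]) (by simp [hf])⟩
  · exact ⟨.II, ⟨_, hf, hzf⟩, .N_II l (by simp [hk]) (by simp [ho])
      (by simp [hkf]) (by simp [hf]) (fun l' hl' => by simp [hzf, hl'])⟩
  · exact ⟨.III, ⟨_, hf, hzf⟩, .N_III l (by simp [hk]) (by simp [ho])
      (by simp [hkf]) (by simp [hf]) (fun l' hl' => by simp [hzf, hl'])⟩
  · exact ⟨.N, ⟨_, hf⟩, .N_N l (by simp [hk]) (by simp [ho])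
      (by simp [hkf]) (by simp [hf]) (fun l' hl' => by simp [hzf, hl'])⟩

theorem IsDegeneration.entry_D_of_not_aligned (h : IsDegeneration n mb mf) (hk : mb none = 0)
    {l₁ l₂ : ι} (hne : l₁ ≠ l₂)
    (h₁ : mb (some l₁) = 2) (h₂ : mb (some l₂) = 2) (hle : ∀ o, mb o ≤ 2) :
    HasEntry n mb mf .D := by
  have hkf : mf none = 0 := by have := h.le none; omega
  have hlef : ∀ o, mf o ≤ 2 := fun o => (h.le o).trans (hle o)
  -- A single AND beside two double ones is impossible for `n = 3`; this yields the dimension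
  -- restriction of some entries.
  have hn : ∀ o, mb o = 1 → 3 < n := fun o ho => by
    by_contra hn
    exact h.bg.three (by omega) (some l₁) (some l₂) o (by simpa using hne) h₁ h₂ ho
  by_cases hall : ∀ o, mf o = 0
  · exact ⟨.G, hall, .D_G l₁ l₂ hne (by simp [hk]) (by simp [h₁]) (by simp [h₂]) (by simp [hall])
      (by simp [hall])⟩
  by_cases hmax : ∀ o, mf o ≤ 1
  · have hpat : ∀ o, mf o = 1 → ∃ l l', l ≠ l' ∧ o = some l ∧ mf (some l') = 1 ∧ Pattern mf .Ii := by
      intro o ho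
      obtain ⟨hp, o', hne', ho'⟩ := h.full.pattern_Ii hmax ho
      obtain ⟨l, rfl⟩ : ∃ l, o = some l := Option.ne_none_iff_exists'.mp (by grind)
      obtain ⟨l', rfl⟩ : ∃ l, o' = some l := Option.ne_none_iff_exists'.mp (by grind)
      exact ⟨l, l', by grind, rfl, ho', hp⟩
    by_cases hd : ∃ l, mb (some l) = 2 ∧ mf (some l) = 1
    · obtain ⟨l, hbl, hfl⟩ := hd
      obtain ⟨l₀, l', hne', hl₀, hfl', hp⟩ := hpat _ hfl
      obtain rfl := Option.some.inj hl₀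
      have hbl' := h.le (some l')
      have hbl'' := hle (some l')
      -- A background double direction other than `l`. If it is still single, the entry with two
      -- formerly double directions applies; if it has lost its alignment, the companion `l'` of `l`
      -- came from a single AND.
      obtain ⟨l'', hne'', hbl3⟩ : ∃ l'', l ≠ l'' ∧ mb (some l'') = 2 := by
        by_cases e : l = l₁
        · exact ⟨l₂, e ▸ hne, h₂⟩
        · exact ⟨l₁, e, h₁⟩
      by_cases hd' : mb (some l') = 2
      · exact ⟨.Ii, hp, .D_Ii l l' hne' (by simp [hk]) (by simp [hbl]) (by simp [hd']) (by simp [hkf])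
          (by simp [hfl]) (by simp [hfl'])⟩
      have hb' : mb (some l') = 1 := by omega
      by_cases hf'' : mf (some l'') = 1
      · exact ⟨.Ii, hp, .D_Ii l l'' hne'' (by simp [hk]) (by simp [hbl]) (by simp [hbl3])
          (by simp [hkf]) (by simp [hfl]) (by simp [hf''])⟩
      have hf0 : mf (some l'') = 0 := by have := hmax (some l''); omega
      exact ⟨.Ii, hp, .D_Ii' (hn _ hb') l l'' l' hne'' (by simp [hk]) (by simp [hbl])
        (by simp [hbl3]) (by simp [hb']) (by simp [hkf]) (by simp [hfl]) (by simp [hf0])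
        (by simp [hfl'])⟩
    -- No background double direction remains aligned, so all full ANDs come from single ANDs of the
    -- background.
    · push Not at hd
      push Not at hall
      obtain ⟨o, ho⟩ := hall
      have ho1 : mf o = 1 := by have := hmax o; omega
      obtain ⟨l, l', hne', rfl, hfl', hp⟩ := hpat _ ho1
      have hs : ∀ l, mf (some l) = 1 → mb (some l) = 1 := fun l hl => by
        have := hd l
        have := h.le (some l)
        have := hle (some l)
        omega
      have hz : ∀ l, mb (some l) = 2 → mf (some l) = 0 := fun l hl => by
        have := hd l hl
        have := hmax (some l)
        omega
      exact ⟨.Ii, hp, .D_Ii'' (hn _ (hs l ho1)) l₁ l₂ l l' hne hne' (by simp [hk]) (by simp [h₁])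
        (by simp [h₂]) (by simp [hs l ho1]) (by simp [hs l' hfl']) (by simp [hkf])
        (by simp [hz l₁ h₁]) (by simp [hz l₂ h₂]) (by simp [ho1]) (by simp [hfl'])⟩
  push Not at hmax
  obtain ⟨o, ho⟩ := hmax
  have ho : mf o = 2 := by have := hlef o; omega
  obtain ⟨l, rfl⟩ : ∃ l, o = some l := Option.ne_none_iff_exists'.mp (by grind)
  have hbl : mb (some l) = 2 := by have := h.le (some l); have := hle (some l); omega
  by_cases hD : ∃ l', l ≠ l' ∧ mf (some l') = 2
  · obtain ⟨l', hne', hl'⟩ := hD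
    have hbl' : mb (some l') = 2 := by have := h.le (some l'); have := hle (some l'); omega
    exact ⟨.D, ⟨some l, some l', by simpa using hne', ho, hl'⟩, .D_D l l' hne' (by simp [hk])
      (by simp [hbl]) (by simp [hbl']) (by simp [hkf]) (by simp [ho]) (by simp [hl'])⟩
  push Not at hD
  have hle1 : ∀ o', o' ≠ some l → mf o' ≤ 1 := by
    intro o' ho'
    rcases o' with _ | l'
    · omega
    · have := hD l' (by grind)
      have := hlef (some l')
      omega
  obtain ⟨l'', hne'', hbl''⟩ : ∃ l'', l ≠ l'' ∧ mb (some l'') = 2 := by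
    by_cases e : l = l₁
    · exact ⟨l₂, e ▸ hne, h₂⟩
    · exact ⟨l₁, e, h₁⟩
  by_cases hz : ∀ o', o' ≠ some l → mf o' = 0
  · exact ⟨.II, ⟨_, ho, hz⟩, .D_II l l'' hne'' (by simp [hk]) (by simp [hbl]) (by simp [hbl''])
      (by simp [hkf]) (by simp [ho]) (fun l' hl' => by simp [hz, hl'])⟩
  push Not at hz
  obtain ⟨o', hne', ho'⟩ := hz
  have ho' : mf o' = 1 := by have := hle1 o' hne'; omega
  obtain ⟨l', rfl⟩ : ∃ l, o' = some l := Option.ne_none_iff_exists'.mp (by grind)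
  have hp : Pattern mf .IIi := ⟨_, ho, ⟨_, ho'⟩, hle1⟩
  by_cases hb2 : mb (some l') = 2
  · exact ⟨.IIi, hp, .D_IIi l l' (by grind) (by simp [hk]) (by simp [hbl]) (by simp [hb2])
      (by simp [hkf]) (by simp [ho]) (by simp [ho'])⟩
  have hb1 : mb (some l') = 1 := by have := h.le (some l'); have := hle (some l'); omega
  by_cases hf1 : mf (some l'') = 1
  · exact ⟨.IIi, hp, .D_IIi l l'' hne'' (by simp [hk]) (by simp [hbl]) (by simp [hbl''])
      (by simp [hkf]) (by simp [ho]) (by simp [hf1])⟩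
  have hf0 : mf (some l'') = 0 := by have := hle1 (some l'') (by grind); omega
  exact ⟨.IIi, hp, .D_IIi' (hn _ hb1) l l'' l' hne'' (by simp [hk]) (by simp [hbl])
    (by simp [hbl'']) (by simp [hb1]) (by simp [hkf]) (by simp [ho]) (by simp [hf0])
    (by simp [ho'])⟩

theorem IsDegeneration.entry_D_of_single (h : IsDegeneration n mb mf) (hk : mb none = 1)
    {l₁ l₂ : ι} (hne : l₁ ≠ l₂)
    (h₁ : mb (some l₁) = 2) (h₂ : mb (some l₂) = 2) (hle : ∀ o, mb o ≤ 2) :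
    HasEntry n mb mf .D := by
  have hkf : mf none = 1 := by have := h.k_one hk.ge; have := h.le none; omega
  have hlef : ∀ o, mf o ≤ 2 := fun o => (h.le o).trans (hle o)
  -- Here `k` itself is the single AND beside two double ones.
  have hn : 3 < n := by
    by_contra hn
    exact h.bg.three (by omega) (some l₁) (some l₂) none (by simpa using hne) h₁ h₂ hk
  by_cases hmax : ∀ o, mf o ≤ 1
  · exact ⟨.Ii, (h.full.pattern_Ii hmax hkf).1, .D_Ii_k1 hn l₁ l₂ hne (by simp [hk]) (by simp [h₁])
      (by simp [h₂]) (by simp [hkf]) (fun l => by exact_mod_cast hmax (some l))⟩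
  push Not at hmax
  obtain ⟨o, ho⟩ := hmax
  have ho : mf o = 2 := by have := hlef o; omega
  obtain ⟨l, rfl⟩ : ∃ l, o = some l := Option.ne_none_iff_exists'.mp (by grind)
  have hbl : mb (some l) = 2 := by have := h.le (some l); have := hle (some l); omega
  by_cases hD : ∃ l', l ≠ l' ∧ mf (some l') = 2
  · obtain ⟨l', hne', hl'⟩ := hD
    have hbl' : mb (some l') = 2 := by have := h.le (some l'); have := hle (some l'); omega
    exact ⟨.D, ⟨some l, some l', by simpa using hne', ho, hl'⟩, .D_D_k1 hn l l' hne' (by simp [hk])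
      (by simp [hbl]) (by simp [hbl']) (by simp [hkf]) (by simp [ho]) (by simp [hl'])⟩
  push Not at hD
  have hle1 : ∀ o', o' ≠ some l → mf o' ≤ 1 := by
    intro o' ho'
    rcases o' with _ | l'
    · omega
    · have := hD l' (by grind)
      have := hlef (some l')
      omega
  obtain ⟨l'', hne'', hbl''⟩ : ∃ l'', l ≠ l'' ∧ mb (some l'') = 2 := by
    by_cases e : l = l₁
    · exact ⟨l₂, e ▸ hne, h₂⟩
    · exact ⟨l₁, e, h₁⟩
  exact ⟨.IIi, ⟨_, ho, ⟨_, hkf⟩, hle1⟩, .D_IIi_k1 hn l l'' hne'' (by simp [hk]) (by simp [hbl])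
    (by simp [hbl'']) (by simp [hkf]) (by simp [ho])
    (fun l' hl' => by exact_mod_cast hle1 (some l') (by simpa using hl'))⟩

theorem IsDegeneration.entry_D_of_double (h : IsDegeneration n mb mf) (hk : mb none = 2) {l : ι}
    (hl : mb (some l) = 2)
    (hle : ∀ o, mb o ≤ 2) : HasEntry n mb mf .D := by
  have hkf : mf none = 2 := by have := h.k_two hk.ge; have := h.le none; omega
  have hlef : ∀ o, mf o ≤ 2 := fun o => (h.le o).trans (hle o)
  by_cases hz : ∀ o', o' ≠ none → mf o' = 0
  · exact ⟨.II, ⟨_, hkf, hz⟩, .D_II_k2 l (by simp [hk]) (by simp [hl]) (by simp [hkf])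
      (by simp [hz])⟩
  by_cases hD : ∃ l, mf (some l) = 2
  · obtain ⟨l', hl'⟩ := hD
    have hbl' : mb (some l') = 2 := by have := h.le (some l'); have := hle (some l'); omega
    exact ⟨.D, ⟨none, some l', by simp, hkf, hl'⟩, .D_D_k2 l' (by simp [hk]) (by simp [hbl'])
      (by simp [hkf]) (by simp [hl'])⟩
  push Not at hD
  have hle1 : ∀ l, mf (some l) ≤ 1 := fun l => by
    have := hD l
    have := hlef (some l)
    omega
  have hle1' : ∀ l, (mf (some l) : ℕ∞) ≤ 1 := fun l => by exact_mod_cast hle1 l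
  push Not at hz
  obtain ⟨o', hne, ho'⟩ := hz
  obtain ⟨l', rfl⟩ := Option.ne_none_iff_exists'.mp hne
  have ho' : mf (some l') = 1 := by have := hle1 l'; omega
  have hp : Pattern mf .IIi := ⟨none, hkf, ⟨_, ho'⟩, fun o ho => by
    obtain ⟨l, rfl⟩ := Option.ne_none_iff_exists'.mp ho
    exact hle1 l⟩
  -- The surviving single AND `l'` may have been double in the background. If not, the double
  -- direction `l` is either single now or no longer aligned; in the latter case a single AND
  -- coexisted with two double ones, so `n > 3`.
  by_cases hb2 : mb (some l') = 2
  · exact ⟨.IIi, hp, .D_IIi_k2 l' (by simp [hk]) (by simp [hb2]) (by simp [hkf]) (by simp [ho'])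
      hle1'⟩
  have hb1 : mb (some l') = 1 := by have := h.le (some l'); have := hle (some l'); omega
  by_cases hf1 : mf (some l) = 1
  · exact ⟨.IIi, hp, .D_IIi_k2 l (by simp [hk]) (by simp [hl]) (by simp [hkf]) (by simp [hf1])
      hle1'⟩
  have hf0 : mf (some l) = 0 := by have := hle1 l; omega
  have hn : 3 < n := by
    by_contra hn
    exact h.bg.three (by omega) none (some l) (some l') (by simp) hk hl hb1
  exact ⟨.IIi, hp, .D_IIi_k2' hn l l' (by simp [hk]) (by simp [hl]) (by simp [hb1]) (by simp [hkf])
    (by simp [hf0]) (by simp [ho']) hle1'⟩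

/-- With one double direction present, the bound on sums caps every multiplicity at 2. What remains
is to distinguish the multiplicity of `k`. -/
theorem IsDegeneration.entry_D (h : IsDegeneration n mb mf) (hb : Pattern mb .D) :
    HasEntry n mb mf .D := by
  obtain ⟨o₁, o₂, hne, h₁, h₂⟩ := hb
  have hle : ∀ o, mb o ≤ 2 := fun o => by
    by_cases e : o = o₁
    · rw [e, h₁]
    · have := h.bg.add_le o o₁ e
      omega
  rcases o₁ with _ | l₁ <;> rcases o₂ with _ | l₂
  · exact absurd rfl hne
  · exact h.entry_D_of_double h₁ h₂ hle
  · exact h.entry_D_of_double h₂ h₁ hle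
  have hne' : l₁ ≠ l₂ := by simpa using hne
  obtain hk | hk | hk : mb none = 0 ∨ mb none = 1 ∨ mb none = 2 := by
    have := hle none
    omega
  · exact h.entry_D_of_not_aligned hk hne' h₁ h₂ hle
  · exact h.entry_D_of_single hk hne' h₁ h₂ hle
  · exact h.entry_D_of_double hk h₁ hle

/-- The table is complete. -/
theorem IsDegeneration.hasEntry (h : IsDegeneration n mb mf) {tb : RicciType} (hb : Pattern mb tb) :
    HasEntry n mb mf tb := by
  cases tb with
  | G => exact h.entry_G hb
  | I =>
    obtain ⟨o, ho, hz⟩ := hb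
    obtain ⟨o', hne, ho'⟩ := h.bg.other o ho
    have := hz o' hne
    omega
  | Ii => exact h.entry_Ii hb
  | II => exact h.entry_II hb
  | IIi => exact h.entry_IIi hb
  | D => exact h.entry_D hb
  | III => exact h.entry_III hb
  | IIIi => exact h.entry_IIIi hb
  | N => exact h.entry_N hb
  | O => exact hb.elim

end Table
end GKS

namespace GKS

/-! ### Smooth functions and one-parameter families of functions on a coordinate domain -/

section Calculus
variable {n : ℕ} {U : Set (Coord n)}

/-- Smoothness of `(t, x) ↦ F t x` on `[0,1] × U`. -/
def SmoothFam (U : Set (Coord n)) (F : ℝ → Coord n → ℝ) : Prop :=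
  ContDiffOn ℝ ∞ (fun q : ℝ × Coord n => F q.1 q.2) (Set.Icc (0 : ℝ) 1 ×ˢ U)

namespace SmoothFam
variable {F F' : ℝ → Coord n → ℝ}

theorem of_contDiffOn {f : Coord n → ℝ} (hf : ContDiffOn ℝ ∞ f U) : SmoothFam U fun _ => f :=
  hf.comp contDiff_snd.contDiffOn fun _ hq => hq.2

theorem const (c : ℝ) : SmoothFam U fun _ _ => c := contDiffOn_const

theorem add (h : SmoothFam U F) (h' : SmoothFam U F') : SmoothFam U fun t x => F t x + F' t x :=
  ContDiffOn.add h h'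

theorem sub (h : SmoothFam U F) (h' : SmoothFam U F') : SmoothFam U fun t x => F t x - F' t x :=
  ContDiffOn.sub h h'

theorem mul (h : SmoothFam U F) (h' : SmoothFam U F') : SmoothFam U fun t x => F t x * F' t x :=
  ContDiffOn.mul h h'

theorem sum {ι : Type*} {s : Finset ι} {F : ι → ℝ → Coord n → ℝ}
    (h : ∀ i ∈ s, SmoothFam U (F i)) : SmoothFam U fun t x => ∑ i ∈ s, F i t x :=
  ContDiffOn.sum h

theorem prod {ι : Type*} {s : Finset ι} {F : ι → ℝ → Coord n → ℝ}
    (h : ∀ i ∈ s, SmoothFam U (F i)) : SmoothFam U fun t x => ∏ i ∈ s, F i t x :=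
  contDiffOn_prod h

theorem inv (h : SmoothFam U F) (h0 : ∀ t ∈ Set.Icc (0 : ℝ) 1, ∀ x ∈ U, F t x ≠ 0) :
    SmoothFam U fun t x => (F t x)⁻¹ :=
  ContDiffOn.inv h fun q hq => h0 q.1 hq.1 q.2 hq.2

theorem slice (h : SmoothFam U F) {t : ℝ} (ht : t ∈ Set.Icc (0 : ℝ) 1) :
    ContDiffOn ℝ ∞ (F t) U :=
  ContDiffOn.comp h (f := fun x => (t, x)) (by fun_prop) fun _ hx => ⟨ht, hx⟩

theorem tendsto (h : SmoothFam U F) {x : Coord n} (hx : x ∈ U) :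
    Filter.Tendsto (fun t => F t x) (nhdsWithin 0 (Set.Icc 0 1)) (nhds (F 0 x)) := by
  have h0 : ((0 : ℝ), x) ∈ Set.Icc (0 : ℝ) 1 ×ˢ U := ⟨by simp, hx⟩
  have := (h.continuousOn _ h0).comp (f := fun t : ℝ => (t, x)) (s := Set.Icc 0 1) (x := 0)
    (by fun_prop) fun t ht => ⟨ht, hx⟩
  exact this

/-- The set `[0,1] × U` has unique derivatives, so the derivative within it is smooth up to the
endpoint `t = 0`. Its value on `(0, e_c)` is the partial derivative of the slice because `U` is
open. -/
theorem pd (hU : IsOpen U) (h : SmoothFam U F) (c : Fin n) :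
    SmoothFam U fun t x => pd c (F t) x := by
  have hS : UniqueDiffOn ℝ (Set.Icc (0 : ℝ) 1 ×ˢ U) :=
    (uniqueDiffOn_Icc zero_lt_one).prod hU.uniqueDiffOn
  have h1 := (ContDiffOn.fderivWithin h hS (m := ∞) (by simp)).clm_apply
    (contDiffOn_const (c := ((0 : ℝ), (Pi.single c 1 : Coord n))))
  refine h1.congr fun q hq => ?_
  have hd := ((ContDiffOn.differentiableOn h (by simp)) q hq).hasFDerivWithinAt
  have hc : HasFDerivWithinAt (fun x : Coord n => (q.1, x)) (ContinuousLinearMap.inr ℝ ℝ (Coord n))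
      U q.2 := (hasFDerivAt_prodMk_right q.1 q.2).hasFDerivWithinAt
  have hm : Set.MapsTo (fun x : Coord n => (q.1, x)) U (Set.Icc (0 : ℝ) 1 ×ˢ U) :=
    fun x hx => ⟨hq.1, hx⟩
  have := (HasFDerivWithinAt.comp q.2 hd hc hm).hasFDerivAt (hU.mem_nhds hq.2)
  have h2 : HasFDerivAt (F q.1) _ q.2 := this
  simp only [GKS.pd]
  rw [h2.fderiv]
  simp

theorem matrix_det {M : ℝ → Coord n → Tensor2 n} (h : ∀ a b, SmoothFam U fun t x => M t x a b) :
    SmoothFam U fun t x => (M t x).det := by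
  simp only [Matrix.det_apply']
  exact sum fun σ _ => (const _).mul (prod fun i _ => h _ _)

theorem matrix_inv {M : ℝ → Coord n → Tensor2 n} (h : ∀ a b, SmoothFam U fun t x => M t x a b)
    (h0 : ∀ t ∈ Set.Icc (0 : ℝ) 1, ∀ x ∈ U, IsUnit (M t x).det) (a b : Fin n) :
    SmoothFam U fun t x => (M t x)⁻¹ a b := by
  simp only [Matrix.inv_def, Ring.inverse_eq_inv, Matrix.smul_apply, smul_eq_mul,
    Matrix.adjugate_apply]
  -- Cramer's rule: an adjugate entry is a determinant with one row replaced by a constant basis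
  -- vector.
  refine ((matrix_det h).inv fun t ht x hx => (h0 t ht x hx).ne_zero).mul (matrix_det fun i j => ?_)
  by_cases hi : i = b
  · subst hi
    simp only [Matrix.updateRow_self]
    exact const _
  · simp only [Matrix.updateRow_ne hi]
    exact h i j

theorem christoffel (hU : IsOpen U) {g : ℝ → Coord n → Tensor2 n}
    (h : ∀ a b, SmoothFam U fun t x => g t x a b)
    (h0 : ∀ t ∈ Set.Icc (0 : ℝ) 1, ∀ x ∈ U, IsUnit (g t x).det) (a b c : Fin n) :
    SmoothFam U fun t => christoffel (g t) a b c := by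
  unfold GKS.christoffel
  exact (const _).mul (sum fun d _ => (matrix_inv h h0 a d).mul
    ((((h d c).pd hU b).add ((h d b).pd hU c)).sub ((h b c).pd hU d)))

theorem ricci (hU : IsOpen U) {g : ℝ → Coord n → Tensor2 n}
    (h : ∀ a b, SmoothFam U fun t x => g t x a b)
    (h0 : ∀ t ∈ Set.Icc (0 : ℝ) 1, ∀ x ∈ U, IsUnit (g t x).det) (b c : Fin n) :
    SmoothFam U fun t x => ricci (g t) x b c := by
  unfold GKS.ricci
  simp only [Matrix.of_apply]
  have hC := christoffel hU h h0
  exact ((((sum fun a _ => (hC a b c).pd hU a).sub (sum fun a _ => (hC a b a).pd hU c)).add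
    (sum fun a _ => sum fun d _ => (hC a a d).mul (hC d b c))).sub
    (sum fun a _ => sum fun d _ => (hC a c d).mul (hC d b a)))

end SmoothFam

/-! ### Partial derivatives -/

theorem differentiableAt_of_contDiffOn (hU : IsOpen U) {f : Coord n → ℝ} (hf : ContDiffOn ℝ ∞ f U)
    {x : Coord n} (hx : x ∈ U) : DifferentiableAt ℝ f x :=
  (hf.differentiableOn (by simp)).differentiableAt (hU.mem_nhds hx)

theorem contDiffOn_pd (hU : IsOpen U) {f : Coord n → ℝ} (hf : ContDiffOn ℝ ∞ f U) (c : Fin n) :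
    ContDiffOn ℝ ∞ (pd c f) U :=
  ((SmoothFam.of_contDiffOn hf).pd hU c).slice (t := 0) (by simp)

variable {f f' : Coord n → ℝ} {x : Coord n} {c : Fin n}

theorem pd_congr (hU : IsOpen U) (hx : x ∈ U) (h : ∀ y ∈ U, f y = f' y) : pd c f x = pd c f' x := by
  have : f =ᶠ[nhds x] f' := Filter.eventuallyEq_of_mem (hU.mem_nhds hx) h
  rw [pd, this.fderiv_eq, pd]

theorem pd_const (a : ℝ) : pd c (fun _ => a) x = 0 := by
  simp [pd]

theorem pd_add (h : DifferentiableAt ℝ f x) (h' : DifferentiableAt ℝ f' x) :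
    pd c (fun y => f y + f' y) x = pd c f x + pd c f' x := by
  rw [pd, fderiv_fun_add h h']; rfl

theorem pd_sub (h : DifferentiableAt ℝ f x) (h' : DifferentiableAt ℝ f' x) :
    pd c (fun y => f y - f' y) x = pd c f x - pd c f' x := by
  rw [pd, fderiv_fun_sub h h']; rfl

theorem pd_mul (h : DifferentiableAt ℝ f x) (h' : DifferentiableAt ℝ f' x) :
    pd c (fun y => f y * f' y) x = pd c f x * f' x + f x * pd c f' x := by
  rw [pd, fderiv_fun_mul h h']; simp [pd]; ring

theorem pd_const_mul (a : ℝ) (h : DifferentiableAt ℝ f x) :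
    pd c (fun y => a * f y) x = a * pd c f x := by
  rw [pd_mul (by fun_prop) h, pd_const]; ring

theorem pd_sum {ι : Type*} {s : Finset ι} {f : ι → Coord n → ℝ}
    (h : ∀ i ∈ s, DifferentiableAt ℝ (f i) x) :
    pd c (fun y => ∑ i ∈ s, f i y) x = ∑ i ∈ s, pd c (f i) x := by
  rw [pd, fderiv_fun_sum h]; simp [pd]

theorem pd_comm (hU : IsOpen U) (hf : ContDiffOn ℝ ∞ f U) (hx : x ∈ U) (b c : Fin n) :
    pd c (pd b f) x = pd b (pd c f) x := by
  have hat : ContDiffAt ℝ ∞ f x := hf.contDiffAt (hU.mem_nhds hx)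
  have hd : DifferentiableAt ℝ (fderiv ℝ f) x :=
    (hat.fderiv_right (m := ∞) (by simp)).differentiableAt (by simp)
  have key : ∀ b c, pd c (pd b f) x = fderiv ℝ (fderiv ℝ f) x (Pi.single c 1) (Pi.single b 1) := by
    intro b c
    have : pd b f = fun y => fderiv ℝ f y (Pi.single b 1) := rfl
    rw [this, pd, fderiv_clm_apply hd (by fun_prop)]
    simp
  rw [key, key]
  exact (hat.isSymmSndFDerivAt (by simp; exact WithTop.coe_le_coe.mpr le_top)).eq _ _

end Calculus

/-! ### Metrics on a coordinate domain -/

section Metric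
variable {n : ℕ} {U : Set (Coord n)}

/-- A smooth nondegenerate symmetric tensor field on `U`. -/
structure IsMetricOn (U : Set (Coord n)) (g : Coord n → Tensor2 n) : Prop where
  smooth : ∀ a b, ContDiffOn ℝ ∞ (fun x => g x a b) U
  symm : ∀ x ∈ U, (g x).IsSymm
  det : ∀ x ∈ U, IsUnit (g x).det

variable {g : Coord n → Tensor2 n} (hg : IsMetricOn U g)
include hg

theorem IsMetricOn.inv_smooth (a b : Fin n) : ContDiffOn ℝ ∞ (fun x => (g x)⁻¹ a b) U :=
  (SmoothFam.matrix_inv (M := fun _ => g) (fun a b => .of_contDiffOn (hg.smooth a b))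
    (fun _ _ => hg.det) a b).slice (t := 0) (by simp)

theorem IsMetricOn.christoffel_smooth (hU : IsOpen U) (a b c : Fin n) :
    ContDiffOn ℝ ∞ (christoffel g a b c) U :=
  (SmoothFam.christoffel hU (g := fun _ => g) (fun a b => .of_contDiffOn (hg.smooth a b))
    (fun _ _ => hg.det) a b c).slice (t := 0) (by simp)

theorem IsMetricOn.inv_symm {x : Coord n} (hx : x ∈ U) (a b : Fin n) :
    (g x)⁻¹ a b = (g x)⁻¹ b a := by
  have : ((g x)⁻¹)ᵀ = (g x)⁻¹ := by rw [Matrix.transpose_nonsing_inv, (hg.symm x hx).eq]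
  conv_lhs => rw [← this]
  rfl

theorem IsMetricOn.pd_symm (hU : IsOpen U) {x : Coord n} (hx : x ∈ U) (a b c : Fin n) :
    pd c (fun y => g y a b) x = pd c (fun y => g y b a) x :=
  pd_congr hU hx fun y hy => (hg.symm y hy).apply b a

theorem IsMetricOn.christoffel_symm (hU : IsOpen U) {x : Coord n} (hx : x ∈ U) (a b c : Fin n) :
    christoffel g a b c x = christoffel g a c b x := by
  unfold christoffel
  congr 1
  refine Finset.sum_congr rfl fun d _ => ?_
  rw [hg.pd_symm hU hx b c d]
  ring

/-- The other two derivative terms cancel on contraction with the symmetric inverse metric. This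
form makes the symmetry of the Ricci tensor accessible. -/
theorem IsMetricOn.christoffel_trace (hU : IsOpen U) {x : Coord n} (hx : x ∈ U) (b : Fin n) :
    ∑ a, christoffel g a b a x =
      ∑ a, ∑ d, (1 / 2) * ((g x)⁻¹ a d * pd b (fun y => g y a d) x) := by
  have h1 : ∑ a, ∑ d, (g x)⁻¹ a d * pd a (fun y => g y d b) x =
      ∑ a, ∑ d, (g x)⁻¹ a d * pd d (fun y => g y b a) x := by
    rw [Finset.sum_comm]
    refine Finset.sum_congr rfl fun a _ => Finset.sum_congr rfl fun d _ => ?_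
    rw [hg.inv_symm hx, hg.pd_symm hU hx a b]
  have h2 : ∑ a, ∑ d, (g x)⁻¹ a d * pd b (fun y => g y d a) x =
      ∑ a, ∑ d, (g x)⁻¹ a d * pd b (fun y => g y a d) x :=
    Finset.sum_congr rfl fun a _ => Finset.sum_congr rfl fun d _ => by rw [hg.pd_symm hU hx d a]
  simp only [christoffel, mul_sub, mul_add, Finset.sum_add_distrib, Finset.sum_sub_distrib,
    ← Finset.mul_sum]
  rw [h1, h2]
  ring

/-- The derivative of the inverse metric. -/
theorem IsMetricOn.pd_inv (hU : IsOpen U) {x : Coord n} (hx : x ∈ U) (c : Fin n) :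
    (Matrix.of fun a b => pd c (fun y => (g y)⁻¹ a b) x) =
      -((g x)⁻¹ * (Matrix.of fun a b => pd c (fun y => g y a b) x) * (g x)⁻¹) := by
  have hd : ∀ a b, DifferentiableAt ℝ (fun y => g y a b) x := fun a b =>
    differentiableAt_of_contDiffOn hU (hg.smooth a b) hx
  have hdi : ∀ a b, DifferentiableAt ℝ (fun y => (g y)⁻¹ a b) x := fun a b =>
    differentiableAt_of_contDiffOn hU (hg.inv_smooth a b) hx
  -- Differentiate `g⁻¹ g = 1`, which holds on all of `U`.
  have h : (Matrix.of fun a b => pd c (fun y => (g y)⁻¹ a b) x) * g x +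
      (g x)⁻¹ * (Matrix.of fun a b => pd c (fun y => g y a b) x) = 0 := by
    ext a b
    have h1 : pd c (fun y => ∑ e, (g y)⁻¹ a e * g y e b) x = 0 := by
      rw [pd_congr (f' := fun _ => (1 : Tensor2 n) a b) hU hx fun y hy => ?_, pd_const]
      rw [← Matrix.mul_apply, Matrix.nonsing_inv_mul _ (hg.det y hy)]
    rw [pd_sum fun e _ => (hdi a e).fun_mul (hd e b)] at h1
    simp only [pd_mul (hdi _ _) (hd _ _), Finset.sum_add_distrib] at h1
    simpa [Matrix.mul_apply] using h1
  have h2 := congrArg (· * (g x)⁻¹) (eq_neg_of_add_eq_zero_left h)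
  simpa [Matrix.mul_assoc, Matrix.mul_nonsing_inv _ (hg.det x hx)] using h2

/-- The one summand not symmetric at sight is `∂_c Γ^a_{ba}`. By the trace formula it equals `-½
tr(g⁻¹ ∂_c g g⁻¹ ∂_b g) + ½ g^{ad} ∂_c ∂_b g_{ad}`, symmetric by cyclicity of the trace and
commuting derivatives. -/
theorem IsMetricOn.ricci_symm (hU : IsOpen U) {x : Coord n} (hx : x ∈ U) : (ricci g x).IsSymm := by
  have hd : ∀ a b c, DifferentiableAt ℝ (pd c fun y => g y a b) x := fun a b c =>
    differentiableAt_of_contDiffOn hU (contDiffOn_pd hU (hg.smooth a b) c) hx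
  have hdi : ∀ a b, DifferentiableAt ℝ (fun y => (g y)⁻¹ a b) x := fun a b =>
    differentiableAt_of_contDiffOn hU (hg.inv_smooth a b) hx
  have hdC : ∀ a b c, DifferentiableAt ℝ (christoffel g a b c) x := fun a b c =>
    differentiableAt_of_contDiffOn hU (hg.christoffel_smooth hU a b c) hx
  let D : Fin n → Tensor2 n := fun c => Matrix.of fun a b => pd c (fun y => g y a b) x
  have hD : ∀ c, (D c)ᵀ = D c := fun c => by
    ext a b
    exact hg.pd_symm hU hx b a c
  have htr : ∀ b c, ∑ a, pd c (christoffel g a b a) x =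
      -(1 / 2) * ((g x)⁻¹ * D c * ((g x)⁻¹ * D b)).trace +
      ∑ a, ∑ d, (1 / 2) * ((g x)⁻¹ a d * pd c (pd b fun y => g y a d) x) := by
    intro b c
    rw [← pd_sum fun a _ => hdC a b a, pd_congr hU hx fun y hy => hg.christoffel_trace hU hy b,
      pd_sum fun a _ => DifferentiableAt.fun_sum fun d _ => ((hdi a d).fun_mul (hd a d b)).const_mul _]
    have : (g x)⁻¹ * D c * ((g x)⁻¹ * D b) =
        -((Matrix.of fun a b => pd c (fun y => (g y)⁻¹ a b) x) * (D b)ᵀ) := by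
      rw [hg.pd_inv hU hx, hD, neg_mul, neg_neg]
      simp only [Matrix.mul_assoc, D]
    rw [this, Matrix.trace_neg, Matrix.trace, neg_mul_neg, Finset.mul_sum, ← Finset.sum_add_distrib]
    refine Finset.sum_congr rfl fun a _ => ?_
    rw [pd_sum fun d _ => ((hdi a d).fun_mul (hd a d b)).const_mul _, Matrix.diag_apply,
      Matrix.mul_apply, Finset.mul_sum, ← Finset.sum_add_distrib]
    refine Finset.sum_congr rfl fun d _ => ?_
    rw [pd_const_mul _ ((hdi a d).fun_mul (hd a d b)), pd_mul (hdi a d) (hd a d b)]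
    simp only [Matrix.of_apply, Matrix.transpose_apply, D]
    ring
  have htr' : ∀ b c, ∑ a, pd c (christoffel g a b a) x = ∑ a, pd b (christoffel g a c a) x := by
    intro b c
    rw [htr, htr, Matrix.trace_mul_comm]
    congr 1
    exact Finset.sum_congr rfl fun a _ => Finset.sum_congr rfl fun d _ => by
      rw [pd_comm hU (hg.smooth a d) hx]
  have hs : ∀ a b c, christoffel g a b c x = christoffel g a c b x := fun a b c =>
    hg.christoffel_symm hU hx a b c
  have hq : ∀ b c, ∑ a, ∑ d, christoffel g a c d x * christoffel g d b a x =
      ∑ a, ∑ d, christoffel g a b d x * christoffel g d c a x := by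
    intro b c
    rw [Finset.sum_comm]
    exact Finset.sum_congr rfl fun a _ => Finset.sum_congr rfl fun d _ => by ring
  ext b c
  simp only [ricci, Matrix.transpose_apply, Matrix.of_apply]
  rw [htr' c b, hq c b]
  congr 1
  congr 1
  · congr 1
    exact Finset.sum_congr rfl fun a _ =>
      pd_congr hU hx fun y hy => hg.christoffel_symm hU hy a c b
  · exact Finset.sum_congr rfl fun a _ => Finset.sum_congr rfl fun d _ => by rw [hs d c b]

end Metric
end GKS

namespace GKS

/-! ### Pointwise algebra of a generalized Kerr–Schild perturbation -/

section KerrSchildAlgebra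
variable {n : ℕ} (k dH : Coord n) (B : Tensor2 n) (H : ℝ)

/-- The lowered difference of the connections of `ḡ - 2 H k ⊗ k` and `ḡ`: the combination
`½ (∇_b h_{dc} + ∇_c h_{db} - ∇_d h_{bc})` for `h = -2 H k ⊗ k`, with `dH = ∇H`, `B = ∇k`. -/
def ksLower (b : Fin n) : Tensor2 n := Matrix.of fun d c =>
  -(dH b * k d * k c + H * B b d * k c + H * k d * B b c + dH c * k d * k b + H * B c d * k b +
    H * k d * B c b - dH d * k b * k c - H * B d b * k c - H * k b * B d c)

variable {k dH B H} {kv : Coord n} {Gi : Tensor2 n} {f : ℝ}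

/-- Nullity of `k` makes the product of the two rank-one terms vanish, so the inverse is exactly
linear in `H`. -/
theorem inv_of_kerrSchild {G Gi : Tensor2 n} (hGi : Giᵀ = Gi) (h : G * Gi = 1)
    (hk : k ⬝ᵥ (Gi *ᵥ k) = 0) (H : ℝ) :
    (G - (2 * H) • Matrix.vecMulVec k k) *
      (Gi + (2 * H) • Matrix.vecMulVec (Gi *ᵥ k) (Gi *ᵥ k)) = 1 := by
  have h1 : G *ᵥ (Gi *ᵥ k) = k := by rw [Matrix.mulVec_mulVec, h, Matrix.one_mulVec]
  have h2 : k ᵥ* Gi = Gi *ᵥ k := by rw [← Matrix.mulVec_transpose, hGi]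
  have h3 : Matrix.vecMulVec k k * Matrix.vecMulVec (Gi *ᵥ k) (Gi *ᵥ k) = 0 := by
    rw [Matrix.mul_vecMulVec, Matrix.vecMulVec_mulVec, hk]
    simp
  rw [Matrix.sub_mul, Matrix.mul_add, Matrix.mul_add, h]
  simp only [Matrix.smul_mul, Matrix.mul_smul, h3]
  simp only [Matrix.mul_vecMulVec, Matrix.vecMulVec_mul, h1, h2]
  simp

/-- Contraction with `k^c` kills the terms containing `k · k` or `k^a ∇_b k_a`. The geodesic
equation turns those with `k^a ∇_a k_b` into multiples of `k_b`. -/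
theorem ksLower_mulVec (hB : B *ᵥ kv = 0) (hgeo : kv ᵥ* B = f • k) (hn : k ⬝ᵥ kv = 0)
    (b : Fin n) :
    ksLower k dH B H b *ᵥ kv = -((dH ⬝ᵥ kv + 2 * H * f) * k b) • k := by
  ext d
  have hrow : ksLower k dH B H b d = -((dH b * k d + H * B b d - dH d * k b - H * B d b) • k +
      (H * k d) • B b + (k d * k b) • dH + (H * k b) • Bᵀ d + (H * k d) • Bᵀ b -
      (H * k b) • B d) := by
    ext c
    simp only [ksLower, Matrix.of_apply, Pi.neg_apply, Pi.sub_apply, Pi.add_apply, Pi.smul_apply,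
      smul_eq_mul, Matrix.transpose_apply]
    ring
  have h1 : ∀ b, B b ⬝ᵥ kv = 0 := fun b => congrFun hB b
  have h2 : ∀ b, Bᵀ b ⬝ᵥ kv = f * k b := fun b => by
    rw [dotProduct_comm]; exact congrFun hgeo b
  rw [Matrix.mulVec, hrow]
  simp only [neg_dotProduct, sub_dotProduct, add_dotProduct, smul_dotProduct, h1, h2, hn,
    smul_eq_mul, Pi.smul_apply]
  ring

/-- Up to terms `u ⊗ k` and `k ⊗ w` with `u`, `w` orthogonal to `k`, the matrix is antisymmetric, so
it is traceless against the symmetric `Gi`. -/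
theorem trace_mul_ksLower (hGi : Giᵀ = Gi) (hkv : Gi *ᵥ k = kv) (hB : B *ᵥ kv = 0)
    (hn : k ⬝ᵥ kv = 0) (b : Fin n) : (Gi * ksLower k dH B H b).trace = 0 := by
  set A := ksLower k dH B H b + Matrix.vecMulVec (dH b • k + H • B b) k +
    H • Matrix.vecMulVec k (B b) with hA
  have hAt : Aᵀ = -A := by
    ext d c
    simp only [hA, ksLower, Matrix.transpose_apply, Matrix.add_apply, Matrix.neg_apply,
      Matrix.smul_apply, Matrix.vecMulVec_apply, Matrix.of_apply, Pi.add_apply, Pi.smul_apply,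
      smul_eq_mul]
    ring
  have hz : (Gi * A).trace = 0 := by
    have : (Gi * A).trace = -(Gi * A).trace := by
      conv_lhs => rw [← Matrix.trace_transpose, Matrix.transpose_mul, hAt, hGi, Matrix.neg_mul,
        Matrix.trace_neg, Matrix.trace_mul_comm]
    linarith
  have hBb : B b ⬝ᵥ kv = 0 := congrFun hB b
  have hBb' : (Gi *ᵥ B b) ⬝ᵥ k = 0 := by
    rw [dotProduct_comm, Matrix.dotProduct_mulVec, ← Matrix.mulVec_transpose, hGi, hkv,
      dotProduct_comm, hBb]
  have hn' : kv ⬝ᵥ k = 0 := by rw [dotProduct_comm, hn]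
  rw [hA, Matrix.mul_add, Matrix.mul_add, Matrix.mul_smul, Matrix.mul_vecMulVec,
    Matrix.mul_vecMulVec, Matrix.trace_add, Matrix.trace_add, Matrix.trace_smul,
    Matrix.trace_vecMulVec, Matrix.trace_vecMulVec, Matrix.mulVec_add, Matrix.mulVec_smul,
    Matrix.mulVec_smul, hkv, dotProduct_comm kv (B b), hBb, add_dotProduct, smul_dotProduct,
    smul_dotProduct, hn', hBb'] at hz
  simpa using hz

/-- For `x` orthogonal to `k` the contracted matrix reduces to `u ⊗ k - H k ⊗ w`. The first term
dies because `k` is annihilated by `Gi Bᵀ` from the left. For the second, the geodesic equation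
reduces the trace to a multiple of `w · k`, which vanishes since `B k = 0` and `x · k = 0`. -/
theorem trace_ksLower_mul {x : Coord n} (hGi : Giᵀ = Gi) (hkv : Gi *ᵥ k = kv) (hB : B *ᵥ kv = 0)
    (hgeo : kv ᵥ* B = f • k) (hn : k ⬝ᵥ kv = 0) (hx : x ⬝ᵥ k = 0) :
    ((Gi + (2 * H) • Matrix.vecMulVec kv kv) * (∑ c, x c • ksLower k dH B H c) *
      (Gi * Bᵀ)).trace = 0 := by
  have hS : ∑ c, x c • ksLower k dH B H c =
      Matrix.vecMulVec (-(x ⬝ᵥ dH) • k - H • (x ᵥ* B) + H • (B *ᵥ x)) k -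
        H • Matrix.vecMulVec k (x ᵥ* B + B *ᵥ x) := by
    ext d c
    have e1 : ∀ e, x e * ksLower k dH B H e d c =
        -(x e * dH e * (k d * k c)) - H * (x e * B e d) * k c - H * k d * (x e * B e c)
        - H * k d * (B c e * x e) + H * (B d e * x e) * k c
        - x e * k e * (dH c * k d + H * B c d - dH d * k c - H * B d c) := by
      intro e
      simp only [ksLower, Matrix.of_apply]
      ring
    simp only [Matrix.sum_apply, Matrix.smul_apply, smul_eq_mul, e1, Finset.sum_add_distrib,
      Finset.sum_sub_distrib, Finset.sum_neg_distrib, ← Finset.mul_sum, ← Finset.sum_mul]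
    simp only [dotProduct] at hx
    simp only [hx, Matrix.sub_apply, Matrix.smul_apply, Matrix.vecMulVec_apply, Pi.add_apply,
      Pi.sub_apply, Pi.smul_apply, smul_eq_mul, Matrix.vecMul, Matrix.mulVec,
      dotProduct]
    ring
  have hkM : k ᵥ* (Gi * Bᵀ) = 0 := by
    rw [← Matrix.vecMul_vecMul, Matrix.vecMul_transpose, ← Matrix.mulVec_transpose, hGi, hkv, hB]
  have hMk : (Gi * Bᵀ) *ᵥ kv = f • kv := by
    rw [← Matrix.mulVec_mulVec, Matrix.mulVec_transpose, hgeo, Matrix.mulVec_smul, hkv]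
  have hgk : (Gi + (2 * H) • Matrix.vecMulVec kv kv) *ᵥ k = kv := by
    rw [Matrix.add_mulVec, hkv, Matrix.smul_mulVec, Matrix.vecMulVec_mulVec, dotProduct_comm, hn]
    simp
  rw [Matrix.mul_assoc, hS, Matrix.sub_mul, Matrix.vecMulVec_mul, hkM, Matrix.smul_mul,
    Matrix.vecMulVec_mul, Matrix.mul_sub, Matrix.mul_smul, Matrix.mul_vecMulVec,
    Matrix.mul_vecMulVec, hgk]
  simp only [Matrix.trace_sub, Matrix.trace_smul, Matrix.trace_vecMulVec, dotProduct_zero]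
  rw [dotProduct_comm, ← Matrix.dotProduct_mulVec, hMk, dotProduct_smul, add_dotProduct,
    ← Matrix.dotProduct_mulVec, hB, dotProduct_comm (B *ᵥ x), Matrix.dotProduct_mulVec, hgeo,
    smul_dotProduct, dotProduct_comm k, hx]
  simp

end KerrSchildAlgebra
end GKS

namespace GKS

/-! ### Generalized Kerr–Schild fields -/

section KerrSchildFields
variable {n : ℕ} {U : Set (Coord n)}

theorem IsMetricOn.lower_christoffel {g : Coord n → Tensor2 n} (hg : IsMetricOn U g)
    {x : Coord n} (hx : x ∈ U) (d b c : Fin n) :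
    ∑ e, g x d e * christoffel g e b c x = (1 / 2) *
      (pd b (fun y => g y d c) x + pd c (fun y => g y d b) x - pd d (fun y => g y b c) x) := by
  set L : Coord n := fun d => (1 / 2) *
      (pd b (fun y => g y d c) x + pd c (fun y => g y d b) x - pd d (fun y => g y b c) x) with hL
  have h1 : (fun e => christoffel g e b c x) = (g x)⁻¹ *ᵥ L := by
    ext e
    simp only [christoffel, Matrix.mulVec, dotProduct, hL, Finset.mul_sum]
    exact Finset.sum_congr rfl fun _ _ => by ring
  have h2 : g x *ᵥ (fun e => christoffel g e b c x) = L := by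
    rw [h1, Matrix.mulVec_mulVec, Matrix.mul_nonsing_inv _ (hg.det x hx), Matrix.one_mulVec]
  exact congrFun h2 d

theorem christoffel_eq_of_lower {g : Coord n → Tensor2 n} {x : Coord n} (hdet : IsUnit (g x).det)
    {b c : Fin n} {Γ : Coord n} (h : ∀ d, (1 / 2) *
      (pd b (fun y => g y d c) x + pd c (fun y => g y d b) x - pd d (fun y => g y b c) x) =
      (g x *ᵥ Γ) d) (a : Fin n) : christoffel g a b c x = Γ a := by
  have : christoffel g a b c x = ((g x)⁻¹ *ᵥ (g x *ᵥ Γ)) a := by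
    simp only [christoffel, Finset.mul_sum]
    rw [Matrix.mulVec, dotProduct]
    exact Finset.sum_congr rfl fun d _ => by rw [← h]; ring
  rw [this, Matrix.mulVec_mulVec, Matrix.nonsing_inv_mul _ hdet, Matrix.one_mulVec]

/-- The metric `ḡ - 2 H k ⊗ k`. -/
def ksMetric (gb : Coord n → Tensor2 n) (k : Coord n → Coord n) (H : Coord n → ℝ)
    (x : Coord n) : Tensor2 n :=
  Matrix.of fun a b => gb x a b - 2 * H x * k x a * k x b

theorem ksMetric_eq (gb : Coord n → Tensor2 n) (k : Coord n → Coord n) (H : Coord n → ℝ)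
    (x : Coord n) : ksMetric gb k H x = gb x - (2 * H x) • Matrix.vecMulVec (k x) (k x) := by
  ext a b
  simp [ksMetric, Matrix.vecMulVec_apply]
  ring

/-- A smooth metric with a smooth null geodesic 1-form and a smooth function. -/
structure IsKerrSchild (U : Set (Coord n)) (gb : Coord n → Tensor2 n) (k : Coord n → Coord n)
    (H : Coord n → ℝ) : Prop where
  isOpen : IsOpen U
  metric : IsMetricOn U gb
  k_smooth : ∀ a, ContDiffOn ℝ ∞ (fun x => k x a) U
  H_smooth : ContDiffOn ℝ ∞ H U
  null : ∀ x ∈ U, k x ⬝ᵥ ((gb x)⁻¹ *ᵥ k x) = 0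
  geodesic : ∀ x ∈ U, ∃ f : ℝ,
    ((gb x)⁻¹ *ᵥ k x) ᵥ* (Matrix.of fun b a => covDeriv gb k b a x) = f • k x

namespace IsKerrSchild
variable {gb : Coord n → Tensor2 n} {k : Coord n → Coord n} {H : Coord n → ℝ}
  (h : IsKerrSchild U gb k H) {x : Coord n} (hx : x ∈ U)
include h

theorem diff_kv (hx : x ∈ U) (a : Fin n) :
    DifferentiableAt ℝ (fun y => ((gb y)⁻¹ *ᵥ k y) a) x := by
  simp only [Matrix.mulVec, dotProduct]
  exact DifferentiableAt.fun_sum fun b _ =>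
    (differentiableAt_of_contDiffOn h.isOpen (h.metric.inv_smooth a b) hx).fun_mul
      (differentiableAt_of_contDiffOn h.isOpen (h.k_smooth b) hx)

theorem diff_k (hx : x ∈ U) (a : Fin n) : DifferentiableAt ℝ (fun y => k y a) x :=
  differentiableAt_of_contDiffOn h.isOpen (h.k_smooth a) hx

theorem diff_gb (hx : x ∈ U) (a b : Fin n) : DifferentiableAt ℝ (fun y => gb y a b) x :=
  differentiableAt_of_contDiffOn h.isOpen (h.metric.smooth a b) hx

include hx

theorem inv_transpose : ((gb x)⁻¹)ᵀ = (gb x)⁻¹ := by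
  rw [Matrix.transpose_nonsing_inv, (h.metric.symm x hx).eq]

theorem lower_kv : gb x *ᵥ ((gb x)⁻¹ *ᵥ k x) = k x := by
  rw [Matrix.mulVec_mulVec, Matrix.mul_nonsing_inv _ (h.metric.det x hx), Matrix.one_mulVec]

theorem ksMetric_mul : ksMetric gb k H x * ((gb x)⁻¹ + (2 * H x) •
    Matrix.vecMulVec ((gb x)⁻¹ *ᵥ k x) ((gb x)⁻¹ *ᵥ k x)) = 1 := by
  rw [ksMetric_eq]
  exact inv_of_kerrSchild (h.inv_transpose hx) (Matrix.mul_nonsing_inv _ (h.metric.det x hx))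
    (h.null x hx) _

theorem ksMetric_inv : (ksMetric gb k H x)⁻¹ = (gb x)⁻¹ + (2 * H x) •
    Matrix.vecMulVec ((gb x)⁻¹ *ᵥ k x) ((gb x)⁻¹ *ᵥ k x) :=
  Matrix.inv_eq_right_inv (h.ksMetric_mul hx)

/-- `∇_a k^d = ḡ^{de} ∇_a k_e`. -/
theorem covDeriv_kv (a d : Fin n) :
    pd a (fun y => ((gb y)⁻¹ *ᵥ k y) d) x + ∑ b, christoffel gb d b a x * ((gb x)⁻¹ *ᵥ k x) b =
      ((gb x)⁻¹ * (Matrix.of fun b a => covDeriv gb k b a x)ᵀ) d a := by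
  set kv := fun y => (gb y)⁻¹ *ᵥ k y with hkv
  set D : Coord n := fun d => pd a (fun y => kv y d) x + ∑ b, christoffel gb d b a x * kv x b
    with hD
  -- Metric compatibility, checked with the index lowered: apply the product rule to `k_e = ḡ_{ed}
  -- k^d` and cancel `∂ḡ` against the lowered Christoffel symbols.
  have key : ∀ e, covDeriv gb k a e x = (gb x *ᵥ D) e := by
    intro e
    have e1 : pd a (fun y => k y e) x =
        ∑ d, (pd a (fun y => gb y e d) x * kv x d + gb x e d * pd a (fun y => kv y d) x) := by
      rw [pd_congr (f' := fun y => ∑ d, gb y e d * kv y d) h.isOpen hx fun y hy =>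
        (congrFun (h.lower_kv hy) e).symm, pd_sum fun d _ => (h.diff_gb hx e d).fun_mul (h.diff_kv hx d)]
      exact Finset.sum_congr rfl fun d _ => pd_mul (h.diff_gb hx e d) (h.diff_kv hx d)
    have e2 : ∑ c, christoffel gb c e a x * k x c =
        ∑ d, (∑ c, gb x d c * christoffel gb c e a x) * kv x d := by
      have : ∀ c, k x c = ∑ d, gb x d c * kv x d := fun c => by
        refine (congrFun (h.lower_kv hx) c).symm.trans ?_
        change ∑ d, gb x c d * kv x d = _
        exact Finset.sum_congr rfl fun d _ => by rw [(h.metric.symm x hx).apply d c]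
      simp only [this, Finset.mul_sum, Finset.sum_mul]
      rw [Finset.sum_comm]
      exact Finset.sum_congr rfl fun d _ => Finset.sum_congr rfl fun c _ => by ring
    have e3 : ∀ d, ∑ c, gb x e c * (christoffel gb c d a x * kv x d) =
        (∑ c, gb x e c * christoffel gb c d a x) * kv x d := fun d => by
      rw [Finset.sum_mul]
      exact Finset.sum_congr rfl fun c _ => by ring
    rw [covDeriv, e1, e2]
    simp only [Matrix.mulVec, dotProduct, hD, mul_add, Finset.sum_add_distrib]
    simp only [Finset.mul_sum]
    rw [Finset.sum_comm (f := fun c d => gb x e c * (christoffel gb c d a x * kv x d))]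
    simp only [e3, h.metric.lower_christoffel hx]
    rw [add_sub_right_comm, ← Finset.sum_sub_distrib]
    rw [add_comm]
    congr 1
    refine Finset.sum_congr rfl fun d _ => ?_
    rw [h.metric.pd_symm h.isOpen hx d e, h.metric.pd_symm h.isOpen hx d a]
    ring
  have : (fun e => covDeriv gb k a e x) = gb x *ᵥ D := funext key
  have h2 : (gb x)⁻¹ *ᵥ (fun e => covDeriv gb k a e x) = D := by
    rw [this, Matrix.mulVec_mulVec, Matrix.nonsing_inv_mul _ (h.metric.det x hx), Matrix.one_mulVec]
  exact (congrFun h2 d).symm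

/-- `k^a ∇_b k_a = 0`. -/
theorem covDeriv_mulVec :
    (Matrix.of fun b a => covDeriv gb k b a x) *ᵥ ((gb x)⁻¹ *ᵥ k x) = 0 := by
  ext a
  set kv := fun y => (gb y)⁻¹ *ᵥ k y with hkv
  set B : Tensor2 n := Matrix.of fun b a => covDeriv gb k b a x with hB
  -- Differentiate `k_e k^e = 0`. The Christoffel terms of the two factors cancel and both factors
  -- contribute the same quantity, which therefore vanishes.
  have h1 : pd a (fun y => ∑ e, k y e * kv y e) x = 0 := by
    rw [pd_congr (f := fun y => ∑ e, k y e * kv y e) (f' := fun _ => 0) h.isOpen hx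
      fun y hy => h.null y hy, pd_const]
  have hdkv : ∀ e, DifferentiableAt ℝ (fun y => kv y e) x := h.diff_kv hx
  rw [pd_sum fun e _ => (h.diff_k hx e).fun_mul (hdkv e)] at h1
  simp only [pd_mul (h.diff_k hx _) (hdkv _), Finset.sum_add_distrib] at h1
  have h2 : ∀ e, pd a (fun y => k y e) x = B a e + ∑ c, christoffel gb c e a x * k x c := by
    intro e
    simp [hB, covDeriv]
  have h3 : ∀ e, pd a (fun y => kv y e) x = ((gb x)⁻¹ * Bᵀ) e a -
      ∑ b, christoffel gb e b a x * kv x b := by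
    intro e
    rw [← h.covDeriv_kv hx a e]
    ring
  have h4 : ∑ e, k x e * ((gb x)⁻¹ * Bᵀ) e a = (B *ᵥ kv x) a := by
    change (k x ᵥ* ((gb x)⁻¹ * Bᵀ)) a = _
    rw [← Matrix.vecMul_vecMul, Matrix.vecMul_transpose, ← Matrix.mulVec_transpose,
      h.inv_transpose hx]
  have h5 : ∑ e, (∑ c, christoffel gb c e a x * k x c) * kv x e =
      ∑ e, k x e * ∑ b, christoffel gb e b a x * kv x b := by
    simp only [Finset.mul_sum, Finset.sum_mul]
    rw [Finset.sum_comm]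
    exact Finset.sum_congr rfl fun d _ => Finset.sum_congr rfl fun c _ => by ring
  simp only [h2, h3, add_mul, mul_sub, Finset.sum_add_distrib, Finset.sum_sub_distrib, h4, h5] at h1
  have h6 : ∑ e, B a e * kv x e = (B *ᵥ kv x) a := rfl
  rw [h6] at h1
  change (B *ᵥ kv x) a = 0
  linarith

/-- The difference of the connections of `ḡ - 2 H k ⊗ k` and `ḡ`. -/
theorem christoffel_sub (a b c : Fin n) :
    christoffel (ksMetric gb k H) a b c x = christoffel gb a b c x +
      (((gb x)⁻¹ + (2 * H x) • Matrix.vecMulVec ((gb x)⁻¹ *ᵥ k x) ((gb x)⁻¹ *ᵥ k x)) *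
        ksLower (k x) (fun a => pd a H x) (Matrix.of fun b a => covDeriv gb k b a x) (H x) b) a c := by
  rw [← h.ksMetric_inv hx]
  set B : Tensor2 n := Matrix.of fun b a => covDeriv gb k b a x with hB
  set S := ksLower (k x) (fun a => pd a H x) B (H x) b with hS
  have hmul := h.ksMetric_mul hx
  have hdet : IsUnit (ksMetric gb k H x).det := Matrix.isUnit_det_of_right_inverse hmul
  have hSc : ((ksMetric gb k H x)⁻¹ * S) a c = ((ksMetric gb k H x)⁻¹ *ᵥ (fun d => S d c)) a := rfl
  rw [hSc]
  -- It suffices to compare lowered symbols. There `∂k` is replaced by `∇k` plus a Christoffel term,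
  -- and the latter cancel with what the `k ⊗ k` part of the metric contributes.
  refine christoffel_eq_of_lower (Γ := (fun a => christoffel gb a b c x) +
    (ksMetric gb k H x)⁻¹ *ᵥ (fun d => S d c)) hdet (fun d => ?_) a
  rw [Matrix.mulVec_add, Matrix.mulVec_mulVec, Matrix.mul_nonsing_inv _ hdet, Matrix.one_mulVec,
    ksMetric_eq, Matrix.sub_mulVec, Matrix.smul_mulVec, Matrix.vecMulVec_mulVec]
  have hL : (gb x *ᵥ fun a => christoffel gb a b c x) d = _ :=
    h.metric.lower_christoffel hx d b c
  have hdH : DifferentiableAt ℝ H x := differentiableAt_of_contDiffOn h.isOpen h.H_smooth hx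
  have hpd : ∀ e a b, pd e (fun y => ksMetric gb k H y a b) x = pd e (fun y => gb y a b) x -
      2 * (pd e H x * k x a * k x b + H x * pd e (fun y => k y a) x * k x b +
        H x * k x a * pd e (fun y => k y b) x) := by
    intro e a b
    simp only [ksMetric, Matrix.of_apply]
    rw [pd_sub (h.diff_gb hx a b) (((hdH.const_mul 2).fun_mul (h.diff_k hx a)).fun_mul (h.diff_k hx b)),
      pd_mul ((hdH.const_mul 2).fun_mul (h.diff_k hx a)) (h.diff_k hx b),
      pd_mul (hdH.const_mul 2) (h.diff_k hx a), pd_const_mul 2 hdH]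
    ring
  have hpk : ∀ e a, pd e (fun y => k y a) x = B e a +
      (k x ⬝ᵥ fun c => christoffel gb c a e x) := by
    intro e a
    simp only [hB, covDeriv, Matrix.of_apply, dotProduct, mul_comm (k x _)]
    ring
  have hsym : ∀ a e, (k x ⬝ᵥ fun c => christoffel gb c a e x) =
      k x ⬝ᵥ fun c => christoffel gb c e a x := by
    intro a e
    congr 1
    ext c
    exact h.metric.christoffel_symm h.isOpen hx c a e
  simp only [Pi.add_apply, Pi.sub_apply, hL, Pi.smul_apply, smul_eq_mul, hpd, hpk, hS, ksLower,
    Matrix.of_apply]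
  simp only [hsym c b, hsym d b, hsym d c, op_smul_eq_mul]
  ring

end IsKerrSchild
end KerrSchildFields
end GKS

namespace GKS

/-! ### The Ricci tensor of a generalized Kerr–Schild metric along `k` -/

section KerrSchildRicci
variable {n : ℕ} {U : Set (Coord n)}

namespace IsKerrSchild
variable {gb : Coord n → Tensor2 n} {k : Coord n → Coord n} {H : Coord n → ℝ}
  (h : IsKerrSchild U gb k H) {x : Coord n} (hx : x ∈ U)

/-- The difference of the Christoffel symbols of `ḡ - 2 H k ⊗ k` and `ḡ`. -/
noncomputable def diff (gb : Coord n → Tensor2 n) (k : Coord n → Coord n) (H : Coord n → ℝ)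
    (a b c : Fin n) (x : Coord n) : ℝ :=
  christoffel (ksMetric gb k H) a b c x - christoffel gb a b c x

include h

theorem metric_ksMetric : IsMetricOn U (ksMetric gb k H) where
  smooth a b := ((h.metric.smooth a b).sub
    (((contDiffOn_const.mul h.H_smooth).mul (h.k_smooth a)).mul (h.k_smooth b)))
  symm x hx := by
    ext a b
    simp only [ksMetric, Matrix.transpose_apply, Matrix.of_apply, (h.metric.symm x hx).apply a b]
    ring
  det x hx := Matrix.isUnit_det_of_right_inverse (h.ksMetric_mul hx)

include hx

theorem diff_symm (a b c : Fin n) : diff gb k H a b c x = diff gb k H a c b x := by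
  rw [diff, diff, h.metric.christoffel_symm h.isOpen hx,
    h.metric_ksMetric.christoffel_symm h.isOpen hx]

theorem differentiableAt_diff (a b c : Fin n) : DifferentiableAt ℝ (diff gb k H a b c) x :=
  (differentiableAt_of_contDiffOn h.isOpen
    (h.metric_ksMetric.christoffel_smooth h.isOpen a b c) hx).sub
  (differentiableAt_of_contDiffOn h.isOpen (h.metric.christoffel_smooth h.isOpen a b c) hx)

theorem diff_eq (a b c : Fin n) : diff gb k H a b c x =
    (((gb x)⁻¹ + (2 * H x) • Matrix.vecMulVec ((gb x)⁻¹ *ᵥ k x) ((gb x)⁻¹ *ᵥ k x)) *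
      ksLower (k x) (fun a => pd a H x) (Matrix.of fun b a => covDeriv gb k b a x) (H x) b) a c := by
  rw [diff, h.christoffel_sub hx]
  ring

theorem ksInv_mulVec : ((gb x)⁻¹ + (2 * H x) • Matrix.vecMulVec ((gb x)⁻¹ *ᵥ k x)
    ((gb x)⁻¹ *ᵥ k x)) *ᵥ k x = (gb x)⁻¹ *ᵥ k x := by
  rw [Matrix.add_mulVec, Matrix.smul_mulVec, Matrix.vecMulVec_mulVec, dotProduct_comm,
    h.null x hx]
  simp

/-- The lowered contraction is proportional to `k_b k_d`, and raising an index of `k` gives the same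
vector with either metric. The factor `α` is obtained pointwise only. -/
theorem exists_diff_mulVec : ∃ α : ℝ, ∀ a b, ∑ c, diff gb k H a b c x * ((gb x)⁻¹ *ᵥ k x) c =
    -α * k x b * ((gb x)⁻¹ *ᵥ k x) a := by
  obtain ⟨f, hf⟩ := h.geodesic x hx
  refine ⟨(fun a => pd a H x) ⬝ᵥ ((gb x)⁻¹ *ᵥ k x) + 2 * H x * f, fun a b => ?_⟩
  simp only [h.diff_eq hx]
  have := ksLower_mulVec (dH := fun a => pd a H x) (H := H x) (h.covDeriv_mulVec hx) hf
    (h.null x hx) b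
  change ((_ * ksLower (k x) (fun a => pd a H x) (Matrix.of fun b a => covDeriv gb k b a x) (H x) b) *ᵥ
    ((gb x)⁻¹ *ᵥ k x)) a = _
  rw [← Matrix.mulVec_mulVec, this, Matrix.mulVec_smul, h.ksInv_mulVec hx, Pi.smul_apply,
    smul_eq_mul]
  ring

/-- The `ḡ`-trace vanishes by near-antisymmetry. The extra rank-one part of the inverse metric sees
only a multiple of `k · k`. -/
theorem sum_diff (b : Fin n) : ∑ a, diff gb k H a b a x = 0 := by
  obtain ⟨f, hf⟩ := h.geodesic x hx
  simp only [h.diff_eq hx]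
  change Matrix.trace _ = 0
  rw [Matrix.add_mul, Matrix.trace_add, trace_mul_ksLower (h.inv_transpose hx) rfl
    (h.covDeriv_mulVec hx) (h.null x hx), Matrix.smul_mul, Matrix.trace_smul, Matrix.vecMulVec_mul,
    Matrix.trace_vecMulVec, dotProduct_comm, ← Matrix.dotProduct_mulVec,
    ksLower_mulVec (h.covDeriv_mulVec hx) hf (h.null x hx), dotProduct_smul,
    dotProduct_comm _ (k x), h.null x hx]
  simp

theorem sum_diff_covDeriv {v : Coord n} (hv : v ⬝ᵥ k x = 0) :
    ∑ c, v c * ∑ a, ∑ d, diff gb k H a c d x *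
      (pd a (fun y => ((gb y)⁻¹ *ᵥ k y) d) x +
        ∑ b, christoffel gb d b a x * ((gb x)⁻¹ *ᵥ k x) b) = 0 := by
  obtain ⟨f, hf⟩ := h.geodesic x hx
  have := trace_ksLower_mul (dH := fun a => pd a H x) (H := H x) (h.inv_transpose hx) rfl
    (h.covDeriv_mulVec hx) hf (h.null x hx) hv
  rw [Matrix.mul_sum, Matrix.sum_mul, Matrix.trace_sum] at this
  rw [← this]
  refine Finset.sum_congr rfl fun c _ => ?_
  rw [Matrix.mul_smul, Matrix.smul_mul, Matrix.trace_smul, smul_eq_mul]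
  congr 1
  rw [Matrix.trace]
  refine Finset.sum_congr rfl fun a _ => ?_
  rw [Matrix.diag_apply, Matrix.mul_apply]
  exact Finset.sum_congr rfl fun d _ => by rw [h.covDeriv_kv hx, h.diff_eq hx]

/-- The Ricci tensors of `ḡ - 2 H k ⊗ k` and `ḡ` in terms of the difference of connections. -/
theorem ricci_sub (b c : Fin n) : ricci (ksMetric gb k H) x b c = ricci gb x b c +
    (∑ a, pd a (diff gb k H a b c) x + ∑ d, (∑ a, christoffel gb a a d x) * diff gb k H d b c x -
      ∑ a, ∑ d, christoffel gb a c d x * diff gb k H d b a x -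
      ∑ a, ∑ d, diff gb k H a c d x * christoffel gb d b a x -
      ∑ a, ∑ d, diff gb k H a c d x * diff gb k H d b a x) := by
  have hC : ∀ a b c, christoffel (ksMetric gb k H) a b c x =
      christoffel gb a b c x + diff gb k H a b c x := fun a b c => by rw [diff]; ring
  have hd : ∀ a b c, DifferentiableAt ℝ (christoffel gb a b c) x := fun a b c =>
    differentiableAt_of_contDiffOn h.isOpen (h.metric.christoffel_smooth h.isOpen a b c) hx
  have hpd : ∀ e a b c, pd e (christoffel (ksMetric gb k H) a b c) x =
      pd e (christoffel gb a b c) x + pd e (diff gb k H a b c) x := by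
    intro e a b c
    rw [← pd_add (hd a b c) (h.differentiableAt_diff hx a b c)]
    congr 1
    ext y
    rw [diff]; ring
  -- The trace of the connection difference vanishes throughout `U`, so its derivative does too; the
  -- same identity removes it from the quadratic terms.
  have hz : ∑ a, pd c (diff gb k H a b a) x = 0 := by
    rw [← pd_sum fun a _ => h.differentiableAt_diff hx a b a,
      pd_congr (f' := fun _ => 0) h.isOpen hx fun y hy => h.sum_diff hy b, pd_const]
  have e1 : ∑ a, ∑ d, (christoffel gb a a d x + diff gb k H a a d x) *
      (christoffel gb d b c x + diff gb k H d b c x) =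
      ∑ a, ∑ d, christoffel gb a a d x * christoffel gb d b c x +
        ∑ d, (∑ a, christoffel gb a a d x) * diff gb k H d b c x := by
    rw [Finset.sum_comm, Finset.sum_comm (f := fun a d => christoffel gb a a d x * _),
      ← Finset.sum_add_distrib]
    refine Finset.sum_congr rfl fun d _ => ?_
    rw [← Finset.sum_mul, ← Finset.sum_mul, Finset.sum_add_distrib]
    simp only [h.diff_symm hx _ _ d, h.sum_diff hx d]
    ring
  have e2 : ∑ a, ∑ d, (christoffel gb a c d x + diff gb k H a c d x) *
      (christoffel gb d b a x + diff gb k H d b a x) =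
      ∑ a, ∑ d, christoffel gb a c d x * christoffel gb d b a x +
        ∑ a, ∑ d, christoffel gb a c d x * diff gb k H d b a x +
        ∑ a, ∑ d, diff gb k H a c d x * christoffel gb d b a x +
        ∑ a, ∑ d, diff gb k H a c d x * diff gb k H d b a x := by
    simp only [add_mul, mul_add, Finset.sum_add_distrib]
    ring
  simp only [ricci, Matrix.of_apply, hC, hpd]
  rw [e1, e2, Finset.sum_add_distrib, Finset.sum_add_distrib, hz]
  ring

omit h hx in
theorem sum_mul_sum_sum (w : Coord n) (X : Fin n → Fin n → ℝ) (Y : Fin n → Fin n → Fin n → ℝ) :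
    ∑ b, w b * ∑ a, ∑ d, X a d * Y d b a = ∑ a, ∑ d, X a d * ∑ b, w b * Y d b a := by
  simp only [Finset.mul_sum]
  rw [Finset.sum_comm]
  refine Finset.sum_congr rfl fun a _ => ?_
  rw [Finset.sum_comm]
  exact Finset.sum_congr rfl fun d _ => Finset.sum_congr rfl fun b _ => by ring

/-- The Ricci tensors of `ḡ - 2 H k ⊗ k` and `ḡ` agree when contracted with `k` and a vector
orthogonal to `k`. -/
theorem contract_ricci (hk : k x ≠ 0) {v : Coord n} (hv : v ⬝ᵥ k x = 0) :
    contract (ricci (ksMetric gb k H) x) ((gb x)⁻¹ *ᵥ k x) v =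
      contract (ricci gb x) ((gb x)⁻¹ *ᵥ k x) v := by
  obtain ⟨c₀, hc₀⟩ := Function.ne_iff.mp hk
  set kv : Coord n → Coord n := fun y => (gb y)⁻¹ *ᵥ k y with hkv
  change contract _ (kv x) v = contract _ (kv x) v
  have hdk := fun a => h.diff_k hx a
  have hdkv : ∀ a, DifferentiableAt ℝ (fun y => kv y a) x := fun a => h.diff_kv hx a
  have hdC := fun a b c => h.differentiableAt_diff hx a b c
  have hA : ∀ y ∈ U, ∃ α : ℝ, ∀ a c, ∑ b, kv y b * diff gb k H a b c y = -α * k y c * kv y a := by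
    intro y hy
    obtain ⟨α, hα⟩ := h.exists_diff_mulVec hy
    refine ⟨α, fun a c => ?_⟩
    rw [← hα]
    exact Finset.sum_congr rfl fun b _ => by rw [h.diff_symm hy a b c, mul_comm]
  obtain ⟨α, hα⟩ := hA x hx
  have hkk : ∑ a, k x a * kv x a = 0 := h.null x hx
  have hv' : ∑ c, v c * k x c = 0 := hv
  -- Moving `k^b` inside the derivative of the connection difference replaces it by the derivative
  -- of `-α k_c k^a`, up to a term with `∂k`.
  set P : Fin n → Fin n → ℝ := fun a c => pd a (fun y => ∑ b, kv y b * diff gb k H a b c y) x with hP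
  have hdA : ∀ a c, DifferentiableAt ℝ (fun y => ∑ b, kv y b * diff gb k H a b c y) x :=
    fun a c => DifferentiableAt.fun_sum fun b _ => (hdkv b).fun_mul (hdC a b c)
  have hP1 : ∀ a c, P a c = ∑ b, pd a (fun y => kv y b) x * diff gb k H a b c x +
      ∑ b, kv x b * pd a (diff gb k H a b c) x := by
    intro a c
    rw [hP, ← Finset.sum_add_distrib]
    simp only
    rw [pd_sum fun b _ => (hdkv b).fun_mul (hdC a b c)]
    exact Finset.sum_congr rfl fun b _ => pd_mul (hdkv b) (hdC a b c)
  have hP2 : ∀ a, ∑ c, v c * P a c = -α * kv x a * ∑ c, v c * pd a (fun y => k y c) x := by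
    intro a
    -- Differentiability of `α` is not available. Differentiating the `α`-free identity `A^a_c
    -- k_{c₀} = A^a_{c₀} k_c`, with `A^a_c = k^b C^a_{bc}`, avoids it; contraction with `v` removes
    -- `k_c`, and `k_{c₀} ≠ 0` can be cancelled.
    have e : ∀ c, P a c * k x c₀ + (-α * k x c * kv x a) * pd a (fun y => k y c₀) x =
        P a c₀ * k x c + (-α * k x c₀ * kv x a) * pd a (fun y => k y c) x := by
      intro c
      rw [← hα a c, ← hα a c₀, hP, ← pd_mul (hdA a c) (hdk c₀), ← pd_mul (hdA a c₀) (hdk c)]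
      refine pd_congr h.isOpen hx fun y hy => ?_
      obtain ⟨β, hβ⟩ := hA y hy
      rw [hβ, hβ]
      ring
    have e' : (∑ c, v c * P a c) * k x c₀ =
        (-α * kv x a * ∑ c, v c * pd a (fun y => k y c) x) * k x c₀ := by
      calc (∑ c, v c * P a c) * k x c₀ = ∑ c, ((P a c₀ + α * kv x a * pd a (fun y => k y c₀) x) *
            (v c * k x c) + (-α * kv x a * k x c₀) * (v c * pd a (fun y => k y c) x)) := by
            rw [Finset.sum_mul]
            exact Finset.sum_congr rfl fun c _ => by linear_combination v c * e c
        _ = _ := by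
            rw [Finset.sum_add_distrib, ← Finset.mul_sum, ← Finset.mul_sum, hv']
            ring
    exact mul_right_cancel₀ hc₀ e'
  -- By the geodesic equation `k^a ∂_a k_c` equals a multiple of `k_c`, invisible to `v`, plus a
  -- Christoffel term.
  have hP3 : ∑ c, v c * ∑ a, P a c =
      -α * ∑ c, v c * ∑ a, ∑ d, christoffel gb a c d x * (k x a * kv x d) := by
    obtain ⟨f, hf⟩ := h.geodesic x hx
    have hgeo : ∀ c, ∑ a, kv x a * covDeriv gb k a c x = f * k x c := fun c => congrFun hf c
    have e : ∀ c, ∑ a, kv x a * pd a (fun y => k y c) x =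
        f * k x c + ∑ a, ∑ d, christoffel gb a c d x * (k x a * kv x d) := by
      intro c
      rw [← hgeo, Finset.sum_comm, ← Finset.sum_add_distrib]
      refine Finset.sum_congr rfl fun a _ => ?_
      rw [covDeriv, mul_sub, Finset.mul_sum, sub_add_eq_add_sub, eq_sub_iff_add_eq]
      congr 1
      exact Finset.sum_congr rfl fun d _ => by ring
    calc ∑ c, v c * ∑ a, P a c = ∑ a, ∑ c, v c * P a c := by
          simp only [Finset.mul_sum]; exact Finset.sum_comm
      _ = -α * ∑ c, v c * ∑ a, kv x a * pd a (fun y => k y c) x := by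
          simp only [hP2, Finset.mul_sum]
          rw [Finset.sum_comm]
          exact Finset.sum_congr rfl fun c _ => Finset.sum_congr rfl fun a _ => by ring
      _ = _ := by
          have : ∑ c, v c * (f * k x c) = 0 := by
            rw [← mul_zero f, ← hv', Finset.mul_sum]
            exact Finset.sum_congr rfl fun c _ => by ring
          simp only [e, mul_add, Finset.sum_add_distrib, this]
          ring
  -- Contracting the Ricci difference with `k^b`, the quadratic term vanishes as `α² k_c k_a k^a`.
  -- The remaining terms are the derivative `P`, the pairing of `C` with `∇k`, a multiple of `k_c`,
  -- and a Christoffel term that will cancel the one from `P`.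
  have hE : ∀ c, ∑ b, kv x b * (∑ a, pd a (diff gb k H a b c) x +
      ∑ d, (∑ a, christoffel gb a a d x) * diff gb k H d b c x -
      ∑ a, ∑ d, christoffel gb a c d x * diff gb k H d b a x -
      ∑ a, ∑ d, diff gb k H a c d x * christoffel gb d b a x -
      ∑ a, ∑ d, diff gb k H a c d x * diff gb k H d b a x) =
      ∑ a, P a c - ∑ a, ∑ d, diff gb k H a c d x * (pd a (fun y => kv y d) x +
        ∑ b, christoffel gb d b a x * kv x b) -
      α * (∑ d, (∑ a, christoffel gb a a d x) * kv x d) * k x c +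
      α * ∑ a, ∑ d, christoffel gb a c d x * (k x a * kv x d) := by
    intro c
    have s1 : ∑ b, kv x b * ∑ a, pd a (diff gb k H a b c) x =
        ∑ a, P a c - ∑ a, ∑ d, diff gb k H a c d x * pd a (fun y => kv y d) x := by
      rw [← Finset.sum_sub_distrib]
      simp only [Finset.mul_sum]
      rw [Finset.sum_comm]
      refine Finset.sum_congr rfl fun a _ => ?_
      rw [hP1, eq_sub_iff_add_eq, add_comm]
      congr 1
      exact Finset.sum_congr rfl fun d _ => by rw [h.diff_symm hx a c d, mul_comm]
    have s2 : ∑ b, kv x b * ∑ d, (∑ a, christoffel gb a a d x) * diff gb k H d b c x =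
        -α * (∑ d, (∑ a, christoffel gb a a d x) * kv x d) * k x c := by
      calc _ = ∑ d, (∑ a, christoffel gb a a d x) * ∑ b, kv x b * diff gb k H d b c x := by
            simp only [Finset.mul_sum]
            rw [Finset.sum_comm]
            exact Finset.sum_congr rfl fun d _ => Finset.sum_congr rfl fun b _ => by ring
        _ = _ := by
            simp only [hα]
            rw [Finset.mul_sum, Finset.sum_mul]
            exact Finset.sum_congr rfl fun d _ => by ring
    have s3 : ∑ b, kv x b * ∑ a, ∑ d, christoffel gb a c d x * diff gb k H d b a x =
        -α * ∑ a, ∑ d, christoffel gb a c d x * (k x a * kv x d) := by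
      rw [sum_mul_sum_sum (kv x) _ fun d b a => diff gb k H d b a x]
      simp only [hα, Finset.mul_sum]
      exact Finset.sum_congr rfl fun d _ => Finset.sum_congr rfl fun b _ => by ring
    have s4 : ∑ b, kv x b * ∑ a, ∑ d, diff gb k H a c d x * christoffel gb d b a x =
        ∑ a, ∑ d, diff gb k H a c d x * ∑ b, christoffel gb d b a x * kv x b := by
      rw [sum_mul_sum_sum (kv x) _ fun d b a => christoffel gb d b a x]
      simp only [mul_comm (kv x _)]
    have s5 : ∑ b, kv x b * ∑ a, ∑ d, diff gb k H a c d x * diff gb k H d b a x = 0 := by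
      rw [sum_mul_sum_sum (kv x) _ fun d b a => diff gb k H d b a x]
      simp only [hα]
      calc _ = ∑ a, -α * k x a * ∑ d, kv x d * diff gb k H a d c x := by
            refine Finset.sum_congr rfl fun a _ => ?_
            rw [Finset.mul_sum]
            exact Finset.sum_congr rfl fun d _ => by rw [h.diff_symm hx a c d]; ring
        _ = α ^ 2 * k x c * ∑ a, k x a * kv x a := by
            rw [Finset.mul_sum]
            exact Finset.sum_congr rfl fun a _ => by rw [hα]; ring
        _ = 0 := by rw [hkk, mul_zero]
    simp only [mul_sub, mul_add, Finset.sum_add_distrib, Finset.sum_sub_distrib, s1, s2, s3, s4, s5]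
    ring
  have hcon : ∀ T : Tensor2 n, contract T (kv x) v = ∑ c, v c * ∑ b, kv x b * T b c := by
    intro T
    rw [contract, Finset.sum_comm]
    refine Finset.sum_congr rfl fun c _ => ?_
    rw [Finset.mul_sum]
    exact Finset.sum_congr rfl fun b _ => by ring
  have h0 := h.sum_diff_covDeriv hx hv
  have h1 : ∀ z, ∑ c, v c * (α * z * k x c) = 0 := by
    intro z
    rw [← mul_zero (α * z), ← hv', Finset.mul_sum]
    exact Finset.sum_congr rfl fun c _ => by ring
  rw [hcon, hcon]
  simp only [h.ricci_sub hx, mul_add (kv x _) (ricci gb x _ _), Finset.sum_add_distrib, hE]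
  simp only [mul_add (v _) (∑ b, kv x b * ricci gb x b _), Finset.sum_add_distrib]
  rw [add_eq_left]
  have h2 : ∑ c, v c * (α * ∑ a, ∑ d, christoffel gb a c d x * (k x a * kv x d)) =
      α * ∑ c, v c * ∑ a, ∑ d, christoffel gb a c d x * (k x a * kv x d) := by
    rw [Finset.mul_sum]
    exact Finset.sum_congr rfl fun c _ => by ring
  calc _ = ∑ c, v c * ∑ a, P a c - ∑ c, v c * (∑ a, ∑ d, diff gb k H a c d x *
        (pd a (fun y => kv y d) x + ∑ b, christoffel gb d b a x * kv x b)) -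
        ∑ c, v c * (α * (∑ d, (∑ a, christoffel gb a a d x) * kv x d) * k x c) +
        ∑ c, v c * (α * ∑ a, ∑ d, christoffel gb a c d x * (k x a * kv x d)) := by
        rw [← Finset.sum_sub_distrib, ← Finset.sum_sub_distrib, ← Finset.sum_add_distrib]
        exact Finset.sum_congr rfl fun c _ => by ring
    _ = 0 := by
        rw [h0, h1, h2, hP3]
        ring

end IsKerrSchild
end KerrSchildRicci
end GKS

namespace GKS

/-! ### Types and multiplicity patterns -/

section Types
variable {n : ℕ} {G T : Tensor2 (n + 3)} {κ : Type} {r : κ → Coord (n + 3)} {m : κ → ℕ}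

/-- `r` lists every null direction of `G` exactly once. -/
structure IsNullList (G : Tensor2 (n + 3)) (r : κ → Coord (n + 3)) : Prop where
  isNull : ∀ o, IsNull G (r o)
  inj : ∀ o o', SameDir (r o) (r o') → o = o'
  surj : ∀ l, IsNull G l → ∃ o, SameDir (r o) l

theorem SameDir.trans {n : ℕ} {l l' l'' : Coord n} (h : SameDir l l') (h' : SameDir l' l'') :
    SameDir l l'' := by
  obtain ⟨c, rfl⟩ := h
  obtain ⟨c', rfl⟩ := h'
  exact ⟨c' * c, by rw [smul_smul]⟩

theorem IsNullList.sameDir_iff (hr : IsNullList G r) (o o' : κ) :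
    SameDir (r o) (r o') ↔ o' = o :=
  ⟨fun h => (hr.inj o o' h).symm, fun h => ⟨1, by rw [h, one_smul]⟩⟩

theorem IsNullList.exists_iff (hr : IsNullList G r) {P : Coord (n + 3) → Prop}
    (hP : ∀ l l', SameDir l l' → l ≠ 0 → l' ≠ 0 → (P l ↔ P l')) :
    (∃ l, IsNull G l ∧ P l) ↔ ∃ o, P (r o) := by
  constructor
  · rintro ⟨l, hl, h⟩
    obtain ⟨o, ho⟩ := hr.surj l hl
    exact ⟨o, (hP _ _ ho (hr.isNull o).1 hl.1).mpr h⟩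
  · rintro ⟨o, h⟩
    exact ⟨r o, hr.isNull o, h⟩

theorem IsNullList.forall_iff (hr : IsNullList G r) {P : Coord (n + 3) → Prop}
    (hP : ∀ l l', SameDir l l' → l ≠ 0 → l' ≠ 0 → (P l ↔ P l')) :
    (∀ l, IsNull G l → P l) ↔ ∀ o, P (r o) := by
  constructor
  · exact fun h o => h _ (hr.isNull o)
  · intro h l hl
    obtain ⟨o, ho⟩ := hr.surj l hl
    exact (hP _ _ ho (hr.isNull o).1 hl.1).mp (h o)

theorem SameDir.congr_left {n : ℕ} {l l' v : Coord n} (h : SameDir l l') (hl' : l' ≠ 0) :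
    SameDir l v ↔ SameDir l' v :=
  ⟨fun h' => (h.symm hl').trans h', fun h' => h.trans h'⟩

theorem SameDir.congr_right {n : ℕ} {l l' v : Coord n} (h : SameDir l l') (hl' : l' ≠ 0) :
    SameDir v l ↔ SameDir v l' :=
  ⟨fun h' => h'.trans h, fun h' => h'.trans (h.symm hl')⟩

theorem IsNullList.isMultPattern (hr : IsNullList G r) (hG : IsLorentzian G) (hT : T.IsSymm)
    (hT0 : T ≠ 0) (hm : ∀ o, (m o : ℕ∞) = mult G T (r o)) : IsMultPattern (n + 3) m where
  le_four o := by
    have := mult_le_four hG hT0 (hr.isNull o)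
    rw [← hm] at this
    exact_mod_cast this
  add_le o o' hne := by
    have := mult_add_mult_le_four hG hT0 (hr.isNull o) (hr.isNull o')
      fun h => hne (hr.inj o o' h)
    rw [← hm, ← hm] at this
    exact_mod_cast this
  other o ho := by
    obtain ⟨l, hl, hne, h1⟩ := exists_other_of_mult_eq_one hG hT (hr.isNull o)
      (by rw [← hm, ho]; rfl)
    obtain ⟨o', ho'⟩ := hr.surj l hl
    refine ⟨o', ?_, ?_⟩
    · rintro rfl
      exact hne ho'
    · rw [ho'.mult_eq hl.1, ← hm] at h1
      exact_mod_cast h1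
  three hn o o' o'' hne h h' h'' := by
    obtain rfl : n = 0 := by omega
    refine mult_ne_one_of_two_double hG hT (hr.isNull o) (hr.isNull o') (hr.isNull o'')
      (fun hs => hne (hr.inj o o' hs)) ?_ ?_ ?_
    · rw [← hm, h]; rfl
    · rw [← hm, h']; rfl
    · rw [← hm, h'']; rfl

theorem IsNullList.hasType_iff (hr : IsNullList G r) (hT0 : T ≠ 0)
    (hm : ∀ o, (m o : ℕ∞) = mult G T (r o)) (t : RicciType) : HasType G T t ↔ Pattern m t := by
  have hmul : ∀ (x : ℕ∞) l l', SameDir l l' → l ≠ 0 → l' ≠ 0 →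
      (mult G T l = x ↔ mult G T l' = x) := fun x l l' h _ h0 => by rw [h.mult_eq h0]
  have hle : ∀ (x : ℕ∞) l l', SameDir l l' → l ≠ 0 → l' ≠ 0 →
      (mult G T l ≤ x ↔ mult G T l' ≤ x) := fun x l l' h _ h0 => by rw [h.mult_eq h0]
  have c0 : ∀ o, mult G T (r o) = 0 ↔ m o = 0 := fun o => by rw [← hm]; norm_cast
  have c1 : ∀ o, mult G T (r o) = 1 ↔ m o = 1 := fun o => by rw [← hm]; norm_cast
  have c2 : ∀ o, mult G T (r o) = 2 ↔ m o = 2 := fun o => by rw [← hm]; norm_cast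
  have c3 : ∀ o, mult G T (r o) = 3 ↔ m o = 3 := fun o => by rw [← hm]; norm_cast
  have c4 : ∀ o, mult G T (r o) = 4 ↔ m o = 4 := fun o => by rw [← hm]; norm_cast
  have cl : ∀ o, mult G T (r o) ≤ 1 ↔ m o ≤ 1 := fun o => by rw [← hm]; norm_cast
  have others : ∀ (P : Coord (n + 3) → Prop), (∀ l l', SameDir l l' → l ≠ 0 → l' ≠ 0 →
      (P l ↔ P l')) → ∀ o, (∀ l', IsNull G l' → ¬ SameDir (r o) l' → P l') ↔
      ∀ o', o' ≠ o → P (r o') := by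
    intro P hP o
    rw [hr.forall_iff (P := fun l' => ¬ SameDir (r o) l' → P l') fun l l' h h0 h0' => by
      rw [h.congr_right h0', hP l l' h h0 h0']]
    simp only [hr.sameDir_iff, ne_eq]
  have inv : ∀ (P : Coord (n + 3) → Prop) l l', SameDir l l' → l ≠ 0 → l' ≠ 0 →
      ((∀ v, IsNull G v → ¬ SameDir l v → P v) ↔ ∀ v, IsNull G v → ¬ SameDir l' v → P v) := by
    intro P l l' h h0 h0'
    simp only [h.congr_left h0']
  have pair : ∀ (x : ℕ∞) (y : ℕ), (∀ o, mult G T (r o) = x ↔ m o = y) →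
      ((∃ l l', IsNull G l ∧ IsNull G l' ∧ ¬ SameDir l l' ∧ mult G T l = x ∧ mult G T l' = x) ↔
      ∃ o o', o ≠ o' ∧ m o = y ∧ m o' = y) := by
    intro x y hxy
    constructor
    · rintro ⟨l, l', hl, hl', hne, h, h'⟩
      obtain ⟨o, ho⟩ := hr.surj l hl
      obtain ⟨o', ho'⟩ := hr.surj l' hl'
      refine ⟨o, o', ?_, ?_, ?_⟩
      · rintro rfl
        exact hne ((ho.symm hl.1).trans ho')
      · rw [← hxy, ← ho.mult_eq hl.1, h]
      · rw [← hxy, ← ho'.mult_eq hl'.1, h']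
    · rintro ⟨o, o', hne, h, h'⟩
      exact ⟨r o, r o', hr.isNull o, hr.isNull o', fun hs => hne (hr.inj _ _ hs),
        (hxy o).mpr h, (hxy o').mpr h'⟩
  cases t with
  | G => exact (hr.forall_iff (hmul 0)).trans (forall_congr' c0)
  | I =>
    simp only [HasType, Pattern]
    rw [hr.exists_iff fun l l' h h0 h0' => and_congr (hmul 1 l l' h h0 h0') (inv _ l l' h h0 h0')]
    exact exists_congr fun o => and_congr (c1 o) ((others _ (hmul 0) o).trans
      (forall₂_congr fun o' _ => c0 o'))
  | Ii =>
    exact and_congr (pair 1 1 c1) ((hr.forall_iff (hle 1)).trans (forall_congr' cl))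
  | II =>
    simp only [HasType, Pattern]
    rw [hr.exists_iff fun l l' h h0 h0' => and_congr (hmul 2 l l' h h0 h0') (inv _ l l' h h0 h0')]
    exact exists_congr fun o => and_congr (c2 o) ((others _ (hmul 0) o).trans
      (forall₂_congr fun o' _ => c0 o'))
  | IIi =>
    simp only [HasType, Pattern]
    rw [hr.exists_iff fun l l' h h0 h0' => and_congr (hmul 2 l l' h h0 h0')
      (and_congr Iff.rfl (inv _ l l' h h0 h0'))]
    exact exists_congr fun o => and_congr (c2 o) (and_congr
      ((hr.exists_iff (hmul 1)).trans (exists_congr c1)) ((others _ (hle 1) o).trans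
      (forall₂_congr fun o' _ => cl o')))
  | D => exact pair 2 2 c2
  | III =>
    simp only [HasType, Pattern]
    rw [hr.exists_iff fun l l' h h0 h0' => and_congr (hmul 3 l l' h h0 h0') (inv _ l l' h h0 h0')]
    exact exists_congr fun o => and_congr (c3 o) ((others _ (hmul 0) o).trans
      (forall₂_congr fun o' _ => c0 o'))
  | IIIi =>
    exact and_congr ((hr.exists_iff (hmul 3)).trans (exists_congr c3))
      ((hr.exists_iff (hmul 1)).trans (exists_congr c1))
  | N => exact (hr.exists_iff (hmul 4)).trans (exists_congr c4)
  | O => exact ⟨fun h => hT0 h, False.elim⟩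

/-- The zero tensor has multiplicity `⊤` everywhere, so no finite pattern fits. Nonemptiness
supplies a null direction; without one, type `G` would hold vacuously. -/
theorem IsNullList.hasType_zero_iff [Nonempty κ] (hr : IsNullList G r) (t : RicciType) :
    HasType G 0 t ↔ t = .O := by
  obtain ⟨o⟩ := ‹Nonempty κ›
  constructor
  · intro h
    by_contra hne
    have h0 := hr.isNull o
    cases t <;> simp only [HasType, mult_zero_tensor] at h
    · simpa using h _ h0
    · obtain ⟨l, -, h, -⟩ := h
      exact absurd h (by decide)
    · exact absurd (h.2 _ h0) (by decide)
    · obtain ⟨l, -, h, -⟩ := h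
      exact absurd h (by decide)
    · obtain ⟨l, -, h, -⟩ := h
      exact absurd h (by decide)
    · obtain ⟨l, l', -, -, -, h, -⟩ := h
      exact absurd h (by decide)
    · obtain ⟨l, -, h, -⟩ := h
      exact absurd h (by decide)
    · obtain ⟨⟨l, -, h⟩, -⟩ := h
      exact absurd h (by decide)
    · obtain ⟨l, -, h⟩ := h
      exact absurd h (by decide)
    · exact hne rfl
  · rintro rfl
    rfl

/-- The entries of the table with background type `O` and nonzero full Ricci tensor. -/
theorem IsMultPattern.entry_O {ι : Type} {n : ℕ} {m : Option ι → ℕ} (h : IsMultPattern n m)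
    (h2 : 2 ≤ m none) (kb : ℕ∞) (lb : ι → ℕ∞) : ∃ t, Pattern m t ∧
      RicciTable n kb (m none : ℕ∞) lb (fun l => (m (some l) : ℕ∞)) .O t := by
  obtain ⟨t, ht⟩ := h.exists_pattern
  refine ⟨t, ht, ?_⟩
  have h4 := h.le_four none
  have hadd := h.add_le none
  cases t with
  | G => exact absurd (ht none) (by omega)
  | I =>
    obtain ⟨o, ho, hz⟩ := ht
    by_cases e : none = o
    · subst e; omega
    · have := hz none e; omega
  | Ii => exact absurd (ht.2 none) (by omega)
  | II =>
    obtain ⟨o, ho, hz⟩ := ht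
    by_cases e : none = o
    · exact .O_II (by rw [e, ho]; rfl)
    · have := hz none e; omega
  | IIi =>
    obtain ⟨o, ho, -, hz⟩ := ht
    by_cases e : none = o
    · exact .O_IIi (by rw [e, ho]; rfl)
    · have := hz none e; omega
  | D =>
    obtain ⟨o, o', -, ho, ho'⟩ := ht
    refine .O_D ?_
    have : m none = 2 := by
      by_cases e : none = o
      · rw [e, ho]
      · have := hadd o e; omega
    rw [this]; rfl
  | III =>
    obtain ⟨o, ho, hz⟩ := ht
    by_cases e : none = o
    · exact .O_III (by rw [e, ho]; rfl)
    · have := hz none e; omega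
  | IIIi =>
    obtain ⟨⟨o, ho⟩, -⟩ := ht
    by_cases e : none = o
    · exact .O_IIIi (by rw [e, ho]; rfl)
    · have := hadd o e; omega
  | N =>
    obtain ⟨o, ho⟩ := ht
    by_cases e : none = o
    · exact .O_N (by rw [e, ho]; rfl)
    · have := hadd o e; omega
  | O => exact ht.elim

end Types
end GKS

namespace GKS

/-! ### The isometry between the background and the full metric -/

section Shift
variable {n : ℕ}

/-- The isometry `v ↦ v + H (k · v) k` from `ḡ` to `ḡ - 2 H k ⊗ k`. -/
def ksShift (H : ℝ) (k kv v : Coord n) : Coord n := v + (H * (k ⬝ᵥ v)) • kv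

variable {H : ℝ} {k kv : Coord n}

theorem ksShift_of_orthogonal {v : Coord n} (hv : k ⬝ᵥ v = 0) : ksShift H k kv v = v := by
  simp [ksShift, hv]

theorem ksShift_smul (c : ℝ) (v : Coord n) : ksShift H k kv (c • v) = c • ksShift H k kv v := by
  simp only [ksShift, dotProduct_smul, smul_add, smul_smul, smul_eq_mul]
  congr 2
  ring

/-- Nullity of `k` leaves `k · v` unchanged by the shift, so the opposite sign of `H` inverts it. -/
theorem ksShift_neg_ksShift (hn : k ⬝ᵥ kv = 0) (v : Coord n) :
    ksShift H k kv (ksShift (-H) k kv v) = v := by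
  have : k ⬝ᵥ ksShift (-H) k kv v = k ⬝ᵥ v := by
    rw [ksShift, dotProduct_add, dotProduct_smul, hn, smul_zero, add_zero]
  rw [ksShift, this, ksShift]
  module

theorem ksShift_ne_zero (hn : k ⬝ᵥ kv = 0) {v : Coord n} (hv : v ≠ 0) : ksShift H k kv v ≠ 0 := by
  intro h
  have := ksShift_neg_ksShift (H := -H) hn v
  rw [neg_neg, h] at this
  exact hv (by rw [← this]; simp [ksShift])

theorem SameDir.ksShift {v w : Coord n} (h : SameDir v w) (H : ℝ) :
    SameDir (ksShift H k kv v) (ksShift H k kv w) := by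
  obtain ⟨c, rfl⟩ := h
  exact ⟨c, ksShift_smul c v⟩

end Shift

/-! ### Generalized Kerr–Schild families -/

namespace Family
variable {n J : ℕ} {U : Set (Coord (n + 3))} (S : Family (n + 3) J U)

theorem metric : IsMetricOn U S.gbar where
  smooth := S.gbar_smooth
  symm x hx := (S.gbar_lorentzian x hx).isSymm
  det x hx := (S.gbar_lorentzian x hx).isUnit_det

theorem H_smoothFam {μ : Fin J → Coord (n + 3) → ℝ} (hμ : μ ∈ S.params) :
    SmoothFam U fun t => S.H (t • μ) := S.H_smooth μ hμ

theorem isKerrSchild (hU : IsOpen U) (hgeo : S.IsGeodesic) {μ : Fin J → Coord (n + 3) → ℝ}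
    (hμ : μ ∈ S.params) : IsKerrSchild U S.gbar S.k (S.H μ) where
  isOpen := hU
  metric := S.metric
  k_smooth := S.k_smooth
  H_smooth := by simpa using (S.H_smoothFam hμ).slice (t := 1) (by simp)
  null x hx := by rw [← contract_eq]; exact S.k_null x hx
  geodesic x hx := by
    obtain ⟨f, hf⟩ := hgeo x hx
    exact ⟨f, funext hf⟩

variable {p : Coord (n + 3)} (hp : p ∈ U)

/-- The isometry from `ḡ` to `g_μ` at `p`. -/
noncomputable def shift (μ : Fin J → Coord (n + 3) → ℝ) (p v : Coord (n + 3)) : Coord (n + 3) :=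
  ksShift (S.H μ p) (S.k p) (S.kVec p) v

include hp

theorem k_dot_kVec : S.k p ⬝ᵥ S.kVec p = 0 := by
  have := S.k_null p hp
  rwa [contract_eq] at this

theorem contract_kVec (v : Coord (n + 3)) : contract (S.gbar p) (S.kVec p) v = S.k p ⬝ᵥ v := by
  rw [contract_comm (S.metric.symm p hp), contract_eq, dotProduct_comm]
  congr 1
  change S.gbar p *ᵥ ((S.gbar p)⁻¹ *ᵥ S.k p) = _
  rw [Matrix.mulVec_mulVec, Matrix.mul_nonsing_inv _ (S.metric.det p hp), Matrix.one_mulVec]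

theorem kVec_ne_zero : S.kVec p ≠ 0 := by
  intro h
  refine S.k_ne_zero p hp (funext fun a => ?_)
  have := S.contract_kVec hp (Pi.single a 1)
  rw [h] at this
  simpa using this.symm

theorem isNull_kVec : IsNull (S.gbar p) (S.kVec p) :=
  ⟨S.kVec_ne_zero hp, by rw [S.contract_kVec hp, S.k_dot_kVec hp]⟩

omit hp in
theorem contract_g (μ : Fin J → Coord (n + 3) → ℝ) (v w : Coord (n + 3)) :
    contract (S.g μ p) v w = contract (S.gbar p) v w - 2 * S.H μ p * (S.k p ⬝ᵥ v) * (S.k p ⬝ᵥ w) := by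
  have : S.g μ p = S.gbar p - (2 * S.H μ p) • Matrix.vecMulVec (S.k p) (S.k p) :=
    ksMetric_eq S.gbar S.k (S.H μ) p
  rw [contract_eq, contract_eq, this, Matrix.sub_mulVec, dotProduct_sub, Matrix.smul_mulVec,
    Matrix.vecMulVec_mulVec]
  simp only [smul_dotProduct, op_smul_eq_smul, smul_eq_mul, dotProduct_comm v]
  ring

theorem k_dot_shift (μ : Fin J → Coord (n + 3) → ℝ) (v : Coord (n + 3)) :
    S.k p ⬝ᵥ S.shift μ p v = S.k p ⬝ᵥ v := by
  simp [shift, ksShift, S.k_dot_kVec hp]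

/-- The two cross terms add `2H (k · v)(k · w)` to the background product, which is exactly what
`-2H k ⊗ k` removes; the quadratic term vanishes because `k` is null. -/
theorem contract_shift (μ : Fin J → Coord (n + 3) → ℝ) (v w : Coord (n + 3)) :
    contract (S.g μ p) (S.shift μ p v) (S.shift μ p w) = contract (S.gbar p) v w := by
  have h := fun u : Coord (n + 3) => contract_comm (S.metric.symm p hp) u (S.kVec p)
  rw [S.contract_g, S.k_dot_shift hp, S.k_dot_shift hp, shift, ksShift, shift, ksShift]
  simp only [contract_add_left, contract_add_right, contract_smul_left, contract_smul_right,
    h, S.contract_kVec hp, dotProduct_add, dotProduct_smul, S.k_dot_kVec hp, smul_zero]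
  ring

theorem g_lorentzian (μ : Fin J → Coord (n + 3) → ℝ) : IsLorentzian (S.g μ p) := by
  obtain ⟨e, he⟩ := S.gbar_lorentzian p hp
  exact ⟨fun a => S.shift μ p (e a), fun a b => by rw [S.contract_shift hp, he]⟩

theorem isNullFrame_shift {F : Fin (n + 3) → Coord (n + 3)} (hF : IsNullFrame (S.gbar p) F)
    (μ : Fin J → Coord (n + 3) → ℝ) : IsNullFrame (S.g μ p) fun a => S.shift μ p (F a) :=
  fun a b => by rw [S.contract_shift hp, hF]

theorem shift_kVec (μ : Fin J → Coord (n + 3) → ℝ) : S.shift μ p (S.kVec p) = S.kVec p :=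
  ksShift_of_orthogonal (S.k_dot_kVec hp)

omit hp in
theorem shift_dir (μ : Fin J → Coord (n + 3) → ℝ) (l : S.Dir p) :
    S.shift μ p l.1 = S.lift μ p l := by
  have : S.k p ⬝ᵥ l.1 = 1 := l.2.2
  simp [shift, ksShift, lift, this]

theorem shift_surj (μ : Fin J → Coord (n + 3) → ℝ) (v : Coord (n + 3)) :
    ∃ w, S.shift μ p w = v :=
  ⟨_, ksShift_neg_ksShift (S.k_dot_kVec hp) v⟩

/-! #### Limits `μ → 0` -/

/-- The Ricci components are built from metric components, their derivatives and the inverse metric,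
all jointly smooth in `(t, x)` up to `t = 0`. The shift tends to the identity because `H` tends to
zero. -/
theorem tendsto_contract (hU : IsOpen U) {μ : Fin J → Coord (n + 3) → ℝ} (hμ : μ ∈ S.params)
    (v w : Coord (n + 3)) :
    Filter.Tendsto (fun t : ℝ => contract (ricci (S.g (t • μ)) p) (S.shift (t • μ) p v)
      (S.shift (t • μ) p w)) (nhdsWithin 0 (Set.Icc 0 1)) (nhds (contract (ricci S.gbar p) v w)) := by
  have hH := S.H_smoothFam hμ
  have hg : ∀ a b, SmoothFam U fun t x => S.g (t • μ) x a b := fun a b => by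
    simp only [g, Matrix.of_apply]
    exact (SmoothFam.of_contDiffOn (S.gbar_smooth a b)).sub ((((SmoothFam.const 2).mul hH).mul
      (.of_contDiffOn (S.k_smooth a))).mul (.of_contDiffOn (S.k_smooth b)))
  have hR : ∀ b c, Filter.Tendsto (fun t : ℝ => ricci (S.g (t • μ)) p b c)
      (nhdsWithin 0 (Set.Icc 0 1)) (nhds (ricci S.gbar p b c)) := by
    intro b c
    have h := (SmoothFam.ricci hU hg
      (fun t _ x hx => (S.g_lorentzian hx (t • μ)).isUnit_det) b c).tendsto hp
    -- Equality on the whole open set `U`, not only at `p`, is needed for the derivatives to agree.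
    have e : ∀ x ∈ U, S.g ((0 : ℝ) • μ) x = S.gbar x := fun x hx => by
      ext a b
      simp [g, S.H_zero x hx]
    have hinv : ∀ a b, ∀ x ∈ U, (S.g ((0 : ℝ) • μ) x)⁻¹ a b = (S.gbar x)⁻¹ a b :=
      fun a b x hx => by rw [e x hx]
    have hC : ∀ a b c, ∀ x ∈ U,
        christoffel (S.g ((0 : ℝ) • μ)) a b c x = christoffel S.gbar a b c x := by
      intro a b c x hx
      have hpd : ∀ c a b, pd c (fun y => S.g ((0 : ℝ) • μ) y a b) x =
          pd c (fun y => S.gbar y a b) x := fun c a b =>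
        pd_congr hU hx fun y hy => by rw [e y hy]
      simp only [christoffel, hinv _ _ x hx, hpd]
    have hpC : ∀ e a b c, pd e (christoffel (S.g ((0 : ℝ) • μ)) a b c) p =
        pd e (christoffel S.gbar a b c) p := fun e a b c => pd_congr hU hp (hC a b c)
    have hlim : ricci (S.g ((0 : ℝ) • μ)) p b c = ricci S.gbar p b c := by
      simp only [ricci, Matrix.of_apply, hC _ _ _ p hp, hpC]
    rwa [hlim] at h
  have hshift : ∀ (v : Coord (n + 3)) a, Filter.Tendsto (fun t : ℝ => S.shift (t • μ) p v a)
      (nhdsWithin 0 (Set.Icc 0 1)) (nhds (v a)) := by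
    intro v a
    have h := hH.tendsto hp
    rw [zero_smul, S.H_zero p hp] at h
    have := ((h.mul_const (S.k p ⬝ᵥ v)).mul_const (S.kVec p a)).const_add (v a)
    simpa [shift, ksShift] using this
  exact tendsto_finsetSum _ fun a _ => tendsto_finsetSum _ fun b _ =>
    ((hR a b).mul (hshift v a)).mul (hshift w b)

/-- The multiplicity can only increase in the limit `μ → 0`. -/
theorem le_multBg (hU : IsOpen U) {μ : Fin J → Coord (n + 3) → ℝ} (hμ : μ ∈ S.params) {χ : ℕ∞}
    {l : Coord (n + 3)} (hl : IsNull (S.gbar p) l)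
    (h : ∀ t ∈ Set.Ioc (0 : ℝ) 1, χ ≤ S.multFull (t • μ) p (S.shift (t • μ) p l)) :
    χ ≤ S.multBg p l := by
  obtain ⟨F, hF, rfl⟩ := (S.gbar_lorentzian p hp).exists_nullFrame_of_isNull hl
  refine ENat.forall_natCast_le_iff_le.mp fun m hm => ?_
  rw [multBg, le_mult_iff, hF.alignedToOrder_iff]
  intro a b hab
  -- Zero is a limit point of `(0, 1]`, so the limit of components that vanish there is unique and
  -- equal to zero.
  have hne : (nhdsWithin (0 : ℝ) (Set.Ioc 0 1)).NeBot := by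
    rw [← mem_closure_iff_nhdsWithin_neBot, closure_Ioc zero_ne_one]
    simp
  refine tendsto_nhds_unique (((S.tendsto_contract hp hU hμ (F a) (F b)).mono_left
    (nhdsWithin_mono _ Set.Ioc_subset_Icc_self))) ?_
  refine (tendsto_const_nhds (x := (0 : ℝ))).congr' ?_
  filter_upwards [self_mem_nhdsWithin] with t ht
  have := le_mult_iff.mp (hm.trans (h t ht))
  exact ((S.isNullFrame_shift hp hF (t • μ)).alignedToOrder_iff.mp this a b hab).symm

end Family
end GKS

/-! ### Comparison of null directions and the theorem for generic parameters -/

namespace GKS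
namespace Family
variable {n J : ℕ} {U : Set (Coord (n + 3))} (S : Family (n + 3) J U) {p : Coord (n + 3)}

/-- The vector representing a null direction of `ḡ`; `none` stands for `k`. -/
noncomputable def dirVec (p : Coord (n + 3)) : Option (S.Dir p) → Coord (n + 3)
  | none => S.kVec p
  | some l => l.1

/-- A null vector orthogonal to `k` is parallel to `k`; any other one has a unique multiple with
product 1 with `k`. -/
theorem isNullList_dirVec (hp : p ∈ U) : IsNullList (S.gbar p) (S.dirVec p) where
  isNull := by
    rintro (_ | l)
    · exact S.isNull_kVec hp
    · exact l.2.1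
  inj := by
    have hd : ∀ l : S.Dir p, S.k p ⬝ᵥ l.1 = 1 := fun l => l.2.2
    have hk := S.k_dot_kVec hp
    rintro (_ | l) (_ | l') ⟨c, hc⟩
    · rfl
    · have := hd l'
      change l'.1 = c • S.kVec p at hc
      rw [hc, dotProduct_smul, hk, smul_zero] at this
      exact absurd this zero_ne_one
    · have h0 : c = 0 := by
        change S.kVec p = c • l.1 at hc
        rwa [hc, dotProduct_smul, hd, smul_eq_mul, mul_one] at hk
      change S.kVec p = c • l.1 at hc
      rw [h0, zero_smul] at hc
      exact absurd hc (S.kVec_ne_zero hp)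
    · change l'.1 = c • l.1 at hc
      have h1 : c = 1 := by
        have := hd l'
        rwa [hc, dotProduct_smul, hd, smul_eq_mul, mul_one] at this
      rw [h1, one_smul] at hc
      exact congrArg some (Subtype.ext hc.symm)
  surj l hl := by
    by_cases h : S.k p ⬝ᵥ l = 0
    · exact ⟨none, (S.gbar_lorentzian p hp).sameDir_of_orthogonal (S.isNull_kVec hp) hl
        ((S.contract_kVec hp l).trans h)⟩
    · refine ⟨some ⟨(S.k p ⬝ᵥ l)⁻¹ • l, ⟨smul_ne_zero (inv_ne_zero h) hl.1, ?_⟩, ?_⟩,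
        S.k p ⬝ᵥ l, ?_⟩
      · rw [contract_smul_left, contract_smul_right, hl.2, mul_zero, mul_zero]
      · change S.k p ⬝ᵥ ((S.k p ⬝ᵥ l)⁻¹ • l) = 1
        rw [dotProduct_smul, smul_eq_mul, inv_mul_cancel₀ h]
      · exact (smul_inv_smul₀ h l).symm

theorem isNull_shift (hp : p ∈ U) (μ : Fin J → Coord (n + 3) → ℝ) {l : Coord (n + 3)}
    (hl : IsNull (S.gbar p) l) : IsNull (S.g μ p) (S.shift μ p l) :=
  ⟨ksShift_ne_zero (S.k_dot_kVec hp) hl.1, by rw [S.contract_shift hp, hl.2]⟩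

theorem isNullList_shift (hp : p ∈ U) (μ : Fin J → Coord (n + 3) → ℝ)
    {κ : Type} {r : κ → Coord (n + 3)} (hr : IsNullList (S.gbar p) r) :
    IsNullList (S.g μ p) fun o => S.shift μ p (r o) where
  isNull o := S.isNull_shift hp μ (hr.isNull o)
  inj o o' h := by
    refine hr.inj o o' ?_
    have e : ∀ v, ksShift (-S.H μ p) (S.k p) (S.kVec p) (S.shift μ p v) = v := fun v => by
      have := ksShift_neg_ksShift (H := -S.H μ p) (S.k_dot_kVec hp) v
      rwa [neg_neg] at this
    have := h.ksShift (k := S.k p) (kv := S.kVec p) (-S.H μ p)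
    rwa [e, e] at this
  surj l hl := by
    obtain ⟨w, rfl⟩ := S.shift_surj hp μ l
    have hw : IsNull (S.gbar p) w := by
      refine ⟨?_, by rw [← S.contract_shift hp μ, hl.2]⟩
      rintro rfl
      exact hl.1 (by simp [shift, ksShift])
    obtain ⟨o, ho⟩ := hr.surj w hw
    exact ⟨o, ho.ksShift _⟩

variable {S} in
/-- In the limit `μ → 0` the alignment of a null direction with the Ricci tensor for generic
parameters cannot be lost. -/
theorem IsGeneric.multFull_le_multBg (hU : IsOpen U) (hp : p ∈ U)
    {μ : Fin J → Coord (n + 3) → ℝ} (hμ : S.IsGeneric p μ) (o : Option (S.Dir p)) :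
    S.multFull μ p (S.shift μ p (S.dirVec p o)) ≤ S.multBg p (S.dirVec p o) := by
  refine S.le_multBg hp hU hμ.1 ((S.isNullList_dirVec hp).isNull o) fun t ht => ?_
  -- Genericity is used here: the multiplicity at `μ` is a lower bound along the whole ray, so it
  -- survives in the limit.
  have h := hμ.2.2 (t • μ) (S.params_scale μ hμ.1 t (Set.Ioc_subset_Icc_self ht))
    (smul_ne_zero ht.1.ne' hμ.2.1)
  rcases o with _ | l
  · simpa only [dirVec, S.shift_kVec hp] using h.1
  · simpa only [dirVec, S.shift_dir] using h.2 l

section Ricci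
variable (hU : IsOpen U) (hgeo : S.IsGeodesic) (hp : p ∈ U) {μ : Fin J → Coord (n + 3) → ℝ}
  (hμ : μ ∈ S.params)
include hU hgeo hp hμ

theorem ricci_g_isSymm : (ricci (S.g μ) p).IsSymm :=
  (S.isKerrSchild hU hgeo hμ).metric_ksMetric.ricci_symm hU hp

theorem contract_ricci_g {v : Coord (n + 3)} (hv : S.k p ⬝ᵥ v = 0) :
    contract (ricci (S.g μ) p) (S.kVec p) v = contract (ricci S.gbar p) (S.kVec p) v :=
  (S.isKerrSchild hU hgeo hμ).contract_ricci hp (S.k_ne_zero p hp)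
    (by rwa [dotProduct_comm])

theorem one_le_multFull_kVec (h : 1 ≤ S.multBg p (S.kVec p)) :
    1 ≤ S.multFull μ p (S.kVec p) := by
  have hn := S.isNull_shift hp μ (S.isNull_kVec hp)
  rw [S.shift_kVec hp] at hn
  rw [multFull, one_le_mult_iff (S.g_lorentzian hp μ) hn,
    S.contract_ricci_g hU hgeo hp hμ (S.k_dot_kVec hp)]
  exact (one_le_mult_iff (S.gbar_lorentzian p hp) (S.isNull_kVec hp)).mp h

/-- The relevant components pair `k` with frame vectors `F b`, `b ≠ 1`. These are orthogonal to `k`,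
so the shift fixes them and the two Ricci tensors agree on the pairs. -/
theorem two_le_multFull_kVec (h : 2 ≤ S.multBg p (S.kVec p)) :
    2 ≤ S.multFull μ p (S.kVec p) := by
  obtain ⟨F, hF, h0⟩ := (S.gbar_lorentzian p hp).exists_nullFrame_of_isNull (S.isNull_kVec hp)
  have hF' := S.isNullFrame_shift hp hF μ
  rw [← h0, multBg, hF.two_le_mult_iff (S.metric.ricci_symm hU hp)] at h
  have h' := hF'.two_le_mult_iff (S.ricci_g_isSymm hU hgeo hp hμ)
  simp only [h0, S.shift_kVec hp] at h' h
  refine h'.mpr fun b hb => ?_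
  have hk : S.k p ⬝ᵥ F b = 0 := by
    rw [← S.contract_kVec hp, ← h0, hF]
    have : b.val ≠ 1 := fun e => hb (Fin.ext e)
    by_cases e : b = 0
    · subst e; simp
    · simp [this, Ne.symm e]
  rw [shift, ksShift_of_orthogonal hk, S.contract_ricci_g hU hgeo hp hμ hk, h b hb]

end Ricci

theorem le_multBg_kVec (hU : IsOpen U) (hp : p ∈ U) {τ : ℕ∞}
    (h : ∀ μ ∈ S.params, μ ≠ 0 → τ ≤ S.multFull μ p (S.kVec p)) :
    τ ≤ S.multBg p (S.kVec p) := by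
  obtain ⟨μ, hμ, h0⟩ := S.params_nontrivial
  refine S.le_multBg hp hU hμ (S.isNull_kVec hp) fun t ht => ?_
  rw [S.shift_kVec hp]
  exact h _ (S.params_scale μ hμ t (Set.Ioc_subset_Icc_self ht)) (smul_ne_zero ht.1.ne' h0)

theorem le_multBg_of_forall (hU : IsOpen U) (hp : p ∈ U) {χ : ℕ∞} {lbar : Coord (n + 3)}
    {l : (Fin J → Coord (n + 3) → ℝ) → Coord (n + 3)}
    (h : ∀ μ ∈ S.params, μ ≠ 0 →
      IsNull (S.g μ p) (l μ) ∧ S.k p ⬝ᵥ l μ = 1 ∧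
      l μ - S.H μ p • S.kVec p = lbar ∧ χ ≤ S.multFull μ p (l μ)) :
    IsNull (S.gbar p) lbar ∧ χ ≤ S.multBg p lbar := by
  obtain ⟨μ, hμ, h0⟩ := S.params_nontrivial
  have hk : S.k p ⬝ᵥ lbar = 1 := by
    obtain ⟨-, h1, h2, -⟩ := h μ hμ h0
    rw [← h2, dotProduct_sub, dotProduct_smul, S.k_dot_kVec hp, h1, smul_zero, sub_zero]
  -- With `k · l̄ = 1`, independence of `l̄` from the parameters says that the whole family `l`
  -- consists of shifts of one background vector.
  have hl : ∀ ν ∈ S.params, ν ≠ 0 → S.shift ν p lbar = l ν := fun ν hν hν0 => by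
    rw [shift, ksShift, hk, mul_one, ← (h ν hν hν0).2.2.1, sub_add_cancel]
  have hnull : IsNull (S.gbar p) lbar := by
    refine ⟨?_, ?_⟩
    · rintro rfl
      simp at hk
    · rw [← S.contract_shift hp μ, hl μ hμ h0, (h μ hμ h0).1.2]
  refine ⟨hnull, S.le_multBg hp hU hμ hnull fun t ht => ?_⟩
  have hν := S.params_scale μ hμ t (Set.Ioc_subset_Icc_self ht)
  have hν0 : t • μ ≠ 0 := smul_ne_zero ht.1.ne' h0
  rw [hl _ hν hν0]
  exact (h _ hν hν0).2.2.2

/-- The Ricci types for generic parameters. -/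
theorem exists_ricciTable (hU : IsOpen U) (hgeo : S.IsGeodesic) (hp : p ∈ U)
    {μ : Fin J → Coord (n + 3) → ℝ} (hμ : S.IsGeneric p μ) :
    ∃ tb tf : RicciType,
      (∀ t, HasType (S.gbar p) (ricci S.gbar p) t ↔ t = tb) ∧
      (∀ t, HasType (S.g μ p) (ricci (S.g μ) p) t ↔ t = tf) ∧
      RicciTable (n + 3) (S.multBg p (S.kVec p)) (S.multFull μ p (S.kVec p))
        (fun l : S.Dir p => S.multBg p l.1)
        (fun l : S.Dir p => S.multFull μ p (S.lift μ p l)) tb tf := by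
  have hrb := S.isNullList_dirVec hp
  have hrf := S.isNullList_shift hp μ hrb
  have hGf := S.g_lorentzian hp μ
  have hTf := S.ricci_g_isSymm hU hgeo hp hμ.1
  have hTb := S.metric.ricci_symm hU hp
  have htype : ∀ {G T : Tensor2 (n + 3)} {r : Option (S.Dir p) → Coord (n + 3)}
      {m : Option (S.Dir p) → ℕ} {t₀ : RicciType}, IsNullList G r → IsLorentzian G → T.IsSymm →
      T ≠ 0 → (∀ o, (m o : ℕ∞) = mult G T (r o)) → Pattern m t₀ →
      ∀ t, HasType G T t ↔ t = t₀ := by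
    intro G T r m t₀ hr hG hT hT0 hm ht₀ t
    rw [hr.hasType_iff hT0 hm]
    exact ⟨fun ht => (hr.isMultPattern hG hT hT0 hm).unique ht ht₀, fun h => h ▸ ht₀⟩
  have hfull : ∀ (m : Option (S.Dir p) → ℕ),
      (∀ o, (m o : ℕ∞) = mult (S.g μ p) (ricci (S.g μ) p) (S.shift μ p (S.dirVec p o))) →
      S.multFull μ p (S.kVec p) = m none ∧
      (fun l : S.Dir p => S.multFull μ p (S.lift μ p l)) = fun l => (m (some l) : ℕ∞) := by
    intro m hm
    refine ⟨?_, funext fun l => ?_⟩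
    · rw [hm, dirVec, S.shift_kVec hp, multFull]
    · rw [hm, dirVec, S.shift_dir, multFull]
  -- Multiplicities of a nonzero tensor are finite, so the value of `toNat` at `⊤` plays no role.
  have hnat : ∀ {G T : Tensor2 (n + 3)} {r : Option (S.Dir p) → Coord (n + 3)},
      IsNullList G r → IsLorentzian G → T ≠ 0 →
      ∀ o, ((mult G T (r o)).toNat : ℕ∞) = mult G T (r o) := fun hr hG hT0 o =>
    ENat.natCast_toNat (ne_top_of_le_ne_top (by decide) (mult_le_four hG hT0 (hr.isNull o)))
  by_cases hb0 : ricci S.gbar p = 0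
  · have htb : ∀ t, HasType (S.gbar p) (ricci S.gbar p) t ↔ t = .O := by
      rw [hb0]
      exact hrb.hasType_zero_iff
    by_cases hf0 : ricci (S.g μ) p = 0
    · refine ⟨.O, .O, htb, ?_, .O_O⟩
      rw [hf0]
      exact hrf.hasType_zero_iff
    · have hm := hnat hrf hGf hf0
      obtain ⟨e1, e2⟩ := hfull _ hm
      have h2 := S.two_le_multFull_kVec hU hgeo hp hμ.1
        (by rw [multBg, hb0, mult_zero_tensor]; exact le_top)
      rw [e1] at h2
      obtain ⟨tf, htf, hR⟩ := (hrf.isMultPattern hGf hTf hf0 hm).entry_O (by exact_mod_cast h2)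
        (S.multBg p (S.kVec p)) fun l : S.Dir p => S.multBg p l.1
      refine ⟨.O, tf, htb, htype hrf hGf hTf hf0 hm htf, ?_⟩
      rw [e1, e2]
      exact hR
  · have hGb := S.gbar_lorentzian p hp
    have hmb := hnat hrb hGb hb0
    have hle := hμ.multFull_le_multBg hU hp
    -- A vanishing full Ricci tensor would give `k` infinite multiplicity, exceeding the background
    -- bound of 4.
    have hf0 : ricci (S.g μ) p ≠ 0 := fun hf0 => by
      have h1 := hle none
      rw [multFull, hf0, mult_zero_tensor] at h1
      exact absurd (h1.trans (mult_le_four hGb hb0 (hrb.isNull none))) (by decide)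
    have hmf := hnat hrf hGf hf0
    obtain ⟨e1, e2⟩ := hfull _ hmf
    have hk1 := S.one_le_multFull_kVec hU hgeo hp hμ.1
    have hk2 := S.two_le_multFull_kVec hU hgeo hp hμ.1
    have eb : S.multBg p (S.kVec p) = _ := (hmb none).symm
    have eb' : (fun l : S.Dir p => S.multBg p l.1) = fun l => _ :=
      funext fun l => (hmb (some l)).symm
    rw [e1, eb] at hk1 hk2
    have hdeg : IsDegeneration (n + 3)
        (fun o => (mult (S.gbar p) (ricci S.gbar p) (S.dirVec p o)).toNat)
        (fun o => (mult (S.g μ p) (ricci (S.g μ) p) (S.shift μ p (S.dirVec p o))).toNat) :=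
      { bg := hrb.isMultPattern hGb hTb hb0 hmb
        full := hrf.isMultPattern hGf hTf hf0 hmf
        le := fun o => by
          have := hle o
          rw [multFull, multBg, ← hmb, ← hmf] at this
          exact_mod_cast this
        k_one := fun h => by exact_mod_cast hk1 (by exact_mod_cast h)
        k_two := fun h => by exact_mod_cast hk2 (by exact_mod_cast h) }
    obtain ⟨tb, htb⟩ := hdeg.bg.exists_pattern
    obtain ⟨tf, htf, hR⟩ := hdeg.hasEntry htb
    refine ⟨tb, tf, htype hrb hGb hTb hb0 hmb htb, htype hrf hGf hTf hf0 hmf htf, ?_⟩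
    rw [e1, e2, eb, eb']
    exact hR

end Family
end GKS

theorem mainTheorem4 {n J : ℕ} (hn : 3 ≤ n) {U : Set (GKS.Coord n)} (hU : IsOpen U)
    (S : GKS.Family n J U) (hgeo : S.IsGeodesic) {p : GKS.Coord n} (hp : p ∈ U) :
    -- the direction `k`
    (∀ τ : ℕ∞, 1 ≤ τ →
      (∀ μ ∈ S.params, μ ≠ 0 → τ ≤ S.multFull μ p (S.kVec p)) →
      τ ≤ S.multBg p (S.kVec p)) ∧
    -- a direction `l ≠ k`, normalized by `l · k = 1`, with `l̄ = l - H k`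
    (∀ (χ : ℕ∞) (lbar : GKS.Coord n) (l : (Fin J → GKS.Coord n → ℝ) → GKS.Coord n), 1 ≤ χ →
      (∀ μ ∈ S.params, μ ≠ 0 →
        GKS.IsNull (S.g μ p) (l μ) ∧ ∑ a, S.k p a * l μ a = 1 ∧
        l μ - S.H μ p • S.kVec p = lbar ∧ χ ≤ S.multFull μ p (l μ)) →
      GKS.IsNull (S.gbar p) lbar ∧ χ ≤ S.multBg p lbar) ∧
    -- the algebraic types
    (∀ μ, S.IsGeneric p μ →
      ∃ tb tf : GKS.RicciType,
        (∀ t, GKS.HasType (S.gbar p) (GKS.ricci S.gbar p) t ↔ t = tb) ∧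
        (∀ t, GKS.HasType (S.g μ p) (GKS.ricci (S.g μ) p) t ↔ t = tf) ∧
        tf.rank ≤ tb.rank ∧
        GKS.RicciTable n
          (S.multBg p (S.kVec p)) (S.multFull μ p (S.kVec p))
          (fun l : S.Dir p => S.multBg p l.1)
          (fun l : S.Dir p => S.multFull μ p (S.lift μ p l)) tb tf) := by
  -- Writing the dimension as `m + 3` makes the frame indices `0` and `1` available as literals.
  obtain ⟨n, rfl⟩ : ∃ m, n = m + 3 := ⟨n - 3, by omega⟩
  refine ⟨fun τ _ h => S.le_multBg_kVec hU hp h, fun χ lbar l _ h => S.le_multBg_of_forall hU hp h,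
    fun μ hμ => ?_⟩
  obtain ⟨tb, tf, hb, hf, hR⟩ := S.exists_ricciTable hU hgeo hp hμ
  exact ⟨tb, tf, hb, hf, hR.rank_le, hR⟩
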